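/- **Theorem 4.2 (uniform rate of the Nadaraya–Watson estimator under local stationarity).** Let $d\ge 1$. On a probability space consider the model $$Y_{t,T}=m\big(\tfrac tT,X_{t,T}\big)+\varepsilon_{t,T},\qquad E[\varepsilon_{t,T}\mid X_{t,T}]=0,\qquad 1\le t\le T,\ T\ge1,$$ with $X_{t,T}=(X^1_{t,T},\dots,X^d_{t,T})\in\mathbb R^d$ and $Y_{t,T},\varepsilon_{t,T}\in\mathbb R$. For an array $\{Z_{t,T}\}$ let $\alpha(k)=\sup_{1\le t\le T-k}\ \sup\{|P(B\cap C)-P(B)P(C)| : B\in\sigma(Z_{s,T},1\le s\le t),\ C\in\sigma(Z_{s,T},t+k\le s\le T)\}$; the array is $\alpha$-mixing if $\alpha(k)\to0$. Assume: * (C1) For each $u\in[0,1]$ there is a strictly stationary process $\{X_t(u)\}_{t\in\mathbb Z}$ with density $f(u,\cdot)=f_{X_t(u)}$ such that a.s. $\|X_{t,T}-X_t(u)\|\le(|\tfrac tT-u|+\tfrac1T)\,U_{t,T}(u)$, where $U_{t,T}(u)>0$ and $E[U_{t,T}(u)^\rho]\le C$ for some $\rho>0$ and $C<\infty$ independent of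 $u,t,T$. * (C2), (C4) $f$ has first partial derivatives with respect to $u\in[0,1]$ and with respect to each $x^j$, and they are continuous on $[0,1]\times\mathbb R^d$. * (C3) The array $\{X_{t,T},\varepsilon_{t,T}\}$ is $\alpha$-mixing. * (C5) $m$ is twice continuously differentiable on $[0,1]\times\mathbb R^d$. * (C6) $K:\mathbb R\to\mathbb R$ has $\int K=1$, is symmetric about zero, bounded, Lipschitz, and $K(v)=0$ for $|v|>C_1$. Assume moreover that for some $s>2$ and some $\beta$ the following hold both for $W_{t,T}=1$ and for $W_{t,T}=\varepsilon_{t,T}$: * (K0) $E|W_{t,T}|^s\le C$ for all $1\le t\le T$, with $C<\infty$. * (K1) $\{X_{t,T},W_{t,T}\}$ is $\alpha$-mixing with $\alpha(k)\le A k^{-\beta}$ for $k\ge1$, where $A<\infty$ and $\beta>\frac{2s-2}{s-2}$. * (K2) $X_{t,T}$ has a density $f_{X_{t,T}}$, and for every compact $S'\subset\mathbb R^d$ there are $C<\infty$ and $l^*\in\mathbb N$ such that for all $t,T$ and $x\in S'$: $f_{X_{t,T}}(x)\le C$ and $E[|W_{t,T}|^s\mid X_{t,T}=x]\,f_{X_{t,T}}(x)\le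 C$; and for all $l\ge l^*$, all $t\ge 1$ and $T\ge t+l$, the pair $(X_{t,T},X_{t+l,T})$ has a density with $E[|W_{t,T}||W_{t+l,T}|\mid X_{t,T}=x,X_{t+l,T}=x']\,f_{X_{t,T},X_{t+l,T}}(x,x')\le C$ for all $x,x'\in S'$. Let $\beta>\frac{2+s(1+(d+1))}{s-2}$ and $\theta=\frac{\beta(1-2/s)-2/s-1-(d+1)}{\beta+3-(d+1)}$, let $S\subset\mathbb R^d$ be compact with $\inf_{u\in[0,1],x\in S}f(u,x)>0$, and let $r=\min\{\rho,1\}$. Let the bandwidths $h=h_T>0$ satisfy $h\le C\,T^{-\xi}$ for some $C,\xi>0$ and $$\frac{(\log\log T)\log T}{T^\theta h^{d+1}}=o(1),\qquad \frac1{T^rh^{d+r}}=o(1)\qquad(T\to\infty).$$ With $K_h(v)=K(v/h)$ let $$\hat m(u,x)=\frac{\sum_{t=1}^TK_h(u-\frac tT)\prod_{j=1}^dK_h(x^j-X^j_{t,T})\,Y_{t,T}}{\sum_{t=1}^TK_h(u-\frac tT)\prod_{j=1}^dK_h(x^j-X^j_{t,T})}.$$ Then, as $T\to\infty$, $$\sup_{u\in[C_1h,\,1-C_1h],\,x\in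 S}|\hat m(u,x)-m(u,x)|=O_p\Big(\sqrt{\tfrac{\log T}{Th^{d+1}}}+\frac1{T^rh^d}+h^2\Big).$$ -/

import Mathlib

open MeasureTheory ProbabilityTheory Filter Topology Set
open scoped ENNReal NNReal

noncomputable section

namespace LocStat

/-- The real function `f` is a (measurable, nonnegative) Lebesgue density of the random variable
`Z` under `P`. -/
def IsDensity {Ω E : Type*} [MeasurableSpace Ω] [MeasureSpace E] (P : Measure Ω)
    (Z : Ω → E) (f : E → ℝ) : Prop :=
  Measurable f ∧ (∀ z, 0 ≤ f z) ∧
    P.map Z = (volume : Measure E).withDensity (fun z => ENNReal.ofReal (f z))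

/-- `g` is a version of the regression function `z ↦ 𝔼[V | Z = z]`, for an integrable `V`. -/
def IsCondExpGiven {Ω E : Type*} [MeasurableSpace Ω] [MeasurableSpace E] (P : Measure Ω)
    (V : Ω → ℝ) (Z : Ω → E) (g : E → ℝ) : Prop :=
  Integrable V P ∧ Measurable g ∧
    P[V | MeasurableSpace.comap Z inferInstance] =ᵐ[P] fun ω => g (Z ω)

/-! ### Mixing of triangular arrays

An array `Z = {Z_{t,T} : 1 ≤ t ≤ T}` is a function `Z : ℕ → ℕ → Ω → E`, `Z t T` standing for
`Z_{t,T}`; only the indices with `1 ≤ t ≤ T` matter. -/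

/-- The coefficient `α(𝓑, 𝓒) = sup |P(B ∩ C) - P(B) P(C)|` over `B ∈ 𝓑`, `C ∈ 𝓒`. -/
def alphaCoeff {Ω : Type*} [MeasurableSpace Ω] (P : Measure Ω) (m₁ m₂ : MeasurableSpace Ω) :
    ℝ≥0∞ :=
  ⨆ (B : Set Ω) (_ : MeasurableSet[m₁] B) (C : Set Ω) (_ : MeasurableSet[m₂] C),
    ENNReal.ofReal |P.real (B ∩ C) - P.real B * P.real C|

/-- The σ-field generated by `Z_{s,T}`, `a ≤ s ≤ b`. -/
abbrev sigmaField {Ω E : Type*} [MeasurableSpace E] (Z : ℕ → ℕ → Ω → E) (T a b : ℕ) :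
    MeasurableSpace Ω :=
  ⨆ s ∈ Set.Icc a b, MeasurableSpace.comap (Z s T) inferInstance

/-- The mixing coefficients `α(k)` of an array: the supremum over all `t, T` with
`1 ≤ t ≤ T - k` of `α(σ(Z_{s,T}, 1 ≤ s ≤ t), σ(Z_{s,T}, t + k ≤ s ≤ T))`. -/
def alphaMix {Ω E : Type*} [MeasurableSpace Ω] [MeasurableSpace E] (P : Measure Ω)
    (Z : ℕ → ℕ → Ω → E) (k : ℕ) : ℝ≥0∞ :=
  ⨆ (t : ℕ) (T : ℕ) (_ : 1 ≤ t ∧ t + k ≤ T),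
    alphaCoeff P (sigmaField Z T 1 t) (sigmaField Z T (t + k) T)

/-- The array is `α`-mixing (strongly mixing). -/
def IsAlphaMixing {Ω E : Type*} [MeasurableSpace Ω] [MeasurableSpace E] (P : Measure Ω)
    (Z : ℕ → ℕ → Ω → E) : Prop :=
  Tendsto (alphaMix P Z) atTop (𝓝 0)

/-! ### Local stationarity -/

/-- Strict stationarity of a process indexed by `ℤ`: its law on the path space is invariant
under all time shifts. -/
def StrictlyStationary {Ω E : Type*} [MeasurableSpace Ω] [MeasurableSpace E] (P : Measure Ω)
    (Z : ℤ → Ω → E) : Prop :=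
  (∀ t, Measurable (Z t)) ∧
    ∀ k : ℤ, P.map (fun ω (t : ℤ) => Z (t + k) ω) = P.map (fun ω (t : ℤ) => Z t ω)

/-- The array `X` is locally stationary with associated processes `X_t(u) = Xs u t`, `u ∈ [0,1]`,
densities `f u` of `X_t(u)`, and moment exponent `ρ`. The norm is the maximum norm on `ℝ^d`; as
the constant `C` is free, the choice of the norm is immaterial. -/
def LocallyStationary {Ω : Type*} [MeasurableSpace Ω] (P : Measure Ω) {d : ℕ}
    (X : ℕ → ℕ → Ω → (Fin d → ℝ)) (Xs : ℝ → ℤ → Ω → (Fin d → ℝ))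
    (f : ℝ → (Fin d → ℝ) → ℝ) (ρ : ℝ) : Prop :=
  (∀ u ∈ Icc (0 : ℝ) 1, StrictlyStationary P (Xs u) ∧ ∀ t, IsDensity P (Xs u t) (f u)) ∧
  0 < ρ ∧
  ∃ (U : ℕ → ℕ → ℝ → Ω → ℝ) (C : ℝ≥0), ∀ u ∈ Icc (0 : ℝ) 1, ∀ t T : ℕ, 1 ≤ t → t ≤ T →
    Measurable (U t T u) ∧ (∀ ω, 0 < U t T u ω) ∧
    ∫⁻ ω, ENNReal.ofReal (U t T u ω ^ ρ) ∂P ≤ C ∧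
    ∀ᵐ ω ∂P, ‖X t T ω - Xs u t ω‖ ≤ (|(t : ℝ) / T - u| + 1 / T) * U t T u ω

/-! ### Smoothness conditions -/

/-- `f` is differentiable in `u ∈ [0,1]` (one-sidedly at the endpoints) for each `x`, and
`∂₀ f` is continuous on `[0,1] × ℝ^d`. -/
def SmoothInTime {d : ℕ} (f : ℝ → (Fin d → ℝ) → ℝ) : Prop :=
  ∃ D : ℝ → (Fin d → ℝ) → ℝ,
    ContinuousOn (fun p : ℝ × (Fin d → ℝ) => D p.1 p.2) (Icc 0 1 ×ˢ univ) ∧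
    ∀ u ∈ Icc (0 : ℝ) 1, ∀ x, HasDerivWithinAt (fun v => f v x) (D u x) (Icc 0 1) u

/-- For each `u ∈ [0,1]` the function `f u` has all first partial derivatives in `x`, and
`∂_j f` is continuous on `[0,1] × ℝ^d` for each `j`. -/
def SmoothInSpace {d : ℕ} (f : ℝ → (Fin d → ℝ) → ℝ) : Prop :=
  ∀ j : Fin d, ∃ D : ℝ → (Fin d → ℝ) → ℝ,
    ContinuousOn (fun p : ℝ × (Fin d → ℝ) => D p.1 p.2) (Icc 0 1 ×ˢ univ) ∧
    ∀ u ∈ Icc (0 : ℝ) 1, ∀ x,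
      HasDerivAt (fun v => f u (Function.update x j v)) (D u x) (x j)

/-- Conditions on the kernel: integral one, symmetric, bounded, supported in `[-C₁, C₁]`,
Lipschitz. -/
def IsKernel (K : ℝ → ℝ) (C₁ : ℝ) : Prop :=
  (∫ v, K v = 1) ∧ (∀ v, K (-v) = K v) ∧ (∃ B, ∀ v, |K v| ≤ B) ∧
  (∀ v, C₁ < |v| → K v = 0) ∧ ∃ L : ℝ≥0, LipschitzWith L K

/-! ### Moment, mixing and density conditions on an array `(X_{t,T}, W_{t,T})` -/

/-- `𝔼|W_{t,T}|^s ≤ C` for a constant `C`. -/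
def MomentCond {Ω : Type*} [MeasurableSpace Ω] (P : Measure Ω) (W : ℕ → ℕ → Ω → ℝ) (s : ℝ) :
    Prop :=
  2 < s ∧ ∃ C : ℝ≥0, ∀ t T : ℕ, 1 ≤ t → t ≤ T → ∫⁻ ω, ENNReal.ofReal (|W t T ω| ^ s) ∂P ≤ C

/-- `{X_{t,T}, W_{t,T}}` is `α`-mixing with `α(k) ≤ A k^{-β}` and `β > (2s-2)/(s-2)`. -/
def MixingCond {Ω : Type*} [MeasurableSpace Ω] (P : Measure Ω) {d : ℕ}
    (X : ℕ → ℕ → Ω → (Fin d → ℝ)) (W : ℕ → ℕ → Ω → ℝ) (s β : ℝ) : Prop :=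
  IsAlphaMixing P (fun t T ω => (X t T ω, W t T ω)) ∧
  (∃ A : ℝ, ∀ k : ℕ, 1 ≤ k →
    alphaMix P (fun t T ω => (X t T ω, W t T ω)) k ≤ ENNReal.ofReal (A * (k : ℝ) ^ (-β))) ∧
  (2 * s - 2) / (s - 2) < β

/-- Bounds, uniform on compact sets, on `f_{X_{t,T}}`, on `𝔼[|W_{t,T}|^s | X_{t,T}] f_{X_{t,T}}`
and, at all lags `l ≥ l*`, on
`𝔼[|W_{t,T}| |W_{t+l,T}| | X_{t,T}, X_{t+l,T}] f_{X_{t,T},X_{t+l,T}}`. The bounds hold for suitable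
versions of the densities and regression functions, which are unique almost everywhere only. -/
def DensityCond {Ω : Type*} [MeasurableSpace Ω] (P : Measure Ω) {d : ℕ}
    (X : ℕ → ℕ → Ω → (Fin d → ℝ)) (W : ℕ → ℕ → Ω → ℝ) (s : ℝ) : Prop :=
  ∃ p g : ℕ → ℕ → (Fin d → ℝ) → ℝ,
    (∀ t T : ℕ, 1 ≤ t → t ≤ T →
      IsDensity P (X t T) (p t T) ∧
      IsCondExpGiven P (fun ω => |W t T ω| ^ s) (X t T) (g t T)) ∧
    ∀ S : Set (Fin d → ℝ), IsCompact S → ∃ C : ℝ,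
      (∀ t T : ℕ, 1 ≤ t → t ≤ T → ∀ x ∈ S, p t T x ≤ C ∧ g t T x * p t T x ≤ C) ∧
      ∃ lstar : ℕ, ∀ l ≥ lstar, ∀ t T : ℕ, 1 ≤ t → t + l ≤ T →
        ∃ q k : (Fin d → ℝ) × (Fin d → ℝ) → ℝ,
          IsDensity P (fun ω => (X t T ω, X (t + l) T ω)) q ∧
          IsCondExpGiven P (fun ω => |W t T ω| * |W (t + l) T ω|)
            (fun ω => (X t T ω, X (t + l) T ω)) k ∧
          ∀ x ∈ S, ∀ x' ∈ S, k (x, x') * q (x, x') ≤ C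

/-! ### The model and the estimator -/

/-- The regression model `Y_{t,T} = m(t/T, X_{t,T}) + ε_{t,T}` with
`𝔼[ε_{t,T} | X_{t,T}] = 0`, for `1 ≤ t ≤ T`. -/
def IsModel {Ω : Type*} [MeasurableSpace Ω] (P : Measure Ω) {d : ℕ}
    (X : ℕ → ℕ → Ω → (Fin d → ℝ)) (Y ε : ℕ → ℕ → Ω → ℝ) (m : ℝ → (Fin d → ℝ) → ℝ) : Prop :=
  ∀ t T : ℕ, 1 ≤ t → t ≤ T →
    Measurable (X t T) ∧ Measurable (ε t T) ∧
    (∀ᵐ ω ∂P, Y t T ω = m ((t : ℝ) / T) (X t T ω) + ε t T ω) ∧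
    Integrable (ε t T) P ∧
    P[ε t T | MeasurableSpace.comap (X t T) inferInstance] =ᵐ[P] 0

/-- The weight `K_h(u - t/T) ∏_j K_h(x^j - X_{t,T}^j)`, where `K_h(v) = K(v/h)`. -/
def weight {Ω : Type*} {d : ℕ} (K : ℝ → ℝ) (X : ℕ → ℕ → Ω → (Fin d → ℝ)) (h : ℝ)
    (u : ℝ) (x : Fin d → ℝ) (t T : ℕ) (ω : Ω) : ℝ :=
  K ((u - (t : ℝ) / T) / h) * ∏ j : Fin d, K ((x j - X t T ω j) / h)

/-- The Nadaraya–Watson estimator `m̂(u,x)` from `T` observations with bandwidth `h`. -/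
def nadarayaWatson {Ω : Type*} {d : ℕ} (K : ℝ → ℝ) (X : ℕ → ℕ → Ω → (Fin d → ℝ))
    (Y : ℕ → ℕ → Ω → ℝ) (h : ℝ) (T : ℕ) (u : ℝ) (x : Fin d → ℝ) (ω : Ω) : ℝ :=
  (∑ t ∈ Finset.Icc 1 T, weight K X h u x t T ω * Y t T ω) /
    ∑ t ∈ Finset.Icc 1 T, weight K X h u x t T ω

/-- `Z_T = O_p(a_T)` for a sequence of `[0,∞]`-valued functions on the probability space (`P` of
an event is its outer probability, so no measurability is presupposed). -/
def IsBigOInProb {Ω : Type*} [MeasurableSpace Ω] (P : Measure Ω) (Z : ℕ → Ω → ℝ≥0∞)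
    (a : ℕ → ℝ) : Prop :=
  ∀ δ : ℝ, 0 < δ → ∃ M : ℝ, 0 < M ∧ ∀ᶠ T : ℕ in atTop,
    P {ω | ENNReal.ofReal (M * a T) < Z T ω} ≤ ENNReal.ofReal δ

/-- The exponent `θ` in the bandwidth condition. -/
def theta (d : ℕ) (s β : ℝ) : ℝ :=
  (β * (1 - 2 / s) - 2 / s - 1 - ((d : ℝ) + 1)) / (β + 3 - ((d : ℝ) + 1))

end LocStat

end

/-! Write w_t for the kernel weights, a = √(log T / (T h^{d+1})) and S = T h^{d+1}. The estimation
error is Σ w_t (Y_t - m(u,x)) divided by D = Σ w_t. Its numerator splits (`sum_weight_mul_sub_eq`)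
into centred kernel sums of the arrays ε, m(t/T, X) and 1, plus a deterministic bias sum. Three
facts suffice, all uniform in (u, x): the centred sums are O_p(a S), the bias sum is O((1/(T^r h^d)
+ h²) S), and D ≥ (c/2) S with high probability for large T, where c is the lower bound of f.
`isBigOInProb_nadarayaWatson` puts them together.

Centred sums (`exists_uniform_rate`). W is truncated at a multiple of T^{1/s}, and the supremum is
reduced to a grid of mesh a h; the oscillation between grid points is dominated by a sum of the same
type with a box kernel (`abs_deviation_sub_le`). At a grid point an exponential inequality is
applied to blocks of length L ≈ 1/(T^{1/s} a). It rests on a supermartingale: for nonnegative Y_i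
the products ∏ Y_i exp(1 - E[Y_i | F_i]) have mean at most 1 because x e^{1-x} ≤ 1, and strong
mixing makes E[Y_i | F_i] close to E Y_i in L¹. Taking every second block leaves gaps of length L.
The variance entering the inequality is of order S: about T h indices are active, and their
covariances are at most h^d times a summable function of the lag (`exists_covariance_bound`), by
interpolation between the joint density bound and Davydov's inequality. The number of grid points
times the mixing error is, up to constants, a positive power of log T / (T^θ h^{d+1}) divided by log
T (`cover_mul_mixing_eq`); this is where θ comes from.

Bias (`exists_bias_le`). Replacing X_{t,T} by the stationary X_t(t/T) costs T^{-r} times a power of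
the Lipschitz constant of the integrand. This constant is of order 1/h for the bare kernel, but of
order 1 once the kernel is multiplied by m(t/T, ·) - m(u, x), which is O(h) on its support. A second
order expansion then leaves O(h²): the linear term in space vanishes by symmetry of the kernel, and
the linear term in time nearly vanishes after summation over t, by a Riemann sum estimate away from
the boundary. -/

noncomputable section

namespace LocStat

/-! ### Covariance bounds under strong mixing -/

/-- The real number `a` bounds `|P(B ∩ C) - P(B) P(C)|` for `B ∈ m₁`, `C ∈ m₂`. -/
def MixBound {Ω : Type*} {mΩ : MeasurableSpace Ω} (P : Measure Ω) (m₁ m₂ : MeasurableSpace Ω)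
    (a : ℝ) : Prop :=
  ∀ B C : Set Ω, MeasurableSet[m₁] B → MeasurableSet[m₂] C →
    |P.real (B ∩ C) - P.real B * P.real C| ≤ a

section Mixing

variable {Ω : Type*} {mΩ : MeasurableSpace Ω} {P : Measure Ω}

theorem MixBound.mono {m₁ m₂ n₁ n₂ : MeasurableSpace Ω} {a : ℝ} (h : MixBound P m₁ m₂ a)
    (h₁ : n₁ ≤ m₁) (h₂ : n₂ ≤ m₂) : MixBound P n₁ n₂ a :=
  fun B C hB hC => h B C (h₁ B hB) (h₂ C hC)

theorem mixBound_of_alphaCoeff_le {m₁ m₂ : MeasurableSpace Ω} {a : ℝ} (ha : 0 ≤ a)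
    (h : @alphaCoeff Ω mΩ P m₁ m₂ ≤ ENNReal.ofReal a) : MixBound P m₁ m₂ a := by
  intro B C hB hC
  rw [← ENNReal.ofReal_le_ofReal_iff ha]
  refine le_trans ?_ h
  unfold alphaCoeff
  exact le_iSup₂_of_le B hB (le_iSup₂_of_le C hC le_rfl)

theorem mixBound_bot_left [IsProbabilityMeasure P] {m : MeasurableSpace Ω} {a : ℝ} (ha : 0 ≤ a) :
    MixBound P ⊥ m a := by
  intro B C hB _
  rcases MeasurableSpace.measurableSet_bot_iff.1 hB with rfl | rfl <;> simpa using ha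

theorem mixBound_bot_right [IsProbabilityMeasure P] {m : MeasurableSpace Ω} {a : ℝ} (ha : 0 ≤ a) :
    MixBound P m ⊥ a := by
  intro B C _ hC
  rcases MeasurableSpace.measurableSet_bot_iff.1 hC with rfl | rfl <;> simpa using ha

/-- A centred variable has positive and negative parts of equal integral, so its L¹ norm is twice
its integral over the set where it is nonnegative. For the centred conditional expectation this set
lies in `m`, and conditioning can be undone on it. -/
theorem exists_integral_abs_condExp_sub [IsProbabilityMeasure P] {m : MeasurableSpace Ω}
    (hm : m ≤ mΩ) {g : Ω → ℝ} (hg : Integrable g P) :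
    ∃ B, MeasurableSet[m] B ∧
      ∫ ω, |P[g | m] ω - ∫ ω', g ω' ∂P| ∂P = 2 * (∫ ω in B, g ω ∂P - P.real B * ∫ ω, g ω ∂P) := by
  set c := ∫ ω', g ω' ∂P with hc
  set B : Set Ω := {ω | c ≤ P[g | m] ω} with hB
  have hBm : MeasurableSet[m] B :=
    measurableSet_le (measurable_const) (stronglyMeasurable_condExp.measurable)
  refine ⟨B, hBm, ?_⟩
  have hBm' := hm B hBm
  have hint : Integrable (fun ω => P[g | m] ω - c) P := integrable_condExp.sub (integrable_const c)
  have hzero : ∫ ω, (P[g | m] ω - c) ∂P = 0 := by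
    rw [integral_sub integrable_condExp (integrable_const c), integral_condExp hm]
    simp [hc]
  have h1 : ∫ ω in B, |P[g | m] ω - c| ∂P = ∫ ω in B, (P[g | m] ω - c) ∂P :=
    setIntegral_congr_fun hBm' fun ω hω => abs_of_nonneg (sub_nonneg.2 hω)
  have h2 : ∫ ω in Bᶜ, |P[g | m] ω - c| ∂P = -∫ ω in Bᶜ, (P[g | m] ω - c) ∂P := by
    rw [← integral_neg]
    refine setIntegral_congr_fun hBm'.compl fun ω hω => abs_of_nonpos ?_
    have : ¬ c ≤ P[g | m] ω := hω
    linarith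
  have h3 := integral_add_compl hBm' hint
  have h4 := integral_add_compl hBm' hint.abs
  have h5 : ∫ ω in B, (P[g | m] ω - c) ∂P = ∫ ω in B, g ω ∂P - P.real B * c := by
    rw [integral_sub integrable_condExp.integrableOn (integrable_const c).integrableOn,
      setIntegral_condExp hm hg hBm]
    simp
  rw [← h4, h1, h2, ← h5]
  linarith

/-- `exists_integral_abs_condExp_sub` is used twice, each time gaining a factor 2. For `g` given
`m₁` it produces a set `B` in `m₁`; after transferring the conditioning to the indicator of `B`
given `m₂`, it produces `C` in `m₂`, and what remains is P(B ∩ C) - P(B) P(C). -/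
theorem MixBound.integral_abs_condExp_sub_le [IsProbabilityMeasure P] {m₁ m₂ : MeasurableSpace Ω}
    {a : ℝ} (h : MixBound P m₁ m₂ a) (h₁ : m₁ ≤ mΩ) (h₂ : m₂ ≤ mΩ) {g : Ω → ℝ} {b : ℝ}
    (hg : Measurable[m₂] g) (hb : ∀ ω, |g ω| ≤ b) :
    ∫ ω, |P[g | m₁] ω - ∫ ω', g ω' ∂P| ∂P ≤ 4 * b * a := by
  have hb0 : 0 ≤ b := (abs_nonneg _).trans (hb (Classical.choice (nonempty_of_isProbabilityMeasure P)))
  have hgint : Integrable g P := Integrable.of_bound (hg.mono h₂ le_rfl).aestronglyMeasurable b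
    (ae_of_all _ hb)
  obtain ⟨B, hB, hBe⟩ := exists_integral_abs_condExp_sub h₁ hgint
  have hBm := h₁ B hB
  have hind : Integrable (B.indicator fun _ => (1 : ℝ)) P := (integrable_const 1).indicator hBm
  obtain ⟨C, hC, hCe⟩ := exists_integral_abs_condExp_sub h₂ hind
  have hCm := h₂ C hC
  have e1 : ∫ ω, B.indicator (fun _ => (1 : ℝ)) ω ∂P = P.real B := by
    rw [integral_indicator hBm]; simp
  have e2 : ∫ ω in C, B.indicator (fun _ => (1 : ℝ)) ω ∂P = P.real (B ∩ C) := by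
    rw [integral_indicator hBm, Measure.restrict_restrict hBm]; simp
  rw [e1] at hCe
  rw [e2] at hCe
  have hmul : Integrable (fun ω => g ω * B.indicator (fun _ => (1 : ℝ)) ω) P :=
    hind.bdd_mul (hg.mono h₂ le_rfl).aestronglyMeasurable (ae_of_all _ hb)
  have e3 : ∫ ω in B, g ω ∂P = ∫ ω, g ω * P[B.indicator fun _ => (1 : ℝ) | m₂] ω ∂P := by
    rw [← integral_indicator hBm]
    have : B.indicator g = fun ω => g ω * B.indicator (fun _ => (1 : ℝ)) ω := by
      ext ω; by_cases hω : ω ∈ B <;> simp [hω]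
    rw [this, ← integral_condExp h₂]
    exact integral_congr_ae (condExp_mul_of_stronglyMeasurable_left
      (hg.stronglyMeasurable) hmul hind)
  have e4 : ∫ ω in B, g ω ∂P - P.real B * ∫ ω, g ω ∂P
      = ∫ ω, g ω * (P[B.indicator fun _ => (1 : ℝ) | m₂] ω - P.real B) ∂P := by
    simp_rw [mul_sub]
    rw [integral_sub (integrable_condExp.bdd_mul (hg.mono h₂ le_rfl).aestronglyMeasurable
      (ae_of_all _ hb)) (hgint.mul_const _), e3, integral_mul_const]
    ring
  have e5 : ∫ ω, g ω * (P[B.indicator fun _ => (1 : ℝ) | m₂] ω - P.real B) ∂P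
      ≤ ∫ ω, b * |P[B.indicator fun _ => (1 : ℝ) | m₂] ω - P.real B| ∂P := by
    have hi : Integrable (fun ω => P[B.indicator fun _ => (1 : ℝ) | m₂] ω - P.real B) P :=
      integrable_condExp.sub (integrable_const _)
    refine integral_mono (hi.bdd_mul (hg.mono h₂ le_rfl).aestronglyMeasurable
      (ae_of_all _ hb)) (hi.abs.const_mul b) fun ω => ?_
    refine (le_abs_self _).trans ?_
    rw [abs_mul]
    exact mul_le_mul_of_nonneg_right (hb ω) (abs_nonneg _)
  rw [integral_const_mul, hCe] at e5
  have e6 := (abs_le.1 (h B C hB hC)).2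
  rw [hBe, e4]
  nlinarith [mul_le_mul_of_nonneg_left e6 hb0]

theorem MixBound.abs_covariance_le [IsProbabilityMeasure P] {m₁ m₂ : MeasurableSpace Ω}
    {a : ℝ} (h : MixBound P m₁ m₂ a) (h₁ : m₁ ≤ mΩ) (h₂ : m₂ ≤ mΩ) {f g : Ω → ℝ} {b c : ℝ}
    (hf : Measurable[m₁] f) (hg : Measurable[m₂] g) (hb : ∀ ω, |f ω| ≤ b) (hc : ∀ ω, |g ω| ≤ c) :
    |∫ ω, f ω * g ω ∂P - (∫ ω, f ω ∂P) * ∫ ω, g ω ∂P| ≤ 4 * b * c * a := by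
  have hb0 : 0 ≤ b := (abs_nonneg _).trans (hb (Classical.choice (nonempty_of_isProbabilityMeasure P)))
  have hfint : Integrable f P := Integrable.of_bound (hf.mono h₁ le_rfl).aestronglyMeasurable b
    (ae_of_all _ hb)
  have hgint : Integrable g P := Integrable.of_bound (hg.mono h₂ le_rfl).aestronglyMeasurable c
    (ae_of_all _ hc)
  have hfae := (hf.mono h₁ le_rfl).aestronglyMeasurable (μ := P)
  have e1 : ∫ ω, f ω * g ω ∂P = ∫ ω, f ω * P[g | m₁] ω ∂P := by
    rw [← integral_condExp h₁]
    exact integral_congr_ae (condExp_mul_of_stronglyMeasurable_left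
      (hf.stronglyMeasurable) (hgint.bdd_mul hfae (ae_of_all _ hb)) hgint)
  have e2 : ∫ ω, f ω * g ω ∂P - (∫ ω, f ω ∂P) * ∫ ω, g ω ∂P
      = ∫ ω, f ω * (P[g | m₁] ω - ∫ ω', g ω' ∂P) ∂P := by
    simp_rw [mul_sub]
    rw [integral_sub (integrable_condExp.bdd_mul hfae (ae_of_all _ hb)) (hfint.mul_const _), e1,
      integral_mul_const]
  have hi : Integrable (fun ω => P[g | m₁] ω - ∫ ω', g ω' ∂P) P :=
    integrable_condExp.sub (integrable_const _)
  rw [e2]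
  calc |∫ ω, f ω * (P[g | m₁] ω - ∫ ω', g ω' ∂P) ∂P|
      ≤ ∫ ω, |f ω * (P[g | m₁] ω - ∫ ω', g ω' ∂P)| ∂P := abs_integral_le_integral_abs
    _ ≤ ∫ ω, b * |P[g | m₁] ω - ∫ ω', g ω' ∂P| ∂P := by
        refine integral_mono (hi.bdd_mul hfae (ae_of_all _ hb)).abs (hi.abs.const_mul b)
          fun ω => ?_
        rw [abs_mul]
        exact mul_le_mul_of_nonneg_right (hb ω) (abs_nonneg _)
    _ ≤ b * (4 * c * a) := by
        rw [integral_const_mul]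
        exact mul_le_mul_of_nonneg_left (h.integral_abs_condExp_sub_le h₁ h₂ hg hc) hb0
    _ = 4 * b * c * a := by ring

end Mixing

/-! ### An exponential inequality for strongly mixing sequences -/

section Exponential

variable {Ω : Type*} {mΩ : MeasurableSpace Ω} {P : Measure Ω}

/-- The partial products form a supermartingale: conditionally on `F n` the new factor has mean x
e^{1-x} ≤ 1, with x = E[Y n | F n] ≥ 0. No independence or coupling is needed, since the dependence
is carried by the compensator. -/
theorem integral_prod_mul_exp_one_sub_condExp_le [IsProbabilityMeasure P]
    {F : ℕ → MeasurableSpace Ω} (hF : ∀ i, F i ≤ mΩ) (hmono : Monotone F)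
    {Y : ℕ → Ω → ℝ} (hY : ∀ i, Measurable[F (i + 1)] (Y i)) {c : ℝ}
    (h0 : ∀ i ω, 0 ≤ Y i ω) (hc : ∀ i ω, Y i ω ≤ c) (n : ℕ) :
    Integrable (fun ω => ∏ i ∈ Finset.range n, (Y i ω * Real.exp (1 - P[Y i | F i] ω))) P ∧
    ∫ ω, ∏ i ∈ Finset.range n, (Y i ω * Real.exp (1 - P[Y i | F i] ω)) ∂P ≤ 1 := by
  set G : ℕ → Ω → ℝ := fun n ω => ∏ i ∈ Finset.range n,
    (Y i ω * Real.exp (1 - P[Y i | F i] ω)) with hG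
  suffices Measurable[F n] (G n) ∧ (∀ᵐ ω ∂P, 0 ≤ G n ω ∧ G n ω ≤ (c * Real.exp 1) ^ n) ∧
      ∫ ω, G n ω ∂P ≤ 1 by
    refine ⟨?_, this.2.2⟩
    refine Integrable.of_bound (this.1.mono (hF n) le_rfl).aestronglyMeasurable
      ((c * Real.exp 1) ^ n) ?_
    filter_upwards [this.2.1] with ω hω
    rw [Real.norm_eq_abs, abs_of_nonneg hω.1]
    exact hω.2
  induction n with
  | zero =>
    refine ⟨?_, ae_of_all _ fun ω => by simp [hG], by simp [hG]⟩
    simp only [hG, Finset.range_zero, Finset.prod_empty]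
    exact measurable_const
  | succ n ih =>
    obtain ⟨hm, hbd, hint⟩ := ih
    have hYint : Integrable (Y n) P := Integrable.of_bound
      ((hY n).mono (hF _) le_rfl).aestronglyMeasurable c
      (ae_of_all _ fun ω => by rw [Real.norm_eq_abs, abs_of_nonneg (h0 n ω)]; exact hc n ω)
    have hce : Measurable[F n] (P[Y n | F n]) := stronglyMeasurable_condExp.measurable
    have hce0 : 0 ≤ᵐ[P] P[Y n | F n] := condExp_nonneg (ae_of_all _ (h0 n))
    have hstep : ∀ ω, G (n + 1) ω = (G n ω * Real.exp (1 - P[Y n | F n] ω)) * Y n ω := by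
      intro ω
      simp only [hG, Finset.prod_range_succ]
      ring
    have hm' : Measurable[F n] fun ω => G n ω * Real.exp (1 - P[Y n | F n] ω) :=
      hm.mul (Real.measurable_exp.comp (measurable_const.sub hce))
    have hbd' : ∀ᵐ ω ∂P, 0 ≤ G n ω * Real.exp (1 - P[Y n | F n] ω) ∧
        G n ω * Real.exp (1 - P[Y n | F n] ω) ≤ (c * Real.exp 1) ^ n * Real.exp 1 := by
      filter_upwards [hbd, hce0] with ω h1 h2
      have h2' : 0 ≤ P[Y n | F n] ω := h2
      refine ⟨mul_nonneg h1.1 (Real.exp_pos _).le, ?_⟩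
      refine mul_le_mul h1.2 (Real.exp_le_exp.2 (by linarith)) (Real.exp_pos _).le
        (h1.1.trans h1.2)
    have hnorm : ∀ᵐ ω ∂P, ‖G n ω * Real.exp (1 - P[Y n | F n] ω)‖
        ≤ (c * Real.exp 1) ^ n * Real.exp 1 := by
      filter_upwards [hbd'] with ω h1
      rw [Real.norm_eq_abs, abs_of_nonneg h1.1]
      exact h1.2
    have haesm := (hm'.mono (hF n) le_rfl).aestronglyMeasurable (μ := P)
    refine ⟨?_, ?_, ?_⟩
    · simp_rw [funext hstep]
      exact (hm'.mono (hmono n.le_succ) le_rfl).mul (hY n)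
    · filter_upwards [hbd'] with ω h1
      rw [hstep]
      refine ⟨mul_nonneg h1.1 (h0 n ω), ?_⟩
      calc _ ≤ (c * Real.exp 1) ^ n * Real.exp 1 * c :=
            mul_le_mul h1.2 (hc n ω) (h0 n ω) (h1.1.trans h1.2)
        _ = _ := by ring
    · simp_rw [hstep]
      rw [← integral_condExp (hF n)]
      have hpull : P[(fun ω => G n ω * Real.exp (1 - P[Y n | F n] ω)) * Y n | F n] =ᵐ[P]
          (fun ω => G n ω * Real.exp (1 - P[Y n | F n] ω)) * P[Y n | F n] :=
        condExp_mul_of_stronglyMeasurable_left hm'.stronglyMeasurable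
          (hYint.bdd_mul haesm hnorm) hYint
      refine (integral_congr_ae hpull).trans_le (le_trans ?_ hint)
      refine integral_mono_ae (integrable_condExp.bdd_mul haesm hnorm) ?_ ?_
      · refine Integrable.of_bound (hm.mono (hF n) le_rfl).aestronglyMeasurable
          ((c * Real.exp 1) ^ n) ?_
        filter_upwards [hbd] with ω hω
        rw [Real.norm_eq_abs, abs_of_nonneg hω.1]
        exact hω.2
      · filter_upwards [hbd] with ω h1
        simp only [Pi.mul_apply]
        have h2 : P[Y n | F n] ω ≤ Real.exp (P[Y n | F n] ω - 1) := by
          have := Real.add_one_le_exp (P[Y n | F n] ω - 1)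
          linarith
        calc G n ω * Real.exp (1 - P[Y n | F n] ω) * P[Y n | F n] ω
            ≤ G n ω * Real.exp (1 - P[Y n | F n] ω) * Real.exp (P[Y n | F n] ω - 1) :=
              mul_le_mul_of_nonneg_left h2 (mul_nonneg h1.1 (Real.exp_pos _).le)
          _ = G n ω := by
              rw [mul_assoc, ← Real.exp_add]
              simp

theorem measureReal_le_integral_div [IsProbabilityMeasure P] {g : Ω → ℝ} (hg : Integrable g P)
    (h0 : 0 ≤ᵐ[P] g) {c : ℝ} (hc : 0 < c) : P.real {ω | c ≤ g ω} ≤ (∫ ω, g ω ∂P) / c := by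
  rw [le_div_iff₀ hc, mul_comm]
  exact mul_meas_ge_le_integral_of_nonneg h0 hg c

/-- Markov's inequality for the product of the compensated factors exp(l V_i) gives the term
exp(-x). The compensator exceeds its deterministic counterpart, at most `l ^ 2 * v`, by no more than
an error `R` whose L¹ norm is controlled by mixing; the event `R ≥ 1` accounts for the second term
of the bound and for the `+ 1` in the threshold. -/
theorem measureReal_sum_block_ge_le [IsProbabilityMeasure P]
    {F G : ℕ → MeasurableSpace Ω} (hF : ∀ i, F i ≤ mΩ) (hG : ∀ i, G i ≤ mΩ) (hmono : Monotone F)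
    {V : ℕ → Ω → ℝ} (hV : ∀ i, Measurable[F (i + 1)] (V i)) (hVG : ∀ i, Measurable[G i] (V i))
    {a b l v : ℝ} (hmix : ∀ i, MixBound P (F i) (G i) a)
    (hb : ∀ i ω, |V i ω| ≤ b) (hl : 0 ≤ l) (hlb : l * b ≤ 1) (hzero : ∀ i, ∫ ω, V i ω ∂P = 0)
    {n : ℕ} (hv : ∑ i ∈ Finset.range n, ∫ ω, V i ω ^ 2 ∂P ≤ v) (x : ℝ) :
    P.real {ω | x + 1 + l ^ 2 * v ≤ l * ∑ i ∈ Finset.range n, V i ω}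
      ≤ Real.exp (-x) + n * (4 * Real.exp 1 * a) := by
  have hVm : ∀ i, Measurable (V i) := fun i => (hV i).mono (hF _) le_rfl
  have hlV : ∀ i ω, |l * V i ω| ≤ 1 := fun i ω => by
    rw [abs_mul, abs_of_nonneg hl]
    exact (mul_le_mul_of_nonneg_left (hb i ω) hl).trans hlb
  set Y : ℕ → Ω → ℝ := fun i ω => Real.exp (l * V i ω) with hYdef
  have hY : ∀ i, Measurable[F (i + 1)] (Y i) := fun i =>
    Real.measurable_exp.comp ((hV i).const_mul l)
  have hYG : ∀ i, Measurable[G i] (Y i) := fun i =>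
    Real.measurable_exp.comp ((hVG i).const_mul l)
  have hY0 : ∀ i ω, 0 ≤ Y i ω := fun i ω => (Real.exp_pos _).le
  have hYc : ∀ i ω, Y i ω ≤ Real.exp 1 := fun i ω =>
    Real.exp_le_exp.2 ((le_abs_self _).trans (hlV i ω))
  have hYabs : ∀ i ω, |Y i ω| ≤ Real.exp 1 := fun i ω => by
    rw [abs_of_nonneg (hY0 i ω)]; exact hYc i ω
  have hVint : ∀ i, Integrable (V i) P := fun i =>
    Integrable.of_bound (hVm i).aestronglyMeasurable b (ae_of_all _ (hb i))
  have hV2int : ∀ i, Integrable (fun ω => V i ω ^ 2) P := fun i =>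
    Integrable.of_bound ((hVm i).pow_const 2).aestronglyMeasurable (b ^ 2) (ae_of_all _ fun ω => by
      rw [Real.norm_eq_abs, abs_pow]
      exact pow_le_pow_left₀ (abs_nonneg _) (hb i ω) 2)
  have hYint : ∀ i, Integrable (Y i) P := fun i =>
    Integrable.of_bound ((hY i).mono (hF _) le_rfl).aestronglyMeasurable _
      (ae_of_all _ (hYabs i))
  -- For |y| ≤ 1 one has e^y ≤ 1 + y + y²; the linear term has mean zero.
  have hEY : ∀ i, ∫ ω, Y i ω ∂P ≤ 1 + l ^ 2 * ∫ ω, V i ω ^ 2 ∂P := by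
    intro i
    calc ∫ ω, Y i ω ∂P ≤ ∫ ω, (1 + l * V i ω + l ^ 2 * V i ω ^ 2) ∂P := by
          refine integral_mono (hYint i) (((integrable_const 1).add ((hVint i).const_mul l)).add
            ((hV2int i).const_mul (l ^ 2))) fun ω => ?_
          have := (abs_le.1 (Real.abs_exp_sub_one_sub_id_le (hlV i ω))).2
          simp only [hYdef]
          nlinarith
      _ = 1 + l ^ 2 * ∫ ω, V i ω ^ 2 ∂P := by
          have h1 : Integrable (fun ω => 1 + l * V i ω) P :=
            (integrable_const 1).add ((hVint i).const_mul l)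
          rw [integral_add h1 ((hV2int i).const_mul (l ^ 2)), integral_add (integrable_const 1)
            ((hVint i).const_mul l), integral_const_mul, integral_const_mul, hzero i]
          simp
  obtain ⟨hint, hle⟩ := integral_prod_mul_exp_one_sub_condExp_le (P := P) hF hmono hY hY0 hYc n
  set R : Ω → ℝ := fun ω => ∑ i ∈ Finset.range n, |P[Y i | F i] ω - ∫ ω', Y i ω' ∂P| with hR
  have hRint : Integrable R P := integrable_finsetSum _ fun i _ =>
    (integrable_condExp.sub (integrable_const _)).abs
  have hRle : ∫ ω, R ω ∂P ≤ n * (4 * Real.exp 1 * a) := by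
    have hi : ∀ i ∈ Finset.range n, Integrable (fun ω => |P[Y i | F i] ω - ∫ ω', Y i ω' ∂P|) P :=
      fun i _ => (integrable_condExp.sub (integrable_const _)).abs
    simp only [hR]
    rw [integral_finsetSum _ hi]
    refine (Finset.sum_le_card_nsmul _ _ (4 * Real.exp 1 * a) fun i _ => ?_).trans (by simp)
    exact (hmix i).integral_abs_condExp_sub_le (hF i) (hG i) (hYG i) (hYabs i)
  set A : Set Ω := {ω | Real.exp x ≤
    ∏ i ∈ Finset.range n, (Y i ω * Real.exp (1 - P[Y i | F i] ω))} with hA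
  set B : Set Ω := {ω | (1 : ℝ) ≤ R ω} with hB
  have hPA : P.real A ≤ Real.exp (-x) := by
    refine (measureReal_le_integral_div hint (ae_of_all _ fun ω => Finset.prod_nonneg fun i _ =>
      mul_nonneg (hY0 i ω) (Real.exp_pos _).le) (Real.exp_pos x)).trans ?_
    rw [Real.exp_neg, div_eq_mul_inv]
    exact mul_le_of_le_one_left (inv_nonneg.2 (Real.exp_pos x).le) hle
  have hPB : P.real B ≤ n * (4 * Real.exp 1 * a) := by
    refine (measureReal_le_integral_div hRint (ae_of_all _ fun ω => Finset.sum_nonneg fun i _ =>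
      abs_nonneg _) one_pos).trans ?_
    simpa using hRle
  have hsub : {ω | x + 1 + l ^ 2 * v ≤ l * ∑ i ∈ Finset.range n, V i ω} ⊆ A ∪ B := by
    intro ω hω
    by_cases hωB : ω ∈ B
    · exact Or.inr hωB
    · left
      have h1 : R ω < 1 := not_le.1 hωB
      have hω' : x + 1 + l ^ 2 * v ≤ l * ∑ i ∈ Finset.range n, V i ω := hω
      have h2 : ∏ i ∈ Finset.range n, (Y i ω * Real.exp (1 - P[Y i | F i] ω))
          = Real.exp (∑ i ∈ Finset.range n, (l * V i ω + (1 - P[Y i | F i] ω))) := by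
        rw [Real.exp_sum]
        exact Finset.prod_congr rfl fun i _ => (Real.exp_add _ _).symm
      change Real.exp x ≤ _
      rw [h2]
      refine Real.exp_le_exp.2 ?_
      rw [Finset.sum_add_distrib, ← Finset.mul_sum]
      have h3 : ∑ i ∈ Finset.range n, -(1 - P[Y i | F i] ω) ≤ R ω + l ^ 2 * v := by
        calc ∑ i ∈ Finset.range n, -(1 - P[Y i | F i] ω)
            ≤ ∑ i ∈ Finset.range n, (|P[Y i | F i] ω - ∫ ω', Y i ω' ∂P|
              + l ^ 2 * ∫ ω, V i ω ^ 2 ∂P) := by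
              refine Finset.sum_le_sum fun i _ => ?_
              have := le_abs_self (P[Y i | F i] ω - ∫ ω', Y i ω' ∂P)
              have := hEY i
              linarith
          _ ≤ R ω + l ^ 2 * v := by
              rw [Finset.sum_add_distrib, ← Finset.mul_sum]
              exact add_le_add le_rfl (mul_le_mul_of_nonneg_left hv (sq_nonneg l))
      rw [Finset.sum_neg_distrib] at h3
      linarith
  calc _ ≤ P.real (A ∪ B) := measureReal_mono hsub
    _ ≤ P.real A + P.real B := measureReal_union_le _ _
    _ ≤ _ := add_le_add hPA hPB

/-- The sum is cut into `2 * n` blocks of length `L`. Even and odd blocks are treated separately, so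
that a full block separates consecutive members of a family. If the total exceeds twice the
threshold, one of the two half sums exceeds it. -/
theorem measureReal_sum_ge_le_of_mixing [IsProbabilityMeasure P]
    {𝓐 : ℕ → MeasurableSpace Ω} (hA : ∀ t, 𝓐 t ≤ mΩ) {Z : ℕ → Ω → ℝ}
    (hZ : ∀ t, Measurable[𝓐 t] (Z t)) {L : ℕ} {a b l v : ℝ} (ha : 0 ≤ a)
    (hmix : ∀ t, MixBound P (⨆ s ∈ Iio t, 𝓐 s) (⨆ s ∈ Ici (t + L), 𝓐 s) a)
    (hb : ∀ t ω, |Z t ω| ≤ b) (hl : 0 ≤ l) (hlb : l * (L * b) ≤ 1)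
    (hzero : ∀ t, ∫ ω, Z t ω ∂P = 0) {n : ℕ}
    (hv : ∑ j ∈ Finset.range (2 * n),
      ∫ ω, (∑ t ∈ Finset.range L, Z (j * L + t) ω) ^ 2 ∂P ≤ v) (x : ℝ) :
    P.real {ω | 2 * (x + 1 + l ^ 2 * v) ≤ l * ∑ t ∈ Finset.range (2 * n * L), Z t ω}
      ≤ 2 * (Real.exp (-x) + n * (4 * Real.exp 1 * a)) := by
  set V : ℕ → Ω → ℝ := fun j ω => ∑ t ∈ Finset.range L, Z (j * L + t) ω with hV
  have hpast : ∀ t, (⨆ s ∈ Iio t, 𝓐 s) ≤ mΩ := fun t => iSup₂_le fun s _ => hA s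
  have hfut : ∀ t, (⨆ s ∈ Ici t, 𝓐 s) ≤ mΩ := fun t => iSup₂_le fun s _ => hA s
  have hVpast : ∀ j t, (j + 1) * L ≤ t → Measurable[⨆ s ∈ Iio t, 𝓐 s] (V j) := by
    intro j t hjt
    refine Finset.measurable_fun_sum _ fun r hr => (hZ _).mono ?_ le_rfl
    refine le_iSup₂_of_le (j * L + r) ?_ le_rfl
    have := Finset.mem_range.1 hr
    rw [add_mul, one_mul] at hjt
    exact mem_Iio.2 (by omega)
  have hVfut : ∀ j t, t ≤ j * L → Measurable[⨆ s ∈ Ici t, 𝓐 s] (V j) := by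
    intro j t hjt
    refine Finset.measurable_fun_sum _ fun r hr => (hZ _).mono ?_ le_rfl
    exact le_iSup₂_of_le (j * L + r) (mem_Ici.2 (by omega)) le_rfl
  have hVb : ∀ j ω, |V j ω| ≤ L * b := by
    intro j ω
    refine (Finset.abs_sum_le_sum_abs _ _).trans ?_
    refine (Finset.sum_le_card_nsmul _ _ b fun t _ => hb _ ω).trans (by simp)
  have hZint : ∀ t, Integrable (Z t) P := fun t => Integrable.of_bound
    ((hZ t).mono (hA t) le_rfl).aestronglyMeasurable b (ae_of_all _ (hb t))
  have hVz : ∀ j, ∫ ω, V j ω ∂P = 0 := by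
    intro j
    rw [hV, integral_finsetSum _ fun t _ => hZint _]
    exact Finset.sum_eq_zero fun t _ => hzero _
  have hsplit : ∀ g : ℕ → ℝ, ∑ j ∈ Finset.range (2 * n), g j
      = ∑ i ∈ Finset.range n, g (2 * i) + ∑ i ∈ Finset.range n, g (2 * i + 1) := by
    intro g
    rw [← Finset.sum_add_distrib]
    induction n with
    | zero => simp
    | succ k ih =>
      rw [Finset.sum_range_succ, show 2 * (k + 1) = 2 * k + 1 + 1 by ring, Finset.sum_range_succ,
        Finset.sum_range_succ]
      have : ∑ j ∈ Finset.range (2 * k), g j = ∑ i ∈ Finset.range k, (g (2 * i) + g (2 * i + 1)) := by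
        clear ih hv
        induction k with
        | zero => simp
        | succ k ih =>
          rw [Finset.sum_range_succ, show 2 * (k + 1) = 2 * k + 1 + 1 by ring,
            Finset.sum_range_succ, Finset.sum_range_succ, ih]
          ring
      rw [this]; ring
  have hv2 := hv
  rw [hsplit] at hv2
  have hnn : ∀ j, 0 ≤ ∫ ω, V j ω ^ 2 ∂P := fun j => integral_nonneg fun ω => sq_nonneg _
  have hve : ∑ i ∈ Finset.range n, ∫ ω, V (2 * i) ω ^ 2 ∂P ≤ v :=
    le_trans (le_add_of_nonneg_right (Finset.sum_nonneg fun i _ => hnn _)) hv2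
  have hvo : ∑ i ∈ Finset.range n, ∫ ω, V (2 * i + 1) ω ^ 2 ∂P ≤ v :=
    le_trans (le_add_of_nonneg_left (Finset.sum_nonneg fun i _ => hnn _)) hv2
  -- The past of the even block `2 * i` ends before block `2 * i - 1`. For `i = 0` natural
  -- subtraction gives 0, so the past is the trivial field.
  have hE := measureReal_sum_block_ge_le (P := P)
    (F := fun i => ⨆ s ∈ Iio ((2 * i - 1) * L), 𝓐 s)
    (G := fun i => ⨆ s ∈ Ici (2 * i * L), 𝓐 s) (fun i => hpast _) (fun i => hfut _)
    (fun i j hij => biSup_mono fun s (hs : s < _) => lt_of_lt_of_le hs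
      (Nat.mul_le_mul_right L (by omega))) (V := fun i => V (2 * i))
    (fun i => hVpast _ _ (Nat.mul_le_mul_right L (by omega))) (fun i => hVfut _ _ le_rfl)
    (fun i => by
      rcases i with _ | i
      · have : (⨆ s ∈ Iio ((2 * 0 - 1) * L), 𝓐 s) = ⊥ := by simp
        rw [this]
        exact mixBound_bot_left ha
      · have := hmix ((2 * (i + 1) - 1) * L)
        rwa [show (2 * (i + 1) - 1) * L + L = 2 * (i + 1) * L by
          rw [show 2 * (i + 1) - 1 = 2 * i + 1 by omega]; ring] at this)
    (fun i => hVb _) hl hlb (fun i => hVz _) hve x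
  have hO := measureReal_sum_block_ge_le (P := P)
    (F := fun i => ⨆ s ∈ Iio (2 * i * L), 𝓐 s)
    (G := fun i => ⨆ s ∈ Ici ((2 * i + 1) * L), 𝓐 s) (fun i => hpast _) (fun i => hfut _)
    (fun i j hij => biSup_mono fun s (hs : s < _) => lt_of_lt_of_le hs
      (Nat.mul_le_mul_right L (by omega))) (V := fun i => V (2 * i + 1))
    (fun i => hVpast _ _ (Nat.mul_le_mul_right L (by omega))) (fun i => hVfut _ _ le_rfl)
    (fun i => by
      have := hmix (2 * i * L)
      rwa [show 2 * i * L + L = (2 * i + 1) * L by ring] at this)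
    (fun i => hVb _) hl hlb (fun i => hVz _) hvo x
  have hsum : ∀ ω, ∑ t ∈ Finset.range (2 * n * L), Z t ω
      = ∑ i ∈ Finset.range n, V (2 * i) ω + ∑ i ∈ Finset.range n, V (2 * i + 1) ω := by
    intro ω
    rw [← hsplit fun j => V j ω]
    generalize 2 * n = k
    induction k with
    | zero => simp
    | succ k ih => rw [add_mul, one_mul, Finset.sum_range_add, ih, Finset.sum_range_succ]
  refine (measureReal_mono (s₂ := {ω | x + 1 + l ^ 2 * v ≤ l * ∑ i ∈ Finset.range n, V (2 * i) ω} ∪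
    {ω | x + 1 + l ^ 2 * v ≤ l * ∑ i ∈ Finset.range n, V (2 * i + 1) ω}) ?_).trans
    ((measureReal_union_le _ _).trans ((add_le_add hE hO).trans_eq (by ring)))
  intro ω hω
  simp only [mem_ofPred_eq, mem_union, hsum ω, mul_add] at hω ⊢
  by_contra hcon
  push Not at hcon
  linarith [hcon.1, hcon.2]

theorem measureReal_abs_sum_ge_le_of_mixing [IsProbabilityMeasure P]
    {𝓐 : ℕ → MeasurableSpace Ω} (hA : ∀ t, 𝓐 t ≤ mΩ) {Z : ℕ → Ω → ℝ}
    (hZ : ∀ t, Measurable[𝓐 t] (Z t)) {L : ℕ} {a b l v : ℝ} (ha : 0 ≤ a)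
    (hmix : ∀ t, MixBound P (⨆ s ∈ Iio t, 𝓐 s) (⨆ s ∈ Ici (t + L), 𝓐 s) a)
    (hb : ∀ t ω, |Z t ω| ≤ b) (hl : 0 ≤ l) (hlb : l * (L * b) ≤ 1)
    (hzero : ∀ t, ∫ ω, Z t ω ∂P = 0) {n : ℕ}
    (hv : ∑ j ∈ Finset.range (2 * n),
      ∫ ω, (∑ t ∈ Finset.range L, Z (j * L + t) ω) ^ 2 ∂P ≤ v) (x : ℝ) :
    P.real {ω | 2 * (x + 1 + l ^ 2 * v) ≤ l * |∑ t ∈ Finset.range (2 * n * L), Z t ω|}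
      ≤ 4 * (Real.exp (-x) + n * (4 * Real.exp 1 * a)) := by
  have h1 := measureReal_sum_ge_le_of_mixing hA hZ ha hmix hb hl hlb hzero hv x
  have h2 := measureReal_sum_ge_le_of_mixing (Z := fun t ω => -Z t ω) hA (fun t => (hZ t).neg) ha
    hmix (fun t ω => by rw [abs_neg]; exact hb t ω) hl hlb
    (fun t => by rw [integral_neg, hzero, neg_zero]) (n := n) (v := v)
    (by simpa only [Finset.sum_neg_distrib, neg_sq] using hv) x
  refine (measureReal_mono (s₂ := _ ∪ _) ?_).trans
    ((measureReal_union_le _ _).trans ((add_le_add h1 h2).trans_eq (by ring)))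
  intro ω hω
  simp only [mem_ofPred_eq, mem_union, Finset.sum_neg_distrib] at hω ⊢
  rcases abs_cases (∑ t ∈ Finset.range (2 * n * L), Z t ω) with h | h
  · left; rwa [h.1] at hω
  · right; rwa [h.1] at hω

end Exponential

/-! ### Local moment bounds and mixing bounds of arrays -/

/-- Uniform moment bounds of the array `(X, W)`, globally and on small balls, and bounds on the
products `|W_{t,T} W_{t+l,T}|` localized at small balls. -/
structure LocalBounds {Ω : Type*} [MeasurableSpace Ω] (P : Measure Ω) {d : ℕ}
    (X : ℕ → ℕ → Ω → (Fin d → ℝ)) (W : ℕ → ℕ → Ω → ℝ) (s : ℝ) : Prop where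
  measX : ∀ t T : ℕ, 1 ≤ t → t ≤ T → Measurable (X t T)
  measW : ∀ t T : ℕ, 1 ≤ t → t ≤ T → Measurable (W t T)
  moment : ∃ C : ℝ, 0 ≤ C ∧ ∀ t T : ℕ, 1 ≤ t → t ≤ T →
    Integrable (fun ω => |W t T ω| ^ s) P ∧ ∫ ω, |W t T ω| ^ s ∂P ≤ C
  local_moment : ∀ r : ℝ, ∃ C : ℝ, 0 ≤ C ∧ ∀ t T : ℕ, 1 ≤ t → t ≤ T →
    ∀ x : Fin d → ℝ, ‖x‖ ≤ r → ∀ η : ℝ, 0 < η → η ≤ 1 →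
      ∫ ω in {ω | ‖X t T ω - x‖ ≤ η}, (1 + |W t T ω| ^ s) ∂P ≤ C * η ^ d
  local_pair : ∀ r : ℝ, ∃ C : ℝ, 0 ≤ C ∧ ∃ lstar : ℕ, ∀ l ≥ lstar, ∀ t T : ℕ, 1 ≤ t → t + l ≤ T →
    ∀ x : Fin d → ℝ, ‖x‖ ≤ r → ∀ η : ℝ, 0 < η → η ≤ 1 →
      ∫ ω in {ω | ‖X t T ω - x‖ ≤ η ∧ ‖X (t + l) T ω - x‖ ≤ η},
        |W t T ω| * |W (t + l) T ω| ∂P ≤ C * η ^ (2 * d)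

section

variable {Ω : Type*} {mΩ : MeasurableSpace Ω} {P : Measure Ω}

/-- Conditioning on `Z` and passing to its law turns the integral into ∫_A g p. This is how bounds
on densities become bounds by volumes of balls. -/
theorem setIntegral_preimage_le_of_density [IsProbabilityMeasure P] {E : Type*} [MeasureSpace E]
    {Z : Ω → E} (hZ : Measurable Z) {p g : E → ℝ} {V : Ω → ℝ} (hp : IsDensity P Z p)
    (hg : IsCondExpGiven P V Z g) {A : Set E} (hA : MeasurableSet A)
    (hvol : volume A ≠ ∞) {C : ℝ} (hC : ∀ z ∈ A, g z * p z ≤ C) :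
    ∫ ω in Z ⁻¹' A, V ω ∂P ≤ C * volume.real A := by
  obtain ⟨hVint, hgm, hce⟩ := hg
  obtain ⟨hpm, hp0, hmap⟩ := hp
  have hle : MeasurableSpace.comap Z inferInstance ≤ mΩ := hZ.comap_le
  have hAm : MeasurableSet[MeasurableSpace.comap Z inferInstance] (Z ⁻¹' A) := ⟨A, hA, rfl⟩
  have hgZ : Integrable (fun ω => g (Z ω)) P := integrable_condExp.congr hce
  have hgmap : Integrable g (P.map Z) :=
    (integrable_map_measure hgm.aestronglyMeasurable hZ.aemeasurable).2 hgZ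
  rw [hmap] at hgmap
  have hgp : Integrable (fun z => p z * g z) := by
    have := (integrable_withDensity_iff_integrable_smul' hpm.ennreal_ofReal
      (ae_of_all _ fun _ => ENNReal.ofReal_lt_top)).1 hgmap
    simpa only [ENNReal.toReal_ofReal (hp0 _), smul_eq_mul] using this
  calc ∫ ω in Z ⁻¹' A, V ω ∂P = ∫ ω in Z ⁻¹' A, g (Z ω) ∂P := by
        rw [← setIntegral_condExp hle hVint hAm]
        exact setIntegral_congr_ae (hle _ hAm) (hce.mono fun ω h _ => h)
    _ = ∫ z in A, g z ∂(P.map Z) :=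
        (setIntegral_map hA hgm.aestronglyMeasurable hZ.aemeasurable).symm
    _ = ∫ z in A, p z * g z := by
        rw [hmap, restrict_withDensity hA, integral_withDensity_eq_integral_toReal_smul
          hpm.ennreal_ofReal (ae_of_all _ fun _ => ENNReal.ofReal_lt_top)]
        simp only [ENNReal.toReal_ofReal (hp0 _), smul_eq_mul]
    _ ≤ ∫ _ in A, C := by
        refine setIntegral_mono_on hgp.integrableOn (integrableOn_const hvol) hA fun z hz => ?_
        rw [mul_comm]
        exact hC z hz
    _ = C * volume.real A := by simp [mul_comm]

theorem isCondExpGiven_one [IsProbabilityMeasure P] {E : Type*} [MeasurableSpace E] {Z : Ω → E}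
    (hZ : Measurable Z) : IsCondExpGiven P (fun _ => (1 : ℝ)) Z fun _ => 1 := by
  refine ⟨integrable_const 1, measurable_const, ?_⟩
  rw [condExp_const hZ.comap_le]

theorem volumeReal_closedBall_pi {d : ℕ} (x : Fin d → ℝ) {η : ℝ} (hη : 0 ≤ η) :
    volume.real (Metric.closedBall x η) = 2 ^ d * η ^ d := by
  rw [measureReal_def, Real.volume_pi_closedBall x hη, ENNReal.toReal_ofReal (by positivity),
    Fintype.card_fin, mul_pow]

theorem localBounds_of_densityCond [IsProbabilityMeasure P] {d : ℕ}
    {X : ℕ → ℕ → Ω → (Fin d → ℝ)} {W : ℕ → ℕ → Ω → ℝ} {s : ℝ}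
    (hX : ∀ t T : ℕ, 1 ≤ t → t ≤ T → Measurable (X t T))
    (hW : ∀ t T : ℕ, 1 ≤ t → t ≤ T → Measurable (W t T))
    (hmom : MomentCond P W s) (hdens : DensityCond P X W s) : LocalBounds P X W s := by
  obtain ⟨hs, C, hC⟩ := hmom
  obtain ⟨p, g, hpg, hloc⟩ := hdens
  refine ⟨hX, hW, ⟨C, C.2, fun t T ht htT => ?_⟩, fun r => ?_, fun r => ?_⟩
  · refine ⟨(hpg t T ht htT).2.1, ?_⟩
    rw [integral_eq_lintegral_of_nonneg_ae (ae_of_all _ fun ω => by positivity)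
      (hpg t T ht htT).2.1.aestronglyMeasurable]
    exact ENNReal.toReal_le_coe_of_le_coe (hC t T ht htT)
  -- Since η ≤ 1, every ball of radius η about a point of norm at most `r` lies in the ball of
  -- radius `r + 1`.
  · obtain ⟨C', hC', -⟩ := hloc _ (isCompact_closedBall (0 : Fin d → ℝ) (r + 1))
    refine ⟨2 * |C'| * 2 ^ d, by positivity, fun t T ht htT x hx η hη hη1 => ?_⟩
    have hsub : ∀ z ∈ Metric.closedBall x η, z ∈ Metric.closedBall (0 : Fin d → ℝ) (r + 1) := by
      intro z hz
      rw [mem_closedBall_zero_iff]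
      have h1 : ‖z - x‖ ≤ η := by rwa [← dist_eq_norm]
      calc ‖z‖ = ‖x + (z - x)‖ := by congr 1; abel
        _ ≤ ‖x‖ + ‖z - x‖ := norm_add_le _ _
        _ ≤ r + 1 := by linarith
    have hset : {ω | ‖X t T ω - x‖ ≤ η} = X t T ⁻¹' Metric.closedBall x η := by
      ext ω; simp [dist_eq_norm]
    have hfin : volume (Metric.closedBall x η) ≠ ∞ := measure_closedBall_lt_top.ne
    rw [hset, integral_add (integrable_const 1).integrableOn (hpg t T ht htT).2.1.integrableOn]
    have h1 := setIntegral_preimage_le_of_density (hX t T ht htT) (hpg t T ht htT).1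
      (isCondExpGiven_one (hX t T ht htT)) Metric.isClosed_closedBall.measurableSet hfin (C := |C'|)
      fun z hz => by
        rw [one_mul]
        exact ((hC' t T ht htT z (hsub z hz)).1).trans (le_abs_self _)
    have h2 := setIntegral_preimage_le_of_density (hX t T ht htT) (hpg t T ht htT).1
      (hpg t T ht htT).2 Metric.isClosed_closedBall.measurableSet hfin (C := |C'|)
      fun z hz => ((hC' t T ht htT z (hsub z hz)).2).trans (le_abs_self _)
    rw [volumeReal_closedBall_pi x hη.le] at h1 h2
    linarith
  · obtain ⟨C', -, lstar, hl⟩ := hloc _ (isCompact_closedBall (0 : Fin d → ℝ) (r + 1))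
    refine ⟨|C'| * (2 ^ d * 2 ^ d), by positivity, lstar, fun l hll t T ht htT x hx η hη hη1 => ?_⟩
    obtain ⟨q, k, hq, hk, hqk⟩ := hl l hll t T ht htT
    have hsub : ∀ z ∈ Metric.closedBall x η, z ∈ Metric.closedBall (0 : Fin d → ℝ) (r + 1) := by
      intro z hz
      rw [mem_closedBall_zero_iff]
      have h1 : ‖z - x‖ ≤ η := by rwa [← dist_eq_norm]
      calc ‖z‖ = ‖x + (z - x)‖ := by congr 1; abel
        _ ≤ ‖x‖ + ‖z - x‖ := norm_add_le _ _
        _ ≤ r + 1 := by linarith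
    have hset : {ω | ‖X t T ω - x‖ ≤ η ∧ ‖X (t + l) T ω - x‖ ≤ η}
        = (fun ω => (X t T ω, X (t + l) T ω)) ⁻¹'
          (Metric.closedBall x η ×ˢ Metric.closedBall x η) := by
      ext ω; simp [dist_eq_norm]
    have hfin : volume (Metric.closedBall x η ×ˢ Metric.closedBall x η) ≠ ∞ := by
      rw [Measure.volume_eq_prod, Measure.prod_prod]
      exact ENNReal.mul_ne_top measure_closedBall_lt_top.ne measure_closedBall_lt_top.ne
    rw [hset]
    refine (setIntegral_preimage_le_of_density ((hX t T ht (by omega)).prodMk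
      (hX (t + l) T (by omega) htT)) hq hk (Metric.isClosed_closedBall.measurableSet.prod
      Metric.isClosed_closedBall.measurableSet) hfin (C := |C'|)
      fun z hz => (hqk z.1 (hsub _ hz.1) z.2 (hsub _ hz.2)).trans (le_abs_self _)).trans_eq ?_
    rw [measureReal_def, Measure.volume_eq_prod, Measure.prod_prod, ENNReal.toReal_mul,
      ← measureReal_def, volumeReal_closedBall_pi x hη.le]
    ring

/-- For a bounded array the bounds are inherited from the constant array 1. This serves the cut-off
regression signal, for which no density condition is assumed. -/
theorem LocalBounds.of_bounded [IsProbabilityMeasure P] {d : ℕ}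
    {X : ℕ → ℕ → Ω → (Fin d → ℝ)} {W : ℕ → ℕ → Ω → ℝ} {s : ℝ} (hs : 0 < s)
    (h : LocalBounds P X (fun _ _ _ => 1) s)
    (hW : ∀ t T : ℕ, 1 ≤ t → t ≤ T → Measurable (W t T)) {b : ℝ}
    (hb : ∀ t T : ℕ, 1 ≤ t → t ≤ T → ∀ ω, |W t T ω| ≤ b) (hb1 : 1 ≤ b) :
    LocalBounds P X W s := by
  have hpow : ∀ t T : ℕ, 1 ≤ t → t ≤ T → ∀ ω, |W t T ω| ^ s ≤ b ^ s := fun t T ht htT ω =>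
    Real.rpow_le_rpow (abs_nonneg _) (hb t T ht htT ω) hs.le
  have hint : ∀ t T : ℕ, 1 ≤ t → t ≤ T → Integrable (fun ω => |W t T ω| ^ s) P :=
    fun t T ht htT => Integrable.of_bound
      ((hW t T ht htT).abs.pow_const s).aestronglyMeasurable (b ^ s) (ae_of_all _ fun ω => by
        rw [Real.norm_eq_abs, abs_of_nonneg (by positivity)]
        exact hpow t T ht htT ω)
  refine ⟨h.measX, hW, ⟨b ^ s, by positivity, fun t T ht htT => ⟨hint t T ht htT, ?_⟩⟩,
    fun r => ?_, fun r => ?_⟩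
  · calc _ ≤ ∫ _, b ^ s ∂P := integral_mono (hint t T ht htT) (integrable_const _)
          (hpow t T ht htT)
      _ = b ^ s := by simp
  · obtain ⟨C, hC, hloc⟩ := h.local_moment r
    refine ⟨(1 + b ^ s) * C, by positivity, fun t T ht htT x hx η hη hη1 => ?_⟩
    have h1 := hloc t T ht htT x hx η hη hη1
    simp only [abs_one, Real.one_rpow, integral_const, smul_eq_mul] at h1
    calc _ ≤ ∫ _ in {ω | ‖X t T ω - x‖ ≤ η}, (1 + b ^ s) ∂P :=
          integral_mono ((integrable_const _).add (hint t T ht htT).integrableOn)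
            (integrable_const _) fun ω => add_le_add le_rfl (hpow t T ht htT ω)
      _ = (1 + b ^ s) * (P.restrict {ω | ‖X t T ω - x‖ ≤ η}).real univ := by simp [mul_comm]
      _ ≤ (1 + b ^ s) * (C * η ^ d) := by
          refine mul_le_mul_of_nonneg_left ?_ (by positivity)
          have : 0 ≤ (P.restrict {ω | ‖X t T ω - x‖ ≤ η}).real univ := measureReal_nonneg
          linarith
      _ = _ := by ring
  · obtain ⟨C, hC, lstar, hloc⟩ := h.local_pair r
    refine ⟨b * b * C, by positivity, lstar, fun l hl t T ht htT x hx η hη hη1 => ?_⟩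
    have h1 := hloc l hl t T ht htT x hx η hη hη1
    simp only [abs_one, integral_const, smul_eq_mul, mul_one] at h1
    have hbd : ∀ ω, |W t T ω| * |W (t + l) T ω| ≤ b * b := fun ω =>
      mul_le_mul (hb t T ht (by omega) ω) (hb (t + l) T (by omega) htT ω) (abs_nonneg _)
        (by linarith)
    calc _ ≤ ∫ _ in {ω | ‖X t T ω - x‖ ≤ η ∧ ‖X (t + l) T ω - x‖ ≤ η}, b * b ∂P := by
          refine integral_mono (Integrable.of_bound (((hW t T ht (by omega)).abs.mul
            (hW (t + l) T (by omega) htT).abs).aestronglyMeasurable) (b * b)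
            (ae_of_all _ fun ω => ?_)) (integrable_const _) hbd
          rw [Real.norm_eq_abs, abs_of_nonneg (by positivity)]
          exact hbd ω
      _ = b * b * (P.restrict {ω | ‖X t T ω - x‖ ≤ η ∧ ‖X (t + l) T ω - x‖ ≤ η}).real univ := by
          simp [mul_comm]
      _ ≤ b * b * (C * η ^ (2 * d)) := mul_le_mul_of_nonneg_left h1 (by positivity)
      _ = _ := by ring

/-! ### Mixing coefficients of coarser arrays and the σ-fields of a row. -/

theorem alphaCoeff_mono {m₁ m₂ n₁ n₂ : MeasurableSpace Ω} (h₁ : n₁ ≤ m₁) (h₂ : n₂ ≤ m₂) :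
    @alphaCoeff Ω mΩ P n₁ n₂ ≤ @alphaCoeff Ω mΩ P m₁ m₂ := by
  unfold alphaCoeff
  exact iSup₂_le fun B hB => iSup₂_le fun C hC =>
    le_iSup₂_of_le B (h₁ B hB) (le_iSup₂_of_le C (h₂ C hC) le_rfl)

theorem alphaMix_mono {E E' : Type*} [MeasurableSpace E] [MeasurableSpace E']
    {Z : ℕ → ℕ → Ω → E} {Z' : ℕ → ℕ → Ω → E'}
    (h : ∀ t T : ℕ, 1 ≤ t → t ≤ T → MeasurableSpace.comap (Z' t T) inferInstance ≤
      MeasurableSpace.comap (Z t T) inferInstance) (k : ℕ) : alphaMix P Z' k ≤ alphaMix P Z k := by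
  unfold alphaMix
  refine iSup_le fun t => iSup_le fun T => iSup_le fun htT => ?_
  refine le_iSup_of_le t (le_iSup_of_le T (le_iSup_of_le htT (alphaCoeff_mono ?_ ?_)))
  · exact iSup₂_mono fun s hs => h s T hs.1 (by have := hs.2; omega)
  · exact iSup₂_mono fun s hs => h s T (by have := hs.1; omega) hs.2

/-- The σ-field generated by `Z_{t,T}` for `1 ≤ t ≤ T`, and the trivial one for other `t`. -/
@[reducible] def rowField {E : Type*} [MeasurableSpace E] (Z : ℕ → ℕ → Ω → E) (T t : ℕ) : MeasurableSpace Ω :=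
  if 1 ≤ t ∧ t ≤ T then MeasurableSpace.comap (Z t T) inferInstance else ⊥

theorem rowField_le {E : Type*} [MeasurableSpace E] {Z : ℕ → ℕ → Ω → E} {T : ℕ}
    (hZ : ∀ t, 1 ≤ t → t ≤ T → Measurable (Z t T)) (t : ℕ) : rowField Z T t ≤ mΩ := by
  unfold rowField
  split_ifs with h
  · exact (hZ t h.1 h.2).comap_le
  · exact bot_le

theorem mixBound_rowField [IsProbabilityMeasure P] {E : Type*} [MeasurableSpace E]
    {Z : ℕ → ℕ → Ω → E} {A β : ℝ} (hA : 0 ≤ A)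
    (h : ∀ k : ℕ, 1 ≤ k → alphaMix P Z k ≤ ENNReal.ofReal (A * (k : ℝ) ^ (-β))) (T : ℕ)
    {L : ℕ} (hL : 1 ≤ L) (t : ℕ) :
    MixBound P (⨆ s ∈ Iio t, rowField Z T s) (⨆ s ∈ Ici (t + L), rowField Z T s)
      (A * (L : ℝ) ^ (-β)) := by
  have ha : 0 ≤ A * (L : ℝ) ^ (-β) := by positivity
  by_cases ht : 2 ≤ t
  · by_cases htT : t + L ≤ T
    · have h1 : alphaCoeff P (sigmaField Z T 1 (t - 1)) (sigmaField Z T (t - 1 + L) T)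
          ≤ ENNReal.ofReal (A * (L : ℝ) ^ (-β)) := by
        refine le_trans ?_ (h L hL)
        unfold alphaMix
        exact le_iSup_of_le (t - 1) (le_iSup_of_le T (le_iSup_of_le (by omega) le_rfl))
      refine (mixBound_of_alphaCoeff_le ha h1).mono ?_ ?_
      · refine iSup₂_le fun s hs => ?_
        unfold rowField
        split_ifs with hsT
        · have := mem_Iio.1 hs
          exact le_iSup₂_of_le s ⟨hsT.1, by omega⟩ le_rfl
        · exact bot_le
      · refine iSup₂_le fun s hs => ?_
        unfold rowField
        split_ifs with hsT
        · have := mem_Ici.1 hs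
          exact le_iSup₂_of_le s ⟨by omega, hsT.2⟩ le_rfl
        · exact bot_le
    · have : (⨆ s ∈ Ici (t + L), rowField Z T s) = ⊥ := by
        refine le_bot_iff.1 (iSup₂_le fun s hs => ?_)
        have := mem_Ici.1 hs
        unfold rowField
        rw [if_neg (by omega)]
      rw [this]
      exact mixBound_bot_right ha
  · have : (⨆ s ∈ Iio t, rowField Z T s) = ⊥ := by
      refine le_bot_iff.1 (iSup₂_le fun s hs => ?_)
      have := mem_Iio.1 hs
      unfold rowField
      rw [if_neg (by omega)]
    rw [this]
    exact mixBound_bot_left ha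

end

/-! ### Covariances of localized variables -/

section

variable {Ω : Type*} {mΩ : MeasurableSpace Ω} {P : Measure Ω}

theorem sq_integral_le [IsProbabilityMeasure P] {f : Ω → ℝ} (hf : Integrable f P)
    (hf2 : Integrable (fun ω => f ω ^ 2) P) : (∫ ω, f ω ∂P) ^ 2 ≤ ∫ ω, f ω ^ 2 ∂P := by
  set c := ∫ ω, f ω ∂P with hc
  have h : ∫ ω, (2 * c * f ω - c ^ 2) ∂P ≤ ∫ ω, f ω ^ 2 ∂P :=
    integral_mono ((hf.const_mul _).sub (integrable_const _)) hf2 fun ω => by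
      simp only; nlinarith [sq_nonneg (f ω - c)]
  rw [integral_sub (hf.const_mul _) (integrable_const _), integral_const_mul, ← hc] at h
  simp at h
  nlinarith

/-- Where |f| > κ one has |f|^q ≤ κ^{q-s} |f|^s for q ≤ s; the cases q = 1 and q = 2 give the last
two bounds, the latter by Jensen's inequality. -/
theorem truncation_bounds [IsProbabilityMeasure P] {f : Ω → ℝ} {b s D κ : ℝ} (hfm : Measurable f)
    (hfb : ∀ ω, |f ω| ≤ b) (hs : 2 < s) (hfD : ∫ ω, |f ω| ^ s ∂P ≤ D) (hκ : 0 < κ) :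
      Integrable f P ∧ Integrable (fun ω => |f ω| ^ s) P ∧
      Integrable (fun ω => if |f ω| ≤ κ then f ω else 0) P ∧
      |∫ ω, (if |f ω| ≤ κ then f ω else 0) ∂P| ≤ κ ∧
      |∫ ω, f ω ∂P - ∫ ω, (if |f ω| ≤ κ then f ω else 0) ∂P| ≤ κ ^ (1 - s) * D ∧
      (∫ ω, f ω ∂P - ∫ ω, (if |f ω| ≤ κ then f ω else 0) ∂P) ^ 2 ≤ κ ^ (2 - s) * D := by
  have hfi : Integrable f P := Integrable.of_bound hfm.aestronglyMeasurable b (ae_of_all _ hfb)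
  have hfs : Integrable (fun ω => |f ω| ^ s) P := Integrable.of_bound
    (hfm.abs.pow_const s).aestronglyMeasurable (b ^ s) (ae_of_all _ fun ω => by
      rw [Real.norm_eq_abs, abs_of_nonneg (by positivity)]
      exact Real.rpow_le_rpow (abs_nonneg _) (hfb ω) (by linarith))
  have htm : Measurable fun ω => if |f ω| ≤ κ then f ω else 0 :=
    Measurable.ite (measurableSet_le hfm.abs measurable_const) hfm measurable_const
  have htb : ∀ ω, |if |f ω| ≤ κ then f ω else 0| ≤ κ := fun ω => by
    split_ifs with h
    · exact h
    · simpa using hκ.le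
  have hti : Integrable (fun ω => if |f ω| ≤ κ then f ω else 0) P :=
    Integrable.of_bound htm.aestronglyMeasurable κ (ae_of_all _ htb)
  have hdi : Integrable (fun ω => f ω - if |f ω| ≤ κ then f ω else 0) P := hfi.sub hti
  have hd2 : Integrable (fun ω => (f ω - if |f ω| ≤ κ then f ω else 0) ^ 2) P := by
    refine Integrable.of_bound ((hfm.sub htm).pow_const 2).aestronglyMeasurable
      ((b + κ) ^ 2) (ae_of_all _ fun ω => ?_)
    rw [Real.norm_eq_abs, abs_pow]
    exact pow_le_pow_left₀ (abs_nonneg _)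
      ((abs_sub _ _).trans (add_le_add (hfb ω) (htb ω))) 2
  refine ⟨hfi, hfs, hti, ?_, ?_, ?_⟩
  · calc _ ≤ ∫ ω, |if |f ω| ≤ κ then f ω else 0| ∂P := abs_integral_le_integral_abs
      _ ≤ ∫ _, κ ∂P := integral_mono hti.abs (integrable_const _) htb
      _ = κ := by simp
  · rw [← integral_sub hfi hti]
    calc _ ≤ ∫ ω, |f ω - if |f ω| ≤ κ then f ω else 0| ∂P := abs_integral_le_integral_abs
      _ ≤ ∫ ω, κ ^ (1 - s) * |f ω| ^ s ∂P := by
        refine integral_mono hdi.abs (hfs.const_mul _) fun ω => ?_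
        simp only
        split_ifs with h
        · simp; positivity
        · have hpos : 0 < |f ω| := hκ.trans (not_le.1 h)
          rw [sub_zero]
          calc |f ω| = |f ω| ^ (1 - s) * |f ω| ^ s := by
                rw [← Real.rpow_add hpos]; simp
            _ ≤ κ ^ (1 - s) * |f ω| ^ s := mul_le_mul_of_nonneg_right
                (Real.rpow_le_rpow_of_nonpos hκ (not_le.1 h).le (by linarith)) (by positivity)
      _ ≤ _ := by
        rw [integral_const_mul]
        exact mul_le_mul_of_nonneg_left hfD (by positivity)
  · rw [← integral_sub hfi hti]
    refine (sq_integral_le hdi hd2).trans ?_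
    calc _ ≤ ∫ ω, κ ^ (2 - s) * |f ω| ^ s ∂P := by
          refine integral_mono hd2 (hfs.const_mul _) fun ω => ?_
          simp only
          split_ifs with h
          · simp; positivity
          · have hpos : 0 < |f ω| := hκ.trans (not_le.1 h)
            rw [sub_zero]
            calc f ω ^ 2 = |f ω| ^ (2 - s) * |f ω| ^ s := by
                  rw [← Real.rpow_add hpos]; simp
              _ ≤ κ ^ (2 - s) * |f ω| ^ s := mul_le_mul_of_nonneg_right
                  (Real.rpow_le_rpow_of_nonpos hκ (not_le.1 h).le (by linarith)) (by positivity)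
      _ ≤ _ := by
        rw [integral_const_mul]
        exact mul_le_mul_of_nonneg_left hfD (by positivity)

/-- The bounded covariance inequality applies to the truncated variables. Of the five tail terms,
two come from replacing the product in the expectation and three from replacing the product of the
means. -/
theorem MixBound.abs_covariance_le_truncation [IsProbabilityMeasure P] {m₁ m₂ : MeasurableSpace Ω}
    {a : ℝ} (h : MixBound P m₁ m₂ a) (h₁ : m₁ ≤ mΩ) (h₂ : m₂ ≤ mΩ) {f g : Ω → ℝ} {b : ℝ}
    (hf : Measurable[m₁] f) (hg : Measurable[m₂] g) (hfb : ∀ ω, |f ω| ≤ b) (hgb : ∀ ω, |g ω| ≤ b)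
    {s D : ℝ} (hs : 2 < s) (hfD : ∫ ω, |f ω| ^ s ∂P ≤ D) (hgD : ∫ ω, |g ω| ^ s ∂P ≤ D)
    {κ : ℝ} (hκ : 0 < κ) :
    |∫ ω, f ω * g ω ∂P - (∫ ω, f ω ∂P) * ∫ ω, g ω ∂P| ≤ 4 * κ ^ 2 * a + 5 * (κ ^ (2 - s) * D) := by
  have hfm := hf.mono h₁ le_rfl
  have hgm := hg.mono h₂ le_rfl
  obtain ⟨hfi, hfs, hfti, hft, hfd, hfd2⟩ := truncation_bounds hfm hfb hs hfD hκ
  obtain ⟨hgi, hgs, hgti, hgt, hgd, hgd2⟩ := truncation_bounds hgm hgb hs hgD hκ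
  set f' : Ω → ℝ := fun ω => if |f ω| ≤ κ then f ω else 0 with hf'
  set g' : Ω → ℝ := fun ω => if |g ω| ≤ κ then g ω else 0 with hg'
  have hf'm : Measurable[m₁] f' := by
    refine Measurable.ite (measurableSet_le ?_ measurable_const) hf measurable_const
    exact measurable_norm.comp hf
  have hg'm : Measurable[m₂] g' := by
    refine Measurable.ite (measurableSet_le ?_ measurable_const) hg measurable_const
    exact measurable_norm.comp hg
  have hf'b : ∀ ω, |f' ω| ≤ κ := fun ω => by
    simp only [hf']; split_ifs with h
    · exact h
    · simpa using hκ.le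
  have hg'b : ∀ ω, |g' ω| ≤ κ := fun ω => by
    simp only [hg']; split_ifs with h
    · exact h
    · simpa using hκ.le
  have hcov := h.abs_covariance_le h₁ h₂ hf'm hg'm hf'b hg'b
  have hfgi : Integrable (fun ω => f ω * g ω) P := hgi.bdd_mul hfm.aestronglyMeasurable
    (ae_of_all _ hfb)
  have hfgi' : Integrable (fun ω => f' ω * g' ω) P := hgti.bdd_mul
    (hf'm.mono h₁ le_rfl).aestronglyMeasurable (ae_of_all _ hf'b)
  have hprod : |∫ ω, f ω * g ω ∂P - ∫ ω, f' ω * g' ω ∂P| ≤ 2 * (κ ^ (2 - s) * D) := by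
    rw [← integral_sub hfgi hfgi']
    calc _ ≤ ∫ ω, |f ω * g ω - f' ω * g' ω| ∂P := abs_integral_le_integral_abs
      _ ≤ ∫ ω, (κ ^ (2 - s) * |f ω| ^ s + κ ^ (2 - s) * |g ω| ^ s) ∂P := by
        refine integral_mono (hfgi.sub hfgi').abs ((hfs.const_mul _).add (hgs.const_mul _))
          fun ω => ?_
        have hsq : ∀ y : ℝ, κ < |y| → y ^ 2 ≤ κ ^ (2 - s) * |y| ^ s := fun y hy => by
          have hpos : 0 < |y| := hκ.trans hy
          calc y ^ 2 = |y| ^ (2 - s) * |y| ^ s := by rw [← Real.rpow_add hpos]; simp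
            _ ≤ κ ^ (2 - s) * |y| ^ s := mul_le_mul_of_nonneg_right
                (Real.rpow_le_rpow_of_nonpos hκ hy.le (by linarith)) (by positivity)
        have hp1 : 0 ≤ κ ^ (2 - s) * |f ω| ^ s := by positivity
        have hp2 : 0 ≤ κ ^ (2 - s) * |g ω| ^ s := by positivity
        have hmax : κ < |f ω| ∨ κ < |g ω| →
            |f ω * g ω| ≤ κ ^ (2 - s) * |f ω| ^ s + κ ^ (2 - s) * |g ω| ^ s := by
          intro hor
          rw [abs_mul]
          rcases le_total (|f ω|) (|g ω|) with hle | hle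
          · have hg1 : κ < |g ω| := hor.elim (fun h => h.trans_le hle) id
            have := hsq _ hg1
            nlinarith [abs_nonneg (f ω), abs_nonneg (g ω), sq_abs (g ω)]
          · have hf1 : κ < |f ω| := hor.elim id (fun h => h.trans_le hle)
            have := hsq _ hf1
            nlinarith [abs_nonneg (f ω), abs_nonneg (g ω), sq_abs (f ω)]
        simp only [hf', hg']
        by_cases h1 : |f ω| ≤ κ
        · by_cases h2 : |g ω| ≤ κ
          · simp only [h1, h2, if_true, sub_self, abs_zero]
            positivity
          · simp only [h2, if_false, mul_zero, sub_zero]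
            exact hmax (Or.inr (not_le.1 h2))
        · simp only [h1, if_false, zero_mul, sub_zero]
          exact hmax (Or.inl (not_le.1 h1))
      _ ≤ _ := by
        rw [integral_add (hfs.const_mul _) (hgs.const_mul _), integral_const_mul,
          integral_const_mul]
        have hk : 0 ≤ κ ^ (2 - s) := by positivity
        have := mul_le_mul_of_nonneg_left hfD hk
        have := mul_le_mul_of_nonneg_left hgD hk
        linarith
  have hk12 : κ * κ ^ (1 - s) = κ ^ (2 - s) := by
    rw [show (2 : ℝ) - s = 1 + (1 - s) by ring, Real.rpow_add hκ, Real.rpow_one]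
  set x := ∫ ω, f ω ∂P
  set x' := ∫ ω, f' ω ∂P
  set y := ∫ ω, g ω ∂P
  set y' := ∫ ω, g' ω ∂P
  have hxy : |x * y - x' * y'| ≤ 3 * (κ ^ (2 - s) * D) := by
    have e : x * y - x' * y' = (x - x') * (y - y') + (x - x') * y' + x' * (y - y') := by ring
    rw [e]
    -- The two squares are bounded separately, and the product of the differences by their mean.
    have t1 : |(x - x') * (y - y')| ≤ κ ^ (2 - s) * D := by
      rw [abs_le]
      constructor <;> nlinarith [sq_nonneg ((x - x') - (y - y')), sq_nonneg ((x - x') + (y - y'))]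
    have t2 : |(x - x') * y'| ≤ κ ^ (2 - s) * D := by
      rw [abs_mul, ← hk12]
      calc _ ≤ (κ ^ (1 - s) * D) * κ := mul_le_mul hfd hgt (abs_nonneg _)
            ((abs_nonneg _).trans hfd)
        _ = _ := by ring
    have t3 : |x' * (y - y')| ≤ κ ^ (2 - s) * D := by
      rw [abs_mul, ← hk12]
      calc _ ≤ κ * (κ ^ (1 - s) * D) := mul_le_mul hft hgd (abs_nonneg _) hκ.le
        _ = _ := by ring
    calc _ ≤ |(x - x') * (y - y')| + |(x - x') * y'| + |x' * (y - y')| := abs_add_three _ _ _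
      _ ≤ _ := by linarith
  calc |∫ ω, f ω * g ω ∂P - x * y| = |(∫ ω, f ω * g ω ∂P - ∫ ω, f' ω * g' ω ∂P)
        + (∫ ω, f' ω * g' ω ∂P - x' * y') + (x' * y' - x * y)| := by congr 1; ring
    _ ≤ _ := abs_add_three _ _ _
    _ ≤ 4 * κ ^ 2 * a + 5 * (κ ^ (2 - s) * D) := by
      rw [abs_sub_comm (x' * y')]
      have : 4 * κ * κ * a = 4 * κ ^ 2 * a := by ring
      linarith

end

section

variable {Ω : Type*} {mΩ : MeasurableSpace Ω} {P : Measure Ω}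

/-- Davydov's covariance inequality. -/
theorem MixBound.abs_covariance_le_rpow [IsProbabilityMeasure P] {m₁ m₂ : MeasurableSpace Ω}
    {a : ℝ} (h : MixBound P m₁ m₂ a) (h₁ : m₁ ≤ mΩ) (h₂ : m₂ ≤ mΩ) {f g : Ω → ℝ} {b : ℝ}
    (hf : Measurable[m₁] f) (hg : Measurable[m₂] g) (hfb : ∀ ω, |f ω| ≤ b) (hgb : ∀ ω, |g ω| ≤ b)
    {s D : ℝ} (hs : 2 < s) (hfD : ∫ ω, |f ω| ^ s ∂P ≤ D) (hgD : ∫ ω, |g ω| ^ s ∂P ≤ D)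
    (ha : 0 < a) (hD : 0 < D) :
    |∫ ω, f ω * g ω ∂P - (∫ ω, f ω ∂P) * ∫ ω, g ω ∂P| ≤ 9 * (a ^ (1 - 2 / s) * D ^ (2 / s)) := by
  have hs0 : s ≠ 0 := by linarith
  have hDa : 0 < D / a := div_pos hD ha
  -- The level κ = (D/a)^{1/s} balances κ² a against κ^{2-s} D.
  refine (h.abs_covariance_le_truncation h₁ h₂ hf hg hfb hgb hs hfD hgD
    (κ := (D / a) ^ (1 / s)) (by positivity)).trans_eq ?_
  have e1 : ((D / a) ^ (1 / s)) ^ 2 * a = a ^ (1 - 2 / s) * D ^ (2 / s) := by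
    rw [← Real.rpow_natCast, ← Real.rpow_mul hDa.le, Real.div_rpow hD.le ha.le,
      Real.rpow_sub ha, Real.rpow_one, show 1 / s * ((2 : ℕ) : ℝ) = 2 / s by push_cast; ring]
    ring
  have e2 : ((D / a) ^ (1 / s)) ^ (2 - s) * D = a ^ (1 - 2 / s) * D ^ (2 / s) := by
    rw [← Real.rpow_mul hDa.le, show 1 / s * (2 - s) = 2 / s - 1 by field_simp,
      Real.div_rpow hD.le ha.le, Real.rpow_sub hD, Real.rpow_sub ha, Real.rpow_sub ha,
      Real.rpow_one, Real.rpow_one]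
    field_simp
  rw [mul_assoc, e1, e2]
  ring

/-! ### Localized weights -/

/-- The weight `G((u - t/T)/h, (x - X_{t,T})/h)` for a function `G` on `ℝ × ℝ^d`. -/
def locWeight {Ω : Type*} {d : ℕ} (G : ℝ → (Fin d → ℝ) → ℝ) (X : ℕ → ℕ → Ω → (Fin d → ℝ)) (h : ℝ)
    (u : ℝ) (x : Fin d → ℝ) (t T : ℕ) (ω : Ω) : ℝ :=
  G ((u - (t : ℝ) / T) / h) fun j => (x j - X t T ω j) / h

/-- `G` is measurable in the space variable, bounded by `B`, and supported in the ball of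
radius `R`. -/
structure IsLocKernel {d : ℕ} (G : ℝ → (Fin d → ℝ) → ℝ) (B R : ℝ) : Prop where
  meas : ∀ v, Measurable (G v)
  bound : ∀ v z, |G v z| ≤ B
  supp_time : ∀ v z, R < |v| → G v z = 0
  supp_space : ∀ v z, R < ‖z‖ → G v z = 0

variable {d : ℕ} {G : ℝ → (Fin d → ℝ) → ℝ} {B R h u : ℝ} {x : Fin d → ℝ} {t T : ℕ}
  {X : ℕ → ℕ → Ω → (Fin d → ℝ)} {W : ℕ → ℕ → Ω → ℝ} {s : ℝ}

theorem measurable_spaceArg (x : Fin d → ℝ) (h : ℝ) :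
    Measurable fun (y : Fin d → ℝ) j => (x j - y j) / h :=
  by fun_prop

theorem norm_spaceArg (x y : Fin d → ℝ) (hh : 0 < h) :
    ‖(fun j => (x j - y j) / h : Fin d → ℝ)‖ = ‖y - x‖ / h := by
  have : (fun j => (x j - y j) / h : Fin d → ℝ) = h⁻¹ • (x - y) := by
    ext j; simp [div_eq_inv_mul]
  rw [this, norm_smul, norm_inv, Real.norm_eq_abs, abs_of_pos hh, norm_sub_rev, div_eq_inv_mul]

theorem IsLocKernel.measurable_locWeight (hG : IsLocKernel G B R) (hX : Measurable (X t T)) :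
    Measurable (locWeight G X h u x t T) :=
  (hG.meas _).comp ((measurable_spaceArg x h).comp hX)

theorem IsLocKernel.locWeight_eq_zero_of_time (hG : IsLocKernel G B R) (hh : 0 < h)
    (hu : R * h < |u - (t : ℝ) / T|) (ω : Ω) : locWeight G X h u x t T ω = 0 := by
  refine hG.supp_time _ _ ?_
  rwa [abs_div, abs_of_pos hh, lt_div_iff₀ hh]

theorem IsLocKernel.locWeight_eq_zero_of_space (hG : IsLocKernel G B R) (hh : 0 < h) {ω : Ω}
    (hx : R * h < ‖X t T ω - x‖) : locWeight G X h u x t T ω = 0 := by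
  refine hG.supp_space _ _ ?_
  rwa [norm_spaceArg _ _ hh, lt_div_iff₀ hh]

theorem one_add_rpow_ge_sq {w s : ℝ} (hs : 2 ≤ s) (hw : 0 ≤ w) : w ^ 2 ≤ 1 + w ^ s := by
  rcases le_total w 1 with h | h
  · have : w ^ 2 ≤ 1 := pow_le_one₀ hw h
    have : 0 ≤ w ^ s := by positivity
    linarith
  · have : w ^ 2 ≤ w ^ s := by
      rw [← Real.rpow_natCast]
      exact Real.rpow_le_rpow_of_exponent_le h (by exact_mod_cast hs)
    linarith

theorem one_add_rpow_ge_self {w s : ℝ} (hs : 1 ≤ s) (hw : 0 ≤ w) : w ≤ 1 + w ^ s := by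
  rcases le_total w 1 with h | h
  · have : 0 ≤ w ^ s := by positivity
    linarith
  · have : w ^ (1 : ℝ) ≤ w ^ s := Real.rpow_le_rpow_of_exponent_le h hs
    rw [Real.rpow_one] at this
    linarith

theorem integral_le_of_le_on {Φ Ψ : Ω → ℝ} {A : Set Ω} (hA : MeasurableSet A)
    (hΨ : Integrable Ψ P) {c : ℝ} (h0 : ∀ ω, 0 ≤ Φ ω)
    (h1 : ∀ ω ∈ A, Φ ω ≤ c * Ψ ω) (h2 : ∀ ω, ω ∉ A → Φ ω = 0) :
    ∫ ω, Φ ω ∂P ≤ c * ∫ ω in A, Ψ ω ∂P := by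
  rw [← integral_const_mul, ← integral_indicator hA]
  refine integral_mono_of_nonneg (ae_of_all _ h0) ((hΨ.const_mul c).indicator hA)
    (ae_of_all _ fun ω => ?_)
  by_cases hω : ω ∈ A
  · simpa [hω] using h1 ω hω
  · simp [hω, h2 ω hω]

theorem LocalBounds.integral_local_le [IsProbabilityMeasure P] (hLB : LocalBounds P X W s)
    (ht : 1 ≤ t) (htT : t ≤ T) {C η : ℝ}
    (hC : ∫ ω in {ω | ‖X t T ω - x‖ ≤ η}, (1 + |W t T ω| ^ s) ∂P ≤ C)
    {Φ : Ω → ℝ} {c : ℝ} (hc : 0 ≤ c) (h0 : ∀ ω, 0 ≤ Φ ω)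
    (h1 : ∀ ω, Φ ω ≤ c * (1 + |W t T ω| ^ s)) (h2 : ∀ ω, η < ‖X t T ω - x‖ → Φ ω = 0) :
    ∫ ω, Φ ω ∂P ≤ c * C := by
  obtain ⟨C', -, hC'⟩ := hLB.moment
  have hA : MeasurableSet {ω | ‖X t T ω - x‖ ≤ η} :=
    measurableSet_le ((hLB.measX t T ht htT).sub_const x).norm measurable_const
  refine (integral_le_of_le_on (Φ := Φ) (Ψ := fun ω => 1 + |W t T ω| ^ s) (c := c) hA
    ((integrable_const 1).add (hC' t T ht htT).1) h0
    (fun ω _ => h1 ω) fun ω hω => h2 ω (not_le.1 hω)).trans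
    (mul_le_mul_of_nonneg_left hC hc)

theorem rpow_interpolate {A₁ A₂ p q h k y η : ℝ} (hA₁ : 0 ≤ A₁) (hA₂ : 0 ≤ A₂) (hh : 0 < h)
    (hk : 0 < k) (hy : 0 ≤ y) (hη0 : 0 < η) (hη1 : η < 1) (h1 : y ≤ A₁ * h ^ p)
    (h2 : y ≤ A₂ * (h ^ q * k)) :
    y ≤ A₁ ^ (1 - η) * A₂ ^ η * (h ^ (p * (1 - η) + q * η) * k ^ η) := by
  calc y = y ^ (1 - η) * y ^ η := by
        rcases hy.eq_or_lt with h0 | h0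
        · rw [← h0, Real.zero_rpow hη0.ne', mul_zero]
        · rw [← Real.rpow_add h0]; simp
    _ ≤ (A₁ * h ^ p) ^ (1 - η) * (A₂ * (h ^ q * k)) ^ η := by
        refine mul_le_mul (Real.rpow_le_rpow hy h1 (by linarith)) (Real.rpow_le_rpow hy h2 hη0.le)
          (by positivity) (by positivity)
    _ = _ := by
        rw [Real.mul_rpow hA₁ (by positivity), Real.mul_rpow hA₂ (by positivity),
          Real.mul_rpow (by positivity) hk.le, ← Real.rpow_mul hh.le, ← Real.rpow_mul hh.le,
          Real.rpow_add hh]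
        ring

theorem measurable_of_rowField [IsProbabilityMeasure P] (hG : IsLocKernel G B R) {g : ℝ → ℝ}
    (hg : Measurable g) (ht : 1 ≤ t) (htT : t ≤ T) :
    Measurable[rowField (fun t T ω => (X t T ω, W t T ω)) T t]
      fun ω => locWeight G X h u x t T ω * g (W t T ω) := by
  unfold rowField
  rw [if_pos ⟨ht, htT⟩]
  have : Measurable fun p : (Fin d → ℝ) × ℝ =>
      G ((u - (t : ℝ) / T) / h) (fun j => (x j - p.1 j) / h) * g p.2 :=
    ((hG.meas _).comp ((measurable_spaceArg x h).comp measurable_fst)).mul (hg.comp measurable_snd)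
  exact this.comp (comap_measurable _)

/-- The localized variables `locWeight * g(W)`. -/
def locTerm {Ω : Type*} {d : ℕ} (G : ℝ → (Fin d → ℝ) → ℝ) (g : ℝ → ℝ)
    (X : ℕ → ℕ → Ω → (Fin d → ℝ)) (W : ℕ → ℕ → Ω → ℝ) (h : ℝ)
    (u : ℝ) (x : Fin d → ℝ) (T t : ℕ) (ω : Ω) : ℝ :=
  locWeight G X h u x t T ω * g (W t T ω)

theorem IsLocKernel.abs_locTerm_le (hG : IsLocKernel G B R) {g : ℝ → ℝ} {w : ℝ} {ω : Ω}
    (hg : |g (W t T ω)| ≤ w) (hB : 0 ≤ B) : |locTerm G g X W h u x T t ω| ≤ B * w := by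
  rw [locTerm, abs_mul]
  exact mul_le_mul (hG.bound _ _) hg (abs_nonneg _) hB

theorem LocalBounds.measurable_locTerm (hLB : LocalBounds P X W s) (hG : IsLocKernel G B R)
    {g : ℝ → ℝ} (hg : Measurable g) (ht : 1 ≤ t) (htT : t ≤ T) :
    Measurable (locTerm G g X W h u x T t) :=
  (hG.measurable_locWeight (hLB.measX t T ht htT)).mul (hg.comp (hLB.measW t T ht htT))

theorem LocalBounds.integrable_abs [IsProbabilityMeasure P] (hLB : LocalBounds P X W s)
    (hs : 1 ≤ s) (ht : 1 ≤ t) (htT : t ≤ T) : Integrable (fun ω => |W t T ω|) P := by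
  obtain ⟨C, -, hC⟩ := hLB.moment
  refine ((integrable_const (1 : ℝ)).add (hC t T ht htT).1).mono'
    (hLB.measW t T ht htT).abs.aestronglyMeasurable (ae_of_all _ fun ω => ?_)
  rw [Real.norm_eq_abs, abs_abs]
  exact one_add_rpow_ge_self hs (abs_nonneg _)

theorem LocalBounds.integrable_locTerm [IsProbabilityMeasure P] (hLB : LocalBounds P X W s)
    (hG : IsLocKernel G B R) {g : ℝ → ℝ} (hg : Measurable g) (hgw : ∀ w, |g w| ≤ |w|)
    (hB : 0 ≤ B) (hs : 1 ≤ s) (ht : 1 ≤ t) (htT : t ≤ T) :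
    Integrable (locTerm G g X W h u x T t) P := by
  refine ((hLB.integrable_abs hs ht htT).const_mul B).mono'
    (hLB.measurable_locTerm hG hg ht htT).aestronglyMeasurable (ae_of_all _ fun ω => ?_)
  exact hG.abs_locTerm_le (hgw _) hB

theorem LocalBounds.integral_locTerm_le [IsProbabilityMeasure P] (hLB : LocalBounds P X W s)
    (hs : 2 < s) (hG : IsLocKernel G B R) (hB : 1 ≤ B) {g : ℝ → ℝ} (hgw : ∀ w, |g w| ≤ |w|)
    (hh : 0 < h) (ht : 1 ≤ t) (htT : t ≤ T) {C : ℝ}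
    (hC : ∫ ω in {ω | ‖X t T ω - x‖ ≤ R * h}, (1 + |W t T ω| ^ s) ∂P ≤ C) :
    ∫ ω, |locTerm G g X W h u x T t ω| ∂P ≤ B ^ 2 * C ∧
    ∫ ω, locTerm G g X W h u x T t ω ^ 2 ∂P ≤ B ^ 2 * C ∧
    ∫ ω, |locTerm G g X W h u x T t ω| ^ s ∂P ≤ B ^ s * C := by
  have hs0 : 0 < s := by linarith
  have hB0 : 0 < B := by linarith
  have hZle : ∀ ω, |locTerm G g X W h u x T t ω| ≤ B * |W t T ω| := fun ω =>
    hG.abs_locTerm_le (hgw _) hB0.le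
  have hZ0 : ∀ ω, R * h < ‖X t T ω - x‖ → locTerm G g X W h u x T t ω = 0 := fun ω hω => by
    simp only [locTerm, hG.locWeight_eq_zero_of_space hh hω, zero_mul]
  refine ⟨?_, ?_, ?_⟩
  · refine hLB.integral_local_le ht htT hC (by positivity) (fun ω => abs_nonneg _)
      (fun ω => ?_) fun ω hω => by rw [hZ0 ω hω, abs_zero]
    exact (hZle ω).trans (mul_le_mul (by nlinarith)
      (one_add_rpow_ge_self (by linarith) (abs_nonneg _)) (abs_nonneg _) (by positivity))
  · refine hLB.integral_local_le ht htT hC (by positivity) (fun ω => sq_nonneg _)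
      (fun ω => ?_) fun ω hω => by rw [hZ0 ω hω]; simp
    calc locTerm G g X W h u x T t ω ^ 2 = |locTerm G g X W h u x T t ω| ^ 2 := (sq_abs _).symm
      _ ≤ (B * |W t T ω|) ^ 2 := pow_le_pow_left₀ (abs_nonneg _) (hZle ω) 2
      _ = B ^ 2 * |W t T ω| ^ 2 := by ring
      _ ≤ _ := mul_le_mul_of_nonneg_left (one_add_rpow_ge_sq hs.le (abs_nonneg _)) (by positivity)
  · refine hLB.integral_local_le ht htT hC (by positivity) (fun ω => by positivity)
      (fun ω => ?_) fun ω hω => by rw [hZ0 ω hω, abs_zero, Real.zero_rpow hs0.ne']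
    calc |locTerm G g X W h u x T t ω| ^ s ≤ (B * |W t T ω|) ^ s :=
          Real.rpow_le_rpow (abs_nonneg _) (hZle ω) hs0.le
      _ = B ^ s * |W t T ω| ^ s := Real.mul_rpow hB0.le (abs_nonneg _)
      _ ≤ _ := mul_le_mul_of_nonneg_left (by linarith) (by positivity)

theorem LocalBounds.integral_locTerm_mul_le [IsProbabilityMeasure P] (hLB : LocalBounds P X W s)
    (hs : 2 < s) (hG : IsLocKernel G B R) (hB : 1 ≤ B) {g : ℝ → ℝ} (hgw : ∀ w, |g w| ≤ |w|)
    (hh : 0 < h) {l : ℕ} (ht : 1 ≤ t) (htT : t + l ≤ T) {C : ℝ}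
    (hC : ∫ ω in {ω | ‖X t T ω - x‖ ≤ R * h ∧ ‖X (t + l) T ω - x‖ ≤ R * h},
      |W t T ω| * |W (t + l) T ω| ∂P ≤ C) :
    |∫ ω, locTerm G g X W h u x T t ω * locTerm G g X W h u x T (t + l) ω ∂P| ≤ B ^ 2 * C := by
  have hB0 : 0 < B := by linarith
  have hZle : ∀ t ω, |locTerm G g X W h u x T t ω| ≤ B * |W t T ω| := fun t ω =>
    hG.abs_locTerm_le (hgw _) hB0.le
  have hZ0 : ∀ t ω, R * h < ‖X t T ω - x‖ → locTerm G g X W h u x T t ω = 0 := fun t ω hω => by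
    simp only [locTerm, hG.locWeight_eq_zero_of_space hh hω, zero_mul]
  refine abs_integral_le_integral_abs.trans ?_
  obtain ⟨CW, -, hCW⟩ := hLB.moment
  have hsq : ∀ t, 1 ≤ t → t ≤ T → Integrable (fun ω => |W t T ω| ^ 2) P := fun t ht htT =>
    ((integrable_const (1 : ℝ)).add (hCW t T ht htT).1).mono'
      ((hLB.measW t T ht htT).abs.pow_const 2).aestronglyMeasurable (ae_of_all _ fun ω => by
        rw [Real.norm_eq_abs, abs_of_nonneg (by positivity)]
        exact one_add_rpow_ge_sq hs.le (abs_nonneg _))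
  have hWW : Integrable (fun ω => |W t T ω| * |W (t + l) T ω|) P :=
    ((hsq t ht (by omega)).add (hsq (t + l) (by omega) htT)).mono'
      ((hLB.measW t T ht (by omega)).abs.mul
        (hLB.measW (t + l) T (by omega) htT).abs).aestronglyMeasurable
      (ae_of_all _ fun ω => by
        rw [Real.norm_eq_abs, abs_of_nonneg (by positivity)]
        simp only [Pi.add_apply]
        nlinarith [sq_nonneg (|W t T ω| - |W (t + l) T ω|), sq_nonneg (|W t T ω|),
          sq_nonneg (|W (t + l) T ω|)])
  have hAm : MeasurableSet {ω | ‖X t T ω - x‖ ≤ R * h ∧ ‖X (t + l) T ω - x‖ ≤ R * h} :=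
    (measurableSet_le ((hLB.measX t T ht (by omega)).sub_const x).norm measurable_const).inter
      (measurableSet_le ((hLB.measX _ T (by omega) htT).sub_const x).norm measurable_const)
  refine (integral_le_of_le_on (c := B ^ 2) hAm hWW (fun ω => abs_nonneg _) (fun ω _ => ?_)
    fun ω hω => ?_).trans (mul_le_mul_of_nonneg_left hC (by positivity))
  · rw [abs_mul]
    calc _ ≤ (B * |W t T ω|) * (B * |W (t + l) T ω|) :=
          mul_le_mul (hZle t ω) (hZle _ ω) (abs_nonneg _) (by positivity)
      _ = _ := by ring
  · rw [abs_eq_zero, mul_eq_zero]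
    by_contra hcon
    push Not at hcon
    refine hω ⟨?_, ?_⟩
    · by_contra hc; exact hcon.1 (hZ0 _ _ (not_le.1 hc))
    · by_contra hc; exact hcon.2 (hZ0 _ _ (not_le.1 hc))

theorem mixBound_rowField_pair {E : Type*} [MeasurableSpace E] {Z : ℕ → ℕ → Ω → E} {A β : ℝ}
    (hA : 0 ≤ A) (h : ∀ k : ℕ, 1 ≤ k → alphaMix P Z k ≤ ENNReal.ofReal (A * (k : ℝ) ^ (-β)))
    {l : ℕ} (hl : 1 ≤ l) (ht : 1 ≤ t) (htl : t + l ≤ T) :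
    MixBound P (rowField Z T t) (rowField Z T (t + l)) (A * (l : ℝ) ^ (-β)) := by
  have h2 : alphaCoeff P (sigmaField Z T 1 t) (sigmaField Z T (t + l) T)
      ≤ ENNReal.ofReal (A * (l : ℝ) ^ (-β)) := by
    refine le_trans ?_ (h l hl)
    unfold alphaMix
    exact le_iSup_of_le t (le_iSup_of_le T (le_iSup_of_le ⟨ht, htl⟩ le_rfl))
  refine (mixBound_of_alphaCoeff_le (by positivity) h2).mono ?_ ?_
  · unfold rowField
    rw [if_pos ⟨ht, by omega⟩]
    exact le_iSup₂_of_le t ⟨ht, le_rfl⟩ le_rfl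
  · unfold rowField
    rw [if_pos ⟨by omega, htl⟩]
    exact le_iSup₂_of_le (t + l) ⟨le_rfl, htl⟩ le_rfl

/-- Interpolation between a density bound and a mixing bound of a covariance. -/
theorem rpow_decay_of_two_bounds {s β A D₂ D₃ h y : ℝ} {l : ℕ} (hs : 2 < s)
    (hA : 0 < A) (hD₂ : 0 < D₂) (hD₃ : 0 ≤ D₃) (hh : 0 < h) (hl : 1 ≤ l) (hy : 0 ≤ y)
    (h1 : y ≤ D₃ * (h ^ d * h ^ d))
    (h2 : y ≤ 9 * ((A * (l : ℝ) ^ (-β)) ^ (1 - 2 / s) * (D₂ * h ^ d) ^ (2 / s))) :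
    y ≤ D₃ ^ (1 - s / (2 * s - 2)) * (9 * (A ^ (1 - 2 / s) * D₂ ^ (2 / s))) ^ (s / (2 * s - 2)) *
      (h ^ d * (l : ℝ) ^ (-(β * (1 - 2 / s) * (s / (2 * s - 2))))) := by
  have hs0 : 0 < s := by linarith
  have hlp : (0 : ℝ) < l := by exact_mod_cast hl
  have hhd0 : 0 < h ^ d := by positivity
  -- η solves 2(1 - η) + (2/s) η = 1, so that interpolating h^{2d} with h^{2d/s} yields exactly h^d.
  set η : ℝ := s / (2 * s - 2) with hη
  have hη0 : 0 < η := div_pos hs0 (by linarith)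
  have hη1 : η < 1 := by rw [hη, div_lt_one (by linarith)]; linarith
  have h3 := rpow_interpolate (A₁ := D₃) (A₂ := 9 * (A ^ (1 - 2 / s) * D₂ ^ (2 / s)))
    (p := 2 * d) (q := d * (2 / s)) (h := h) (k := (l : ℝ) ^ (-β * (1 - 2 / s)))
    hD₃ (by positivity) hh (by positivity) hy hη0 hη1
    (h1.trans_eq (by rw [show (2 * d : ℝ) = d + d by ring, Real.rpow_add hh, Real.rpow_natCast]))
    (h2.trans_eq (by
      rw [Real.mul_rpow hA.le (by positivity), Real.mul_rpow hD₂.le hhd0.le,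
        ← Real.rpow_mul hlp.le, ← Real.rpow_natCast h d, ← Real.rpow_mul hh.le]
      ring))
  have e1 : (2 * d : ℝ) * (1 - η) + d * (2 / s) * η = d := by
    have h2s' : s - 1 ≠ 0 := by linarith
    rw [hη, show 2 * s - 2 = 2 * (s - 1) by ring]; field_simp; ring
  have e2 : ((l : ℝ) ^ (-β * (1 - 2 / s))) ^ η = (l : ℝ) ^ (-(β * (1 - 2 / s) * η)) := by
    rw [← Real.rpow_mul hlp.le]; congr 1; ring
  rwa [e1, e2, Real.rpow_natCast] at h3

-- Summability over lags must not cost any power of h. At long lags the joint density bound has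
-- order h^{2d} without decay, and Davydov's inequality decays but has only the order h^{2d/s};
-- `rpow_decay_of_two_bounds` interpolates between them. At finitely many short lags, where no joint
-- density is available, second moments already give h^d.
set_option maxHeartbeats 800000 in
theorem exists_covariance_bound [IsProbabilityMeasure P] (hLB : LocalBounds P X W s)
    {A β : ℝ} (hA : 0 < A) (hs : 2 < s) (hβ : (2 * s - 2) / (s - 2) < β)
    (hmix : ∀ k : ℕ, 1 ≤ k →
      alphaMix P (fun t T ω => (X t T ω, W t T ω)) k ≤ ENNReal.ofReal (A * (k : ℝ) ^ (-β)))
    (r : ℝ) (hB : 1 ≤ B) (hR : 1 ≤ R) :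
    ∃ Q p : ℝ, 0 ≤ Q ∧ 1 < p ∧ ∀ (T : ℕ) (h u : ℝ) (x : Fin d → ℝ) (G : ℝ → (Fin d → ℝ) → ℝ)
      (g : ℝ → ℝ), IsLocKernel G B R → 0 < h → R * h ≤ 1 → ‖x‖ ≤ r → Measurable g →
      (∃ b, ∀ w, |g w| ≤ b) → (∀ w, |g w| ≤ |w|) →
      ∀ t l : ℕ, 1 ≤ t → t + l ≤ T →
        |∫ ω, locTerm G g X W h u x T t ω * locTerm G g X W h u x T (t + l) ω ∂P -
          (∫ ω, locTerm G g X W h u x T t ω ∂P) * ∫ ω, locTerm G g X W h u x T (t + l) ω ∂P|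
          ≤ Q * h ^ d * ((l : ℝ) + 1) ^ (-p) := by
  obtain ⟨C₁, hC₁, hmom⟩ := hLB.local_moment r
  obtain ⟨C₂, hC₂, lstar, hpair⟩ := hLB.local_pair r
  have hs0 : 0 < s := by linarith
  have hs2 : 0 < s - 2 := by linarith
  set p : ℝ := β * (1 - 2 / s) * (s / (2 * s - 2)) with hp
  -- Since p = β(s - 2)/(2s - 2), summability of l^{-p} is precisely the condition β > (2s - 2)/(s -
  -- 2).
  have hp1 : 1 < p := by
    have hlt : 2 * s - 2 < β * (s - 2) := (div_lt_iff₀ hs2).1 hβ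
    have h2s' : s - 1 ≠ 0 := by linarith
    have : p = β * (s - 2) / (2 * s - 2) := by
      rw [hp, show 2 * s - 2 = 2 * (s - 1) by ring]; field_simp
    rw [this, one_lt_div (by linarith)]
    exact hlt
  have hR0 : 0 < R := by linarith
  have hB0 : 0 < B := by linarith
  obtain ⟨D₁, hD₁⟩ : ∃ D₁ : ℝ, D₁ = B ^ 2 * (C₁ * R ^ d) := ⟨_, rfl⟩
  obtain ⟨D₂, hD₂⟩ : ∃ D₂ : ℝ, D₂ = B ^ s * (C₁ * R ^ d) + 1 := ⟨_, rfl⟩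
  obtain ⟨D₃, hD₃⟩ : ∃ D₃ : ℝ, D₃ = B ^ 2 * (C₂ * R ^ (2 * d)) + D₁ ^ 2 := ⟨_, rfl⟩
  have hD₁0 : 0 ≤ D₁ := by rw [hD₁]; positivity
  have hD₂0 : 0 < D₂ := by rw [hD₂]; positivity
  have hD₃0 : 0 ≤ D₃ := by rw [hD₃]; positivity
  obtain ⟨Q₁, hQ₁⟩ : ∃ Q₁ : ℝ, Q₁ = D₃ ^ (1 - s / (2 * s - 2)) *
    (9 * (A ^ (1 - 2 / s) * D₂ ^ (2 / s))) ^ (s / (2 * s - 2)) := ⟨_, rfl⟩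
  obtain ⟨l₀, hl₀⟩ : ∃ l₀ : ℕ, l₀ = max lstar 1 := ⟨_, rfl⟩
  obtain ⟨Q₂, hQ₂⟩ : ∃ Q₂ : ℝ, Q₂ = (D₁ + D₁ ^ 2) * ((l₀ : ℝ) + 1) ^ p := ⟨_, rfl⟩
  have hQ₁0 : 0 ≤ Q₁ := by rw [hQ₁]; positivity
  have hQ₂0 : 0 ≤ Q₂ := by rw [hQ₂]; positivity
  refine ⟨Q₂ + Q₁ * 2 ^ p, p, by positivity, hp1, ?_⟩
  intro T h u x G g hG hh hRh hx hg hgb hgw t l ht htl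
  obtain ⟨b, hgb⟩ := hgb
  have hh1 : h ≤ 1 := by nlinarith
  have hfield := rowField_le (Z := fun t T ω => (X t T ω, W t T ω)) (T := T) fun t ht htT =>
    (hLB.measX t T ht htT).prodMk (hLB.measW t T ht htT)
  have hloc : ∀ t, 1 ≤ t → t ≤ T →
      ∫ ω in {ω | ‖X t T ω - x‖ ≤ R * h}, (1 + |W t T ω| ^ s) ∂P ≤ C₁ * R ^ d * h ^ d := by
    intro t ht htT
    refine (hmom t T ht htT x hx (R * h) (by positivity) hRh).trans_eq ?_
    rw [mul_pow]; ring
  have htT : t ≤ T := by omega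
  have ht' : 1 ≤ t + l := by omega
  have hmom1 := hLB.integral_locTerm_le (u := u) hs hG hB hgw hh ht htT (hloc t ht htT)
  have hmom2 := hLB.integral_locTerm_le (u := u) hs hG hB hgw hh ht' htl (hloc _ ht' htl)
  have hpairb := hLB.integral_locTerm_mul_le (u := u) (x := x) (C := C₂ * (R * h) ^ (2 * d)) hs hG
    hB hgw hh ht htl
  have hpairb' := fun hll : lstar ≤ l => hpairb
    (hpair l hll t T ht htl x hx (R * h) (by positivity) hRh)
  have hbd : ∀ t ω, |locTerm G g X W h u x T t ω| ≤ B * b := fun t ω =>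
    hG.abs_locTerm_le (hgb _) hB0.le
  have hZ₁ : Measurable[rowField (fun t T ω => (X t T ω, W t T ω)) T t]
    (locTerm G g X W h u x T t) := measurable_of_rowField (P := P) hG hg ht htT
  have hZ₂ : Measurable[rowField (fun t T ω => (X t T ω, W t T ω)) T (t + l)]
    (locTerm G g X W h u x T (t + l)) := measurable_of_rowField (P := P) hG hg ht' htl
  have hb₁ := hbd t
  have hb₂ := hbd (t + l)
  clear hbd hpairb hpair hmom
  generalize locTerm G g X W h u x T t = Z₁ at *
  generalize locTerm G g X W h u x T (t + l) = Z₂ at *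
  have hm₁ := hZ₁.mono (hfield t) le_rfl
  have hm₂ := hZ₂.mono (hfield (t + l)) le_rfl
  have hhd1 : h ^ d ≤ 1 := pow_le_one₀ hh.le hh1
  have hhd0 : 0 < h ^ d := by positivity
  have hEE : |(∫ ω, Z₁ ω ∂P) * ∫ ω, Z₂ ω ∂P| ≤ D₁ ^ 2 * (h ^ d * h ^ d) := by
    rw [abs_mul]
    calc _ ≤ (D₁ * h ^ d) * (D₁ * h ^ d) := by
          refine mul_le_mul (abs_integral_le_integral_abs.trans (hmom1.1.trans_eq ?_))
            (abs_integral_le_integral_abs.trans (hmom2.1.trans_eq ?_)) (abs_nonneg _)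
            (by positivity) <;> rw [hD₁] <;> ring
      _ = _ := by ring
  have hgoal : ∀ y : ℝ, |∫ ω, Z₁ ω * Z₂ ω ∂P| ≤ y →
      |∫ ω, Z₁ ω * Z₂ ω ∂P - (∫ ω, Z₁ ω ∂P) * ∫ ω, Z₂ ω ∂P|
        ≤ y + D₁ ^ 2 * (h ^ d * h ^ d) := fun y hy => (abs_sub _ _).trans (add_le_add hy hEE)
  -- Short lags, including the variances at `l = 0`; the factor (l₀ + 1)^p in `Q₂` compensates the
  -- decay that is claimed.
  by_cases hl : l < l₀
  · have hi : ∀ Z : Ω → ℝ, Measurable Z → (∀ ω, |Z ω| ≤ B * b) →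
        Integrable (fun ω => Z ω ^ 2) P := fun Z hZ hb =>
      Integrable.of_bound (hZ.pow_const 2).aestronglyMeasurable ((B * b) ^ 2)
        (ae_of_all _ fun ω => by
          rw [Real.norm_eq_abs, abs_pow]; exact pow_le_pow_left₀ (abs_nonneg _) (hb ω) 2)
    have hi₁ := hi Z₁ hm₁ hb₁
    have hi₂ := hi Z₂ hm₂ hb₂
    have hintm : Integrable (fun ω => Z₁ ω * Z₂ ω) P :=
      (Integrable.of_bound hm₂.aestronglyMeasurable _ (ae_of_all _ hb₂)).bdd_mul
        hm₁.aestronglyMeasurable (ae_of_all _ hb₁)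
    have h1 : |∫ ω, Z₁ ω * Z₂ ω ∂P| ≤ D₁ * h ^ d := by
      refine abs_integral_le_integral_abs.trans ?_
      calc _ ≤ ∫ ω, (Z₁ ω ^ 2 / 2 + Z₂ ω ^ 2 / 2) ∂P := by
            refine integral_mono hintm.abs ((hi₁.div_const 2).add (hi₂.div_const 2)) fun ω => ?_
            simp only
            rw [abs_le]
            constructor <;> nlinarith [sq_nonneg (Z₁ ω - Z₂ ω), sq_nonneg (Z₁ ω + Z₂ ω)]
        _ = (∫ ω, Z₁ ω ^ 2 ∂P + ∫ ω, Z₂ ω ^ 2 ∂P) / 2 := by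
            rw [integral_add (hi₁.div_const 2) (hi₂.div_const 2), integral_div, integral_div]
            ring
        _ ≤ _ := by
            rw [hD₁]
            linarith [hmom1.2.1, hmom2.2.1]
    have h3 : 1 ≤ ((l₀ : ℝ) + 1) ^ p * ((l : ℝ) + 1) ^ (-p) := by
      rw [Real.rpow_neg (by positivity), ← div_eq_mul_inv, one_le_div (by positivity)]
      refine Real.rpow_le_rpow (by positivity) ?_ (by linarith)
      have : (l : ℝ) ≤ l₀ := by exact_mod_cast hl.le
      linarith
    calc _ ≤ D₁ * h ^ d + D₁ ^ 2 * (h ^ d * h ^ d) := hgoal _ h1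
      _ ≤ (D₁ + D₁ ^ 2) * h ^ d * 1 := by
          have : h ^ d * h ^ d ≤ h ^ d := mul_le_of_le_one_left hhd0.le hhd1
          nlinarith [mul_le_mul_of_nonneg_left this (sq_nonneg D₁)]
      _ ≤ (D₁ + D₁ ^ 2) * h ^ d * (((l₀ : ℝ) + 1) ^ p * ((l : ℝ) + 1) ^ (-p)) :=
          mul_le_mul_of_nonneg_left h3 (by positivity)
      _ = Q₂ * h ^ d * ((l : ℝ) + 1) ^ (-p) := by rw [hQ₂]; ring
      _ ≤ _ := by
          refine mul_le_mul_of_nonneg_right (mul_le_mul_of_nonneg_right ?_ hhd0.le)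
            (by positivity)
          have : 0 ≤ Q₁ * 2 ^ p := by positivity
          linarith
  · have hl1 : 1 ≤ l := le_trans (le_max_right _ _) (hl₀ ▸ not_lt.1 hl)
    have hlp : (0 : ℝ) < l := by exact_mod_cast hl1
    have hll : lstar ≤ l := le_trans (le_max_left _ _) (hl₀ ▸ not_lt.1 hl)
    have h1 := (hgoal _ (hpairb' hll)).trans_eq (b := B ^ 2 * (C₂ * (R * h) ^ (2 * d)) +
      D₁ ^ 2 * (h ^ d * h ^ d)) (c := D₃ * (h ^ d * h ^ d)) (by
        rw [hD₃, mul_pow, mul_comm 2 d, pow_mul h, ]; ring)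
    have hDs : B ^ s * (C₁ * R ^ d * h ^ d) ≤ D₂ * h ^ d := by
      rw [hD₂]; linarith
    have h2 := (mixBound_rowField_pair hA.le hmix hl1 ht htl).abs_covariance_le_rpow (hfield _)
      (hfield _) hZ₁ hZ₂ hb₁ hb₂ hs (hmom1.2.2.trans hDs) (hmom2.2.2.trans hDs)
      (by positivity) (by positivity)
    have h3 := rpow_decay_of_two_bounds hs hA hD₂0 hD₃0 hh hl1 (abs_nonneg _) h1 h2
    rw [← hQ₁, ← hp] at h3
    have h4 : (l : ℝ) ^ (-p) ≤ 2 ^ p * ((l : ℝ) + 1) ^ (-p) := by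
      rw [Real.rpow_neg hlp.le, Real.rpow_neg (by positivity), ← div_eq_mul_inv,
        inv_eq_one_div, div_le_div_iff₀ (by positivity) (by positivity), one_mul,
        ← Real.mul_rpow (by norm_num) hlp.le]
      refine Real.rpow_le_rpow (by positivity) ?_ (by linarith)
      have : (1 : ℝ) ≤ l := by exact_mod_cast hl1
      linarith
    calc _ ≤ Q₁ * (h ^ d * (l : ℝ) ^ (-p)) := h3
      _ ≤ Q₁ * (h ^ d * (2 ^ p * ((l : ℝ) + 1) ^ (-p))) :=
          mul_le_mul_of_nonneg_left (mul_le_mul_of_nonneg_left h4 hhd0.le) hQ₁0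
      _ = (Q₁ * 2 ^ p) * h ^ d * ((l : ℝ) + 1) ^ (-p) := by ring
      _ ≤ _ := by
          refine mul_le_mul_of_nonneg_right (mul_le_mul_of_nonneg_right ?_ hhd0.le)
            (by positivity)
          linarith

end

/-! ### The pointwise deviation bound -/

theorem card_filter_abs_sub_le (N : ℕ) (y ρ : ℝ) (hρ : 0 ≤ ρ) :
    (((Finset.range N).filter fun t : ℕ => |y - (t : ℝ)| ≤ ρ).card : ℝ) ≤ 2 * ρ + 1 := by
  have hsub : ((Finset.range N).filter fun t : ℕ => |y - (t : ℝ)| ≤ ρ).map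
      ⟨((↑) : ℕ → ℤ), Nat.cast_injective⟩ ⊆ Finset.Icc ⌈y - ρ⌉ ⌊y + ρ⌋ := by
    intro z hz
    simp only [Finset.mem_map, Finset.mem_filter, Function.Embedding.coeFn_mk] at hz
    obtain ⟨t, ⟨-, ht⟩, rfl⟩ := hz
    have := abs_le.1 ht
    rw [Finset.mem_Icc, Int.ceil_le, Int.le_floor]
    push_cast
    constructor <;> linarith
  have hcard := Finset.card_le_card hsub
  rw [Finset.card_map, Int.card_Icc] at hcard
  have h1 : ((⌊y + ρ⌋ + 1 - ⌈y - ρ⌉).toNat : ℝ) ≤ 2 * ρ + 1 := by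
    rcases le_total 0 (⌊y + ρ⌋ + 1 - ⌈y - ρ⌉) with h | h
    · have : (((⌊y + ρ⌋ + 1 - ⌈y - ρ⌉).toNat : ℤ) : ℝ) = ((⌊y + ρ⌋ + 1 - ⌈y - ρ⌉ : ℤ) : ℝ) := by
        rw [Int.toNat_of_nonneg h]
      rw [Int.cast_natCast] at this
      rw [this]
      push_cast
      have := Int.floor_le (y + ρ)
      have := Int.le_ceil (y - ρ)
      linarith
    · rw [Int.toNat_of_nonpos h]
      push_cast
      linarith
  exact le_trans (by exact_mod_cast hcard) h1

/-- Each distance from `r` is attained at most once on either side. -/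
theorem sum_dist_le {c : ℕ → ℝ} (hc : ∀ l, 0 ≤ c l) (hsum : Summable c) (L r : ℕ) :
    ∑ r' ∈ Finset.range L, c (Nat.dist r r') ≤ 2 * ∑' l, c l := by
  have h1 : ∑ r' ∈ Finset.range L, c (Nat.dist r r')
      ≤ ∑ r' ∈ Finset.range L, ((if r' ≤ r then c (r - r') else 0) +
        if r ≤ r' then c (r' - r) else 0) := by
    refine Finset.sum_le_sum fun r' _ => ?_
    rcases le_total r' r with h | h
    · rw [Nat.dist_eq_sub_of_le_right h, if_pos h]
      split_ifs
      · linarith [hc (r' - r)]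
      · linarith
    · rw [Nat.dist_eq_sub_of_le h, if_pos h]
      split_ifs
      · linarith [hc (r - r')]
      · linarith
  refine h1.trans ?_
  rw [Finset.sum_add_distrib, two_mul]
  have key : ∀ (p : ℕ → Prop) [DecidablePred p] (e : ℕ → ℕ), (∀ a b, p a → p b → e a = e b → a = b) →
      ∑ r' ∈ Finset.range L, (if p r' then c (e r') else 0) ≤ ∑' l, c l := by
    intro p _ e he
    rw [← Finset.sum_filter]
    have hinj : Set.InjOn e ((Finset.range L).filter p) := by
      intro a ha b hb hab
      simp only [Finset.coe_filter, mem_ofPred_eq] at ha hb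
      exact he a b ha.2 hb.2 hab
    rw [← Finset.sum_image (f := c) hinj]
    exact hsum.sum_le_tsum _ fun l _ => hc l
  exact add_le_add (key _ _ fun a b ha hb hab => by omega) (key _ _ fun a b ha hb hab => by omega)

section

variable {Ω : Type*} {mΩ : MeasurableSpace Ω} {P : Measure Ω}

theorem integral_centered_mul [IsProbabilityMeasure P] {f g : Ω → ℝ} (hf : Integrable f P)
    (hg : Integrable g P) (hfg : Integrable (fun ω => f ω * g ω) P) :
    ∫ ω, (f ω - ∫ ω', f ω' ∂P) * (g ω - ∫ ω', g ω' ∂P) ∂P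
      = ∫ ω, f ω * g ω ∂P - (∫ ω, f ω ∂P) * ∫ ω, g ω ∂P := by
  set m₁ := ∫ ω', f ω' ∂P with hm₁
  set m₂ := ∫ ω', g ω' ∂P with hm₂
  have e : ∀ ω, (f ω - m₁) * (g ω - m₂) = f ω * g ω - (m₂ * f ω + m₁ * (g ω - m₂)) :=
    fun ω => by ring
  have h1 : Integrable (fun ω => m₂ * f ω) P := hf.const_mul _
  have h2 : Integrable (fun ω => m₁ * (g ω - m₂)) P := (hg.sub (integrable_const _)).const_mul _
  have h3 : Integrable (fun ω => m₂ * f ω + m₁ * (g ω - m₂)) P := h1.add h2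
  simp_rw [e]
  rw [integral_sub hfg h3, integral_add h1 h2, integral_const_mul, integral_const_mul,
    integral_sub hg (integrable_const _), ← hm₁, ← hm₂]
  simp only [integral_const, probReal_univ, smul_eq_mul, one_mul]
  ring

/-- Every row of the covariance matrix sums to at most 2 Σ c, and the rows outside `I` vanish. The
total is thus proportional to the number of active indices, whatever the block length. -/
theorem sum_integral_sq_block_le [IsProbabilityMeasure P] {Z : ℕ → Ω → ℝ} {b : ℝ}
    (hZm : ∀ t, Measurable (Z t)) (hb : ∀ t ω, |Z t ω| ≤ b) {c : ℕ → ℝ} (hc : ∀ l, 0 ≤ c l)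
    (hsum : Summable c) {I : ℕ → Prop} [DecidablePred I] (h0 : ∀ t ω, ¬ I t → Z t ω = 0)
    (hcov : ∀ t t', t ≤ t' → |∫ ω, Z t ω * Z t' ω ∂P| ≤ c (t' - t)) (L N : ℕ) :
    ∑ j ∈ Finset.range N, ∫ ω, (∑ r ∈ Finset.range L, Z (j * L + r) ω) ^ 2 ∂P
      ≤ ((Finset.range (N * L)).filter I).card * (2 * ∑' l, c l) := by
  have hi : ∀ t t', Integrable (fun ω => Z t ω * Z t' ω) P := fun t t' =>
    (Integrable.of_bound (hZm t').aestronglyMeasurable b (ae_of_all _ (hb t'))).bdd_mul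
      (hZm t).aestronglyMeasurable (ae_of_all _ (hb t))
  have hcov' : ∀ t t', ∫ ω, Z t ω * Z t' ω ∂P ≤ (if I t then 1 else 0) * c (Nat.dist t t') := by
    intro t t'
    by_cases hI : I t
    · rw [if_pos hI, one_mul]
      rcases le_total t t' with h | h
      · rw [Nat.dist_eq_sub_of_le h]
        exact (le_abs_self _).trans (hcov t t' h)
      · rw [Nat.dist_eq_sub_of_le_right h]
        simp_rw [mul_comm (Z t _)]
        exact (le_abs_self _).trans (hcov t' t h)
    · simp [hI, h0 t _ hI]
  have hblock : ∀ j, ∫ ω, (∑ r ∈ Finset.range L, Z (j * L + r) ω) ^ 2 ∂P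
      ≤ ∑ r ∈ Finset.range L, (if I (j * L + r) then (1 : ℝ) else 0) * (2 * ∑' l, c l) := by
    intro j
    simp_rw [sq, Finset.sum_mul_sum]
    rw [integral_finsetSum _ fun r _ => integrable_finsetSum _ fun r' _ => hi _ _]
    refine Finset.sum_le_sum fun r _ => ?_
    rw [integral_finsetSum _ fun r' _ => hi _ _]
    refine (Finset.sum_le_sum fun r' _ => hcov' _ _).trans ?_
    rw [← Finset.mul_sum]
    refine mul_le_mul_of_nonneg_left ?_ (by split_ifs <;> norm_num)
    simp_rw [Nat.dist_add_add_left]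
    exact sum_dist_le hc hsum L r
  refine (Finset.sum_le_sum fun j _ => hblock j).trans_eq ?_
  simp_rw [← Finset.sum_mul]
  congr 1
  rw [Finset.card_filter]
  push_cast
  induction N with
  | zero => simp
  | succ N ih => rw [Finset.sum_range_succ, ih, add_mul, one_mul, Finset.sum_range_add]

variable {d : ℕ} {B R : ℝ} {X : ℕ → ℕ → Ω → (Fin d → ℝ)} {W : ℕ → ℕ → Ω → ℝ} {s : ℝ}

/-- The exponential inequality at a single point (u, x). The time kernel leaves O(T h + 1) active
indices and covariances are h^d times a summable sequence, hence the variance proxy h^d (T h + 1).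
The constant `Q` depends neither on the kernel `G` nor on `g`, so that kernel and box kernel,
truncated and absolute values are all covered. -/
theorem exists_deviation_bound [IsProbabilityMeasure P] (hLB : LocalBounds P X W s)
    {A β : ℝ} (hA : 0 < A) (hs : 2 < s) (hβ : (2 * s - 2) / (s - 2) < β)
    (hmix : ∀ k : ℕ, 1 ≤ k →
      alphaMix P (fun t T ω => (X t T ω, W t T ω)) k ≤ ENNReal.ofReal (A * (k : ℝ) ^ (-β)))
    (r : ℝ) (hB : 1 ≤ B) (hR : 1 ≤ R) :
    ∃ Q : ℝ, 0 ≤ Q ∧ ∀ (T : ℕ) (h u : ℝ) (x : Fin d → ℝ) (G : ℝ → (Fin d → ℝ) → ℝ)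
      (g : ℝ → ℝ) (b l y : ℝ) (L : ℕ), IsLocKernel G B R → 0 < h → R * h ≤ 1 → ‖x‖ ≤ r →
      Measurable g → (∀ w, |g w| ≤ b) → (∀ w, |g w| ≤ |w|) → 1 ≤ T → 1 ≤ L → 0 ≤ l →
      l * (L * (2 * (B * b))) ≤ 1 →
      P.real {ω | 2 * (y + 1 + l ^ 2 * (Q * h ^ d * (T * h + 1))) ≤
          l * |∑ t ∈ Finset.Icc 1 T, (locTerm G g X W h u x T t ω -
            ∫ ω', locTerm G g X W h u x T t ω' ∂P)|}
        ≤ 4 * (Real.exp (-y) + (T / (2 * L) + 1) * (4 * Real.exp 1 * (A * (L : ℝ) ^ (-β)))) := by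
  obtain ⟨Q, p, hQ, hp, hcov⟩ := exists_covariance_bound hLB hA hs hβ hmix r hB hR
  have hsumm : Summable fun l : ℕ => ((l : ℝ) + 1) ^ (-p) := by
    have := (summable_nat_add_iff 1).2 (Real.summable_nat_rpow.2 (by linarith : -p < -1))
    simpa using this
  set Γ : ℝ := ∑' l : ℕ, ((l : ℝ) + 1) ^ (-p) with hΓ
  have hΓ0 : 0 ≤ Γ := tsum_nonneg fun l => by positivity
  refine ⟨2 * R * (2 * (Q * Γ)), by positivity, ?_⟩
  intro T h u x G g b l y L hG hh hRh hx hg hgb hgw hT hL hl hlb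
  have hB0 : 0 < B := by linarith
  have hR0 : 0 < R := by linarith
  have hTp : (0 : ℝ) < T := by exact_mod_cast hT
  have hb0 : 0 ≤ b := (abs_nonneg _).trans (hgb 0)
  -- Extension by zero to all indices allows blocks that start at 0 and overshoot `T`.
  set Z : ℕ → Ω → ℝ := fun t ω => if 1 ≤ t ∧ t ≤ T then locTerm G g X W h u x T t ω -
    ∫ ω', locTerm G g X W h u x T t ω' ∂P else 0 with hZ
  have hmZ : ∀ t, 1 ≤ t → t ≤ T → Measurable (fun ω => (X t T ω, W t T ω)) := fun t ht htT =>
    (hLB.measX t T ht htT).prodMk (hLB.measW t T ht htT)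
  have hfield := rowField_le (Z := fun t T ω => (X t T ω, W t T ω)) (T := T) hmZ
  have hlocb : ∀ t ω, |locTerm G g X W h u x T t ω| ≤ B * b := fun t ω =>
    hG.abs_locTerm_le (hgb _) hB0.le
  have hlocm : ∀ t, 1 ≤ t → t ≤ T → Measurable (locTerm G g X W h u x T t) := fun t ht htT =>
    hLB.measurable_locTerm hG hg ht htT
  have hlocint : ∀ t, 1 ≤ t → t ≤ T → Integrable (locTerm G g X W h u x T t) P :=
    fun t ht htT => Integrable.of_bound (hlocm t ht htT).aestronglyMeasurable _
      (ae_of_all _ (hlocb t))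
  have hZfield : ∀ t, Measurable[rowField (fun t T ω => (X t T ω, W t T ω)) T t] (Z t) := by
    intro t
    by_cases ht : 1 ≤ t ∧ t ≤ T
    · have : Z t = fun ω => locTerm G g X W h u x T t ω -
          ∫ ω', locTerm G g X W h u x T t ω' ∂P := by
        ext ω; simp only [hZ, if_pos ht]
      rw [this]
      exact (measurable_of_rowField (P := P) hG hg ht.1 ht.2).sub_const _
    · have : Z t = fun _ => 0 := by
        ext ω; simp only [hZ, if_neg ht]
      rw [this]
      exact measurable_const
  have hZm : ∀ t, Measurable (Z t) := fun t => (hZfield t).mono (hfield t) le_rfl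
  have hZb : ∀ t ω, |Z t ω| ≤ 2 * (B * b) := by
    intro t ω
    by_cases ht : 1 ≤ t ∧ t ≤ T
    · simp only [hZ, if_pos ht]
      have h1 : |∫ ω', locTerm G g X W h u x T t ω' ∂P| ≤ B * b := by
        refine abs_integral_le_integral_abs.trans ?_
        calc _ ≤ ∫ _, B * b ∂P := integral_mono (hlocint t ht.1 ht.2).abs (integrable_const _)
              (hlocb t)
          _ = _ := by simp
      refine (abs_sub _ _).trans ?_
      linarith [hlocb t ω]
    · simp only [hZ, if_neg ht, abs_zero]
      positivity
  have hZzero : ∀ t, ∫ ω, Z t ω ∂P = 0 := by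
    intro t
    by_cases ht : 1 ≤ t ∧ t ≤ T
    · simp only [hZ, if_pos ht]
      rw [integral_sub (hlocint t ht.1 ht.2) (integrable_const _)]
      simp
    · simp [hZ, if_neg ht]
  set c : ℕ → ℝ := fun l => Q * h ^ d * ((l : ℝ) + 1) ^ (-p) with hc
  have hc0 : ∀ l, 0 ≤ c l := fun l => by positivity
  have hZcov : ∀ t t', t ≤ t' → |∫ ω, Z t ω * Z t' ω ∂P| ≤ c (t' - t) := by
    intro t t' htt
    by_cases ht : 1 ≤ t ∧ t' ≤ T
    · have h1 := hcov T h u x G g hG hh hRh hx hg ⟨b, hgb⟩ hgw t (t' - t) ht.1 (by omega)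
      rw [Nat.add_sub_cancel' htt] at h1
      refine le_trans (le_of_eq ?_) h1
      congr 1
      have e1 : 1 ≤ t ∧ t ≤ T := ⟨ht.1, by omega⟩
      have e2 : 1 ≤ t' ∧ t' ≤ T := ⟨by omega, ht.2⟩
      simp only [hZ, if_pos e1, if_pos e2]
      have hi1 := hlocint t e1.1 e1.2
      have hi2 := hlocint t' e2.1 e2.2
      have hi3 : Integrable (fun ω => locTerm G g X W h u x T t ω * locTerm G g X W h u x T t' ω)
        P := hi2.bdd_mul (hlocm t e1.1 e1.2).aestronglyMeasurable (ae_of_all _ (hlocb t))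
      exact integral_centered_mul hi1 hi2 hi3
    · have : ∀ ω, Z t ω * Z t' ω = 0 := fun ω => by
        rw [mul_eq_zero]
        by_cases h1 : 1 ≤ t
        · right; simp only [hZ]; exact if_neg (by omega)
        · left; simp only [hZ]; exact if_neg (by omega)
      simp only [this, integral_zero, abs_zero]
      exact hc0 _
  set I : ℕ → Prop := fun t => |u * T - (t : ℝ)| ≤ R * h * T with hI
  have hZI : ∀ t ω, ¬ I t → Z t ω = 0 := by
    intro t ω ht
    have h1 : R * h < |u - (t : ℝ) / T| := by
      have h2 : R * h * T < |u * T - (t : ℝ)| := not_le.1 ht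
      have h3 : u * T - (t : ℝ) = (u - (t : ℝ) / T) * T := by field_simp
      rw [h3, abs_mul, abs_of_pos hTp] at h2
      exact lt_of_mul_lt_mul_right h2 hTp.le
    have h4 : ∀ ω, locTerm G g X W h u x T t ω = 0 := fun ω => by
      rw [locTerm, hG.locWeight_eq_zero_of_time hh h1, zero_mul]
    simp [hZ, h4]
  classical
  -- With this `n` the `2 * n` blocks of length `L` cover all indices up to `T`.
  obtain ⟨n, hn⟩ : ∃ n : ℕ, n = T / (2 * L) + 1 := ⟨_, rfl⟩
  have hnT : T < 2 * n * L := by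
    have := Nat.lt_mul_div_succ T (show 0 < 2 * L by omega)
    rw [hn]; calc T < _ := this
      _ = _ := by ring
  have hnle : (n : ℝ) ≤ T / (2 * L) + 1 := by
    rw [hn]; push_cast
    have : ((T / (2 * L) : ℕ) : ℝ) ≤ T / ((2 * L : ℕ) : ℝ) := Nat.cast_div_le
    push_cast at this
    linarith
  have hv := sum_integral_sq_block_le (P := P) hZm hZb hc0 (hsumm.mul_left _) hZI hZcov L (2 * n)
  have hv' : ∑ j ∈ Finset.range (2 * n), ∫ ω, (∑ r ∈ Finset.range L, Z (j * L + r) ω) ^ 2 ∂P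
      ≤ 2 * R * (2 * (Q * Γ)) * h ^ d * (T * h + 1) := by
    refine hv.trans ?_
    simp only [hc]
    rw [tsum_mul_left, ← hΓ]
    have h1 := card_filter_abs_sub_le (2 * n * L) (u * T) (R * h * T) (by positivity)
    calc _ ≤ (2 * (R * h * T) + 1) * (2 * (Q * h ^ d * Γ)) :=
          mul_le_mul_of_nonneg_right h1 (by positivity)
      _ ≤ (2 * R * (T * h + 1)) * (2 * (Q * h ^ d * Γ)) := by
          refine mul_le_mul_of_nonneg_right ?_ (by positivity)
          nlinarith
      _ = _ := by ring
  have hmain := measureReal_abs_sum_ge_le_of_mixing hfield hZfield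
    (by positivity : 0 ≤ A * (L : ℝ) ^ (-β)) (mixBound_rowField hA.le hmix T hL) hZb hl hlb hZzero
    hv' y
  have hsumeq : ∀ ω, ∑ t ∈ Finset.range (2 * n * L), Z t ω = ∑ t ∈ Finset.Icc 1 T,
      (locTerm G g X W h u x T t ω - ∫ ω', locTerm G g X W h u x T t ω' ∂P) := by
    intro ω
    simp only [hZ]
    rw [← Finset.sum_filter]
    refine Finset.sum_congr ?_ fun _ _ => rfl
    ext t
    simp only [Finset.mem_filter, Finset.mem_range, Finset.mem_Icc]
    omega
  simp_rw [hsumeq] at hmain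
  refine hmain.trans ?_
  have : 0 ≤ 4 * Real.exp 1 * (A * (L : ℝ) ^ (-β)) := by positivity
  have := mul_le_mul_of_nonneg_right hnle this
  linarith

end

/-! ### Discretization of the supremum -/

/-- The grid consists of points of the lattice m ℤ^{d+1}. It may stick out of the region to be
covered, also in time; the deviation bounds hold for all real u and for norms up to `r + 2`. -/
theorem exists_grid (d : ℕ) {r m : ℝ} (hm : 0 < m) (hm1 : m ≤ 1) (hr : 0 ≤ r) :
    ∃ 𝒢 : Finset (ℝ × (Fin d → ℝ)), (𝒢.card : ℝ) ≤ ((2 * r + 5) / m) ^ (d + 1) ∧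
      (∀ p ∈ 𝒢, ‖p.2‖ ≤ r + 2) ∧
      ∀ (u : ℝ) (x : Fin d → ℝ), |u| ≤ r → ‖x‖ ≤ r → ∃ p ∈ 𝒢, |u - p.1| ≤ m ∧ ‖x - p.2‖ ≤ m := by
  classical
  obtain ⟨n, hn⟩ : ∃ n : ℕ, n = ⌈r / m⌉₊ + 1 := ⟨_, rfl⟩
  have hn1 : r / m + 1 ≤ n := by
    rw [hn]; push_cast; linarith [Nat.le_ceil (r / m)]
  have hn2 : (n : ℝ) ≤ r / m + 2 := by
    rw [hn]; push_cast; linarith [Nat.ceil_lt_add_one (div_nonneg hr hm.le)]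
  set J : Finset ℤ := Finset.Icc (-(n : ℤ)) n with hJ
  have hJcard : (J.card : ℝ) ≤ (2 * r + 5) / m := by
    rw [hJ, Int.card_Icc]
    have : ((n : ℤ) + 1 - -(n : ℤ)).toNat = 2 * n + 1 := by omega
    rw [this, le_div_iff₀ hm]
    push_cast
    have h1 : (n : ℝ) * m ≤ r + 2 * m := by
      calc (n : ℝ) * m ≤ (r / m + 2) * m := mul_le_mul_of_nonneg_right hn2 hm.le
        _ = r + 2 * m := by field_simp
    nlinarith
  have hnear : ∀ y : ℝ, |y| ≤ r → ∃ k ∈ J, |y - m * (k : ℝ)| ≤ m := by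
    intro y hy
    refine ⟨⌊y / m⌋, ?_, ?_⟩
    · have h1 : |y / m| ≤ r / m := by rw [abs_div, abs_of_pos hm]; gcongr
      have h2 := abs_le.1 h1
      rw [hJ, Finset.mem_Icc]
      constructor
      · rw [Int.le_floor]; push_cast; linarith
      · have h3 := Int.floor_le (y / m)
        have : ((⌊y / m⌋ : ℤ) : ℝ) ≤ (n : ℤ) := by push_cast; linarith
        exact_mod_cast this
    · have h1 := Int.floor_le (y / m)
      have h2 := Int.lt_floor_add_one (y / m)
      have h3 : y = m * (y / m) := by field_simp
      rw [h3, ← mul_sub, abs_mul, abs_of_pos hm, mul_div_cancel_left₀ _ hm.ne',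
        abs_of_nonneg (by linarith)]
      nlinarith
  refine ⟨(J ×ˢ Fintype.piFinset fun _ : Fin d => J).image
    fun q => (m * (q.1 : ℝ), fun j => m * (q.2 j : ℝ)), ?_, ?_, ?_⟩
  · calc _ ≤ (((J ×ˢ Fintype.piFinset fun _ : Fin d => J).card : ℕ) : ℝ) := by
          exact_mod_cast Finset.card_image_le
      _ = (J.card : ℝ) ^ (d + 1) := by
          rw [Finset.card_product, Fintype.card_piFinset]
          simp [pow_succ, mul_comm]
      _ ≤ _ := pow_le_pow_left₀ (by positivity) hJcard _
  · intro p hp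
    simp only [Finset.mem_image, Finset.mem_product, Fintype.mem_piFinset] at hp
    obtain ⟨q, ⟨-, hq⟩, rfl⟩ := hp
    refine (pi_norm_le_iff_of_nonneg (by linarith)).2 fun j => ?_
    have h1 := Finset.mem_Icc.1 (hq j)
    have h2 : |(q.2 j : ℝ)| ≤ n := by
      rw [abs_le]; constructor
      · exact_mod_cast h1.1
      · exact_mod_cast h1.2
    rw [Real.norm_eq_abs, abs_mul, abs_of_pos hm]
    calc m * |(q.2 j : ℝ)| ≤ m * (r / m + 2) :=
          mul_le_mul_of_nonneg_left (h2.trans hn2) hm.le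
      _ = r + 2 * m := by field_simp
      _ ≤ r + 2 := by linarith
  · intro u x hu hx
    obtain ⟨k, hk, hku⟩ := hnear u hu
    choose κ hκ hκx using fun j => hnear (x j) ((norm_le_pi_norm x j).trans hx)
    refine ⟨(m * (k : ℝ), fun j => m * (κ j : ℝ)), ?_, hku, ?_⟩
    · exact Finset.mem_image.2 ⟨(k, κ), Finset.mem_product.2
        ⟨hk, Fintype.mem_piFinset.2 hκ⟩, rfl⟩
    · exact (pi_norm_le_iff_of_nonneg hm.le).2 hκx

/-- The indicator of the box of radius `R`. -/
def boxKernel {d : ℕ} (R : ℝ) (v : ℝ) (z : Fin d → ℝ) : ℝ :=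
  if |v| ≤ R ∧ ‖z‖ ≤ R then 1 else 0

theorem isLocKernel_boxKernel {d : ℕ} {B R : ℝ} (hB : 1 ≤ B) :
    IsLocKernel (boxKernel R : ℝ → (Fin d → ℝ) → ℝ) B R := by
  refine ⟨fun v => ?_, fun v z => ?_, fun v z hv => ?_, fun v z hz => ?_⟩
  · refine Measurable.ite ?_ measurable_const measurable_const
    by_cases hv : |v| ≤ R
    · simpa [hv] using measurableSet_le measurable_norm measurable_const
    · simp [hv]
  · unfold boxKernel
    split_ifs <;> simp <;> linarith
  · simp [boxKernel, not_le.2 hv]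
  · simp [boxKernel, not_le.2 hz]

theorem IsLocKernel.mono {d : ℕ} {G : ℝ → (Fin d → ℝ) → ℝ} {B R B' R' : ℝ}
    (hG : IsLocKernel G B R) (hB : B ≤ B') (hR : R ≤ R') : IsLocKernel G B' R' :=
  ⟨hG.meas, fun v z => (hG.bound v z).trans hB, fun v z hv => hG.supp_time v z (hR.trans_lt hv),
    fun v z hz => hG.supp_space v z (hR.trans_lt hz)⟩

/-- Truncation at level `τ`. -/
def trunc (τ w : ℝ) : ℝ := if |w| ≤ τ then w else 0

theorem measurable_trunc (τ : ℝ) : Measurable (trunc τ) :=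
  Measurable.ite (measurableSet_le measurable_norm measurable_const) measurable_id measurable_const

theorem abs_trunc_le (τ w : ℝ) : |trunc τ w| ≤ |w| := by
  unfold trunc; split_ifs <;> simp

theorem abs_trunc_le_level {τ : ℝ} (hτ : 0 ≤ τ) (w : ℝ) : |trunc τ w| ≤ τ := by
  unfold trunc; split_ifs with h
  · exact h
  · simpa using hτ

theorem trunc_of_abs_le {τ w : ℝ} (h : |w| ≤ τ) : trunc τ w = w := if_pos h

theorem abs_sub_trunc_le {τ s : ℝ} (hτ : 0 < τ) (hs : 1 ≤ s) (w : ℝ) :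
    |w - trunc τ w| ≤ τ ^ (1 - s) * (1 + |w| ^ s) := by
  unfold trunc
  split_ifs with h
  · rw [sub_self, abs_zero]; positivity
  · have hpos : 0 < |w| := hτ.trans (not_le.1 h)
    rw [sub_zero]
    calc |w| = |w| ^ (1 - s) * |w| ^ s := by rw [← Real.rpow_add hpos]; simp
      _ ≤ τ ^ (1 - s) * (1 + |w| ^ s) := mul_le_mul
          (Real.rpow_le_rpow_of_nonpos hτ (not_le.1 h).le (by linarith)) (by linarith)
          (by positivity) (by positivity)

section

variable {Ω : Type*} {mΩ : MeasurableSpace Ω} {P : Measure Ω} {d : ℕ}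
  {X : ℕ → ℕ → Ω → (Fin d → ℝ)} {W : ℕ → ℕ → Ω → ℝ} {s : ℝ}

/-- Both arguments move by at most a ≤ 1. Hence either the shifted one lies in the box of radius `R
+ 1`, where the Lipschitz bound applies, or both weights vanish. Keeping the box indicator retains
the localization. -/
theorem abs_locWeight_sub_le {G : ℝ → (Fin d → ℝ) → ℝ} {B R Λ h a : ℝ} (hG : IsLocKernel G B R)
    (hLip : ∀ v v' z z', |G v z - G v' z'| ≤ Λ * max |v - v'| ‖z - z'‖) (hΛ : 0 ≤ Λ)
    (hh : 0 < h) (ha : a ≤ 1) {u u' : ℝ} {x x' : Fin d → ℝ}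
    (hu : |u - u'| ≤ a * h) (hx : ‖x - x'‖ ≤ a * h) (t T : ℕ) (ω : Ω) :
    |locWeight G X h u x t T ω - locWeight G X h u' x' t T ω|
      ≤ Λ * a * locWeight (boxKernel (R + 1)) X h u' x' t T ω := by
  unfold locWeight
  set v := (u - (t : ℝ) / T) / h
  set v' := (u' - (t : ℝ) / T) / h
  set z : Fin d → ℝ := fun j => (x j - X t T ω j) / h
  set z' : Fin d → ℝ := fun j => (x' j - X t T ω j) / h
  have hv : |v - v'| ≤ a := by
    have : v - v' = (u - u') / h := by simp only [v, v']; field_simp; ring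
    rw [this, abs_div, abs_of_pos hh, div_le_iff₀ hh]
    exact hu
  have hz : ‖z - z'‖ ≤ a := by
    have : z - z' = h⁻¹ • (x - x') := by
      ext j; simp [z, z']; field_simp; ring
    rw [this, norm_smul, norm_inv, Real.norm_eq_abs, abs_of_pos hh, inv_mul_le_iff₀ hh, mul_comm]
    exact hx
  by_cases hbox : |v'| ≤ R + 1 ∧ ‖z'‖ ≤ R + 1
  · rw [boxKernel, if_pos hbox, mul_one]
    exact (hLip v v' z z').trans (mul_le_mul_of_nonneg_left (max_le hv hz) hΛ)
  · have h0 : G v z = 0 ∧ G v' z' = 0 := by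
      rcases not_and_or.1 hbox with hc | hc
      · have hc := not_le.1 hc
        have : |v'| ≤ |v| + |v - v'| := by
          calc |v'| = |v - (v - v')| := by congr 1; ring
            _ ≤ _ := abs_sub _ _
        exact ⟨hG.supp_time _ _ (by linarith), hG.supp_time _ _ (by linarith)⟩
      · have hc := not_le.1 hc
        have : ‖z'‖ ≤ ‖z‖ + ‖z - z'‖ := by
          calc ‖z'‖ = ‖z - (z - z')‖ := by congr 1; abel
            _ ≤ _ := norm_sub_le _ _
        exact ⟨hG.supp_space _ _ (by linarith), hG.supp_space _ _ (by linarith)⟩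
    rw [h0.1, h0.2, boxKernel, if_neg hbox]
    simp

/-- The centered sum of the localized variables. -/
def deviation (P : Measure Ω) (G : ℝ → (Fin d → ℝ) → ℝ) (g : ℝ → ℝ) (X : ℕ → ℕ → Ω → (Fin d → ℝ))
    (W : ℕ → ℕ → Ω → ℝ) (h u : ℝ) (x : Fin d → ℝ) (T : ℕ) (ω : Ω) : ℝ :=
  ∑ t ∈ Finset.Icc 1 T, (locTerm G g X W h u x T t ω - ∫ ω', locTerm G g X W h u x T t ω' ∂P)

/-- The increment is dominated termwise by a nonnegative localized variable, whose sum is its own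
deviation plus its mean. The mean is counted twice because the increment is centred as well. -/
theorem abs_deviation_sub_le [IsProbabilityMeasure P] (hLB : LocalBounds P X W s) (hs : 1 ≤ s)
    {G : ℝ → (Fin d → ℝ) → ℝ} {B R Λ h a : ℝ} (hB : 1 ≤ B) (hG : IsLocKernel G B R)
    (hLip : ∀ v v' z z', |G v z - G v' z'| ≤ Λ * max |v - v'| ‖z - z'‖) (hΛ : 0 ≤ Λ)
    (hh : 0 < h) (ha : a ≤ 1) {g : ℝ → ℝ} (hg : Measurable g) (hgw : ∀ w, |g w| ≤ |w|)
    {u u' : ℝ} {x x' : Fin d → ℝ}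
    (hu : |u - u'| ≤ a * h) (hx : ‖x - x'‖ ≤ a * h) (T : ℕ) (ω : Ω) :
    |deviation P G g X W h u x T ω - deviation P G g X W h u' x' T ω| ≤ Λ * a *
      (|deviation P (boxKernel (R + 1)) (fun w => |g w|) X W h u' x' T ω| +
        2 * ∑ t ∈ Finset.Icc 1 T,
          ∫ ω', locTerm (boxKernel (R + 1)) (fun w => |g w|) X W h u' x' T t ω' ∂P) := by
  have hbox := isLocKernel_boxKernel (d := d) (R := R + 1) hB
  set F := locTerm G g X W h u x T
  set F' := locTerm G g X W h u' x' T
  set F₂ := locTerm (boxKernel (R + 1)) (fun w => |g w|) X W h u' x' T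
  have hFF : ∀ t ω, |F t ω - F' t ω| ≤ Λ * a * F₂ t ω := by
    intro t ω
    have := abs_locWeight_sub_le (X := X) hG hLip hΛ hh ha hu hx t T ω
    simp only [F, F', F₂, locTerm]
    rw [← sub_mul, abs_mul, ← mul_assoc]
    exact mul_le_mul_of_nonneg_right this (abs_nonneg _)
  have hi : ∀ t, 1 ≤ t → t ≤ T → Integrable (F t) P := fun t ht htT =>
    hLB.integrable_locTerm hG hg hgw (by linarith) hs ht htT
  have hi' : ∀ t, 1 ≤ t → t ≤ T → Integrable (F' t) P := fun t ht htT =>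
    hLB.integrable_locTerm hG hg hgw (by linarith) hs ht htT
  have hi₂ : ∀ t, 1 ≤ t → t ≤ T → Integrable (F₂ t) P := fun t ht htT =>
    hLB.integrable_locTerm hbox (measurable_norm.comp hg) (fun w => by simpa using hgw w)
      (by linarith) hs ht htT
  have hterm : ∀ t ∈ Finset.Icc 1 T, |(F t ω - ∫ ω', F t ω' ∂P) - (F' t ω - ∫ ω', F' t ω' ∂P)|
      ≤ Λ * a * (F₂ t ω - ∫ ω', F₂ t ω' ∂P + 2 * ∫ ω', F₂ t ω' ∂P) := by
    intro t ht
    obtain ⟨ht1, htT⟩ := Finset.mem_Icc.1 ht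
    have h1 : |∫ ω', F t ω' ∂P - ∫ ω', F' t ω' ∂P| ≤ Λ * a * ∫ ω', F₂ t ω' ∂P := by
      rw [← integral_sub (hi t ht1 htT) (hi' t ht1 htT), ← integral_const_mul]
      exact abs_integral_le_integral_abs.trans (integral_mono
        ((hi t ht1 htT).sub (hi' t ht1 htT)).abs ((hi₂ t ht1 htT).const_mul _) (hFF t))
    calc _ = |(F t ω - F' t ω) - (∫ ω', F t ω' ∂P - ∫ ω', F' t ω' ∂P)| := by congr 1; ring
      _ ≤ |F t ω - F' t ω| + |∫ ω', F t ω' ∂P - ∫ ω', F' t ω' ∂P| := abs_sub _ _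
      _ ≤ Λ * a * F₂ t ω + Λ * a * ∫ ω', F₂ t ω' ∂P := add_le_add (hFF t ω) h1
      _ = _ := by ring
  have hΛa : 0 ≤ Λ * a := by
    have : 0 ≤ a * h := (abs_nonneg _).trans hu
    exact mul_nonneg hΛ (nonneg_of_mul_nonneg_left this hh)
  unfold deviation
  rw [← Finset.sum_sub_distrib]
  refine (Finset.abs_sum_le_sum_abs _ _).trans ((Finset.sum_le_sum hterm).trans ?_)
  rw [← Finset.mul_sum, Finset.sum_add_distrib, ← Finset.mul_sum]
  exact mul_le_mul_of_nonneg_left (add_le_add (le_abs_self _) le_rfl) hΛa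

/-- Chaining in one step. Off the event that some |W| exceeds τ, the supremum is at most the value
at a grid point, the oscillation, and the truncated part of the mean. The mesh `a * h` makes the
oscillation `a` times a quantity of the order of the mean. -/
theorem measure_sup_deviation_le [IsProbabilityMeasure P] (hLB : LocalBounds P X W s) (hs : 1 ≤ s)
    {G : ℝ → (Fin d → ℝ) → ℝ} {B R Λ h a : ℝ} (hB : 1 ≤ B) (hG : IsLocKernel G B R)
    (hLip : ∀ v v' z z', |G v z - G v' z'| ≤ Λ * max |v - v'| ‖z - z'‖) (hΛ : 0 ≤ Λ)
    (hh : 0 < h) (hh1 : h ≤ 1) (ha0 : 0 < a) (ha : a ≤ 1) {τ r M E₂ tl π₀ π₁ : ℝ} (hr : 1 ≤ r)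
    {T : ℕ}
    (hdev : ∀ (u : ℝ) (x : Fin d → ℝ), ‖x‖ ≤ r + 2 →
      P.real {ω | M ≤ |deviation P G (trunc τ) X W h u x T ω|} ≤ π₁ ∧
      P.real {ω | M ≤ |deviation P (boxKernel (R + 1)) (fun w => |trunc τ w|) X W h u x T ω|} ≤ π₁)
    (hE₂ : ∀ (u : ℝ) (x : Fin d → ℝ), ‖x‖ ≤ r + 2 → ∑ t ∈ Finset.Icc 1 T,
      ∫ ω, locTerm (boxKernel (R + 1)) (fun w => |trunc τ w|) X W h u x T t ω ∂P ≤ E₂)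
    (htail : ∀ (u : ℝ) (x : Fin d → ℝ), ‖x‖ ≤ r → ∑ t ∈ Finset.Icc 1 T,
      |∫ ω, locTerm G id X W h u x T t ω ∂P - ∫ ω, locTerm G (trunc τ) X W h u x T t ω ∂P| ≤ tl)
    (hmax : P.real {ω | ∃ t ∈ Finset.Icc 1 T, τ < |W t T ω|} ≤ π₀) :
    P {ω | ∃ u ∈ Icc (0 : ℝ) 1, ∃ x : Fin d → ℝ, ‖x‖ ≤ r ∧
      M + Λ * a * (M + 2 * E₂) + tl < |deviation P G id X W h u x T ω|}
      ≤ ENNReal.ofReal (π₀ + ((2 * r + 5) / (a * h)) ^ (d + 1) * (2 * π₁)) := by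
  have hah : 0 < a * h := mul_pos ha0 hh
  obtain ⟨𝒢, hcard, hnorm, hnear⟩ := exists_grid d hah (by nlinarith : a * h ≤ 1)
    (by linarith : 0 ≤ r)
  set E₀ : Set Ω := {ω | ∃ t ∈ Finset.Icc 1 T, τ < |W t T ω|}
  set E₁ : Set Ω := ⋃ p ∈ 𝒢, ({ω | M ≤ |deviation P G (trunc τ) X W h p.1 p.2 T ω|} ∪
    {ω | M ≤ |deviation P (boxKernel (R + 1)) (fun w => |trunc τ w|) X W h p.1 p.2 T ω|})
  have hsub : {ω | ∃ u ∈ Icc (0 : ℝ) 1, ∃ x : Fin d → ℝ, ‖x‖ ≤ r ∧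
      M + Λ * a * (M + 2 * E₂) + tl < |deviation P G id X W h u x T ω|} ⊆ E₀ ∪ E₁ := by
    rintro ω ⟨u, hu, x, hx, hlt⟩
    by_contra hcon
    rw [mem_union, not_or] at hcon
    obtain ⟨h0, h1⟩ := hcon
    have hW : ∀ t ∈ Finset.Icc 1 T, |W t T ω| ≤ τ := fun t ht => by
      by_contra hc
      exact h0 ⟨t, ht, not_le.1 hc⟩
    obtain ⟨p, hp, hup, hxp⟩ := hnear u x (abs_le.2 ⟨by linarith [hu.1], by linarith [hu.2]⟩) hx
    have h2 : |deviation P G (trunc τ) X W h p.1 p.2 T ω| < M := by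
      by_contra hc
      exact h1 (mem_biUnion hp (Or.inl (not_lt.1 hc)))
    have h3 : |deviation P (boxKernel (R + 1)) (fun w => |trunc τ w|) X W h p.1 p.2 T ω| < M := by
      by_contra hc
      exact h1 (mem_biUnion hp (Or.inr (not_lt.1 hc)))
    have h4 := abs_deviation_sub_le hLB hs hB hG hLip hΛ hh ha (measurable_trunc τ)
      (abs_trunc_le τ) hup hxp T ω
    -- For this ω nothing is truncated, so only the expectations differ.
    have h5 : |deviation P G id X W h u x T ω - deviation P G (trunc τ) X W h u x T ω| ≤ tl := by
      refine le_trans ?_ (htail u x hx)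
      unfold deviation
      rw [← Finset.sum_sub_distrib]
      refine (Finset.abs_sum_le_sum_abs _ _).trans (Finset.sum_le_sum fun t ht => le_of_eq ?_)
      have : locTerm G id X W h u x T t ω = locTerm G (trunc τ) X W h u x T t ω := by
        simp only [locTerm, trunc_of_abs_le (hW t ht), id]
      rw [this, ← abs_neg]
      congr 1; ring
    have h6 : Λ * a * (|deviation P (boxKernel (R + 1)) (fun w => |trunc τ w|) X W h p.1 p.2 T ω| +
        2 * ∑ t ∈ Finset.Icc 1 T, ∫ ω', locTerm (boxKernel (R + 1)) (fun w => |trunc τ w|)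
          X W h p.1 p.2 T t ω' ∂P) ≤ Λ * a * (M + 2 * E₂) :=
      mul_le_mul_of_nonneg_left (by linarith [hE₂ p.1 p.2 (hnorm p hp)]) (by positivity)
    have h7 : |deviation P G id X W h u x T ω| ≤
        |deviation P G id X W h u x T ω - deviation P G (trunc τ) X W h u x T ω| +
        |deviation P G (trunc τ) X W h u x T ω - deviation P G (trunc τ) X W h p.1 p.2 T ω| +
        |deviation P G (trunc τ) X W h p.1 p.2 T ω| := by
      refine le_trans (le_of_eq ?_) (abs_add_three _ _ _)
      congr 1; ring
    linarith
  have hE₁ : P.real E₁ ≤ ((2 * r + 5) / (a * h)) ^ (d + 1) * (2 * π₁) := by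
    have hπ : 0 ≤ π₁ := measureReal_nonneg.trans (hdev 0 0 (by simp; linarith)).1
    calc P.real E₁ ≤ ∑ p ∈ 𝒢, P.real ({ω | M ≤ |deviation P G (trunc τ) X W h p.1 p.2 T ω|} ∪
          {ω | M ≤ |deviation P (boxKernel (R + 1)) (fun w => |trunc τ w|) X W h p.1 p.2 T ω|}) :=
          measureReal_biUnion_finset_le _ _
      _ ≤ ∑ p ∈ 𝒢, 2 * π₁ := by
          refine Finset.sum_le_sum fun p hp => (measureReal_union_le _ _).trans ?_
          have := hdev p.1 p.2 (hnorm p hp)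
          linarith [this.1, this.2]
      _ = 𝒢.card * (2 * π₁) := by simp
      _ ≤ _ := mul_le_mul_of_nonneg_right hcard (by positivity)
  calc _ ≤ P (E₀ ∪ E₁) := measure_mono hsub
    _ = ENNReal.ofReal (P.real (E₀ ∪ E₁)) := (ofReal_measureReal).symm
    _ ≤ _ := ENNReal.ofReal_le_ofReal ((measureReal_union_le _ _).trans (add_le_add hmax hE₁))

end

/-! ### Rates -/

/-- The stochastic rate `√(log T / (T h^{d+1}))`. -/
def stochRate (d : ℕ) (h : ℝ) (T : ℕ) : ℝ := Real.sqrt (Real.log T / (T * h ^ (d + 1)))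

/-! ### Arithmetic of the exponent θ. -/

section Theta

variable {d : ℕ} {s β : ℝ}

theorem lt_beta_of_condition (hs : 2 < s) (hβ : (2 + s * (1 + ((d : ℝ) + 1))) / (s - 2) < β) :
    (d : ℝ) + 2 < β := by
  have h1 : 2 + s * (1 + ((d : ℝ) + 1)) < β * (s - 2) := (div_lt_iff₀ (by linarith)).1 hβ
  have hd : (0 : ℝ) ≤ d := Nat.cast_nonneg d
  by_contra hcon
  push Not at hcon
  have : β * (s - 2) ≤ ((d : ℝ) + 2) * (s - 2) := mul_le_mul_of_nonneg_right hcon (by linarith)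
  nlinarith

theorem theta_mul (hs : 2 < s) (hβ : (2 + s * (1 + ((d : ℝ) + 1))) / (s - 2) < β) :
    theta d s β * (β + 2 - d) = β * (1 - 2 / s) - 2 / s - 1 - ((d : ℝ) + 1) := by
  have h1 := lt_beta_of_condition hs hβ
  have h2 : β + 3 - ((d : ℝ) + 1) ≠ 0 := by linarith
  unfold theta
  rw [show β + 2 - (d : ℝ) = β + 3 - ((d : ℝ) + 1) by ring, div_mul_cancel₀ _ h2]

/-- This yields T^{2/s} a² ≤ log T / (T^θ h^{d+1}) → 0 for a = `stochRate d h T`, so that blocks of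
length about 1/(T^{1/s} a) are eventually nonempty. -/
theorem theta_le (hs : 2 < s) (hβ : (2 + s * (1 + ((d : ℝ) + 1))) / (s - 2) < β) :
    theta d s β ≤ 1 - 2 / s := by
  have h1 := lt_beta_of_condition hs hβ
  have hd : (0 : ℝ) ≤ d := Nat.cast_nonneg d
  have h2 : 0 < β + 3 - ((d : ℝ) + 1) := by linarith
  have h3 : 0 < 2 / s := by positivity
  have h4 : 2 / s < 1 := by rw [div_lt_one (by linarith)]; exact hs
  unfold theta
  rw [div_le_iff₀ h2]
  nlinarith [mul_nonneg hd h3.le]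

theorem theta_le_one (hs : 2 < s) (hβ : (2 + s * (1 + ((d : ℝ) + 1))) / (s - 2) < β) :
    theta d s β ≤ 1 := by
  have h3 : 0 < 2 / s := by positivity
  linarith [theta_le hs hβ]

/-- The left side is the number of grid points times the mixing error T L^{-(β+1)} with 1/L replaced
by x^{1/s} a, up to constants. The definition of θ is what makes all powers of x and h combine into
one power of ℓ / (x^θ h^{d+1}); this is checked on logarithms. -/
theorem cover_mul_mixing_eq {a h x ℓ : ℝ} (hs : 2 < s)
    (hβ : (2 + s * (1 + ((d : ℝ) + 1))) / (s - 2) < β) (hh : 0 < h) (hx : 0 < x) (hℓ : 0 < ℓ)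
    (ha : a = Real.sqrt (ℓ / (x * h ^ (d + 1)))) :
    (1 / (a * h)) ^ (d + 1) * (x * (x ^ (1 / s) * a) ^ (β + 1))
      = (ℓ / (x ^ theta d s β * h ^ (d + 1))) ^ ((β + 2 - d) / 2) / ℓ := by
  have ha0 : 0 < a := by rw [ha]; positivity
  have hloga : Real.log a = (Real.log ℓ - (Real.log x + (d + 1) * Real.log h)) / 2 := by
    rw [ha, Real.log_sqrt (by positivity), Real.log_div hℓ.ne' (by positivity),
      Real.log_mul hx.ne' (by positivity), Real.log_pow]
    push_cast; ring
  refine Real.log_injOn_pos (mem_Ioi.2 (by positivity)) (mem_Ioi.2 (by positivity)) ?_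
  have e1 : Real.log ((1 / (a * h)) ^ (d + 1) * (x * (x ^ (1 / s) * a) ^ (β + 1)))
      = -((d : ℝ) + 1) * (Real.log a + Real.log h) + (Real.log x + (β + 1) *
        (1 / s * Real.log x + Real.log a)) := by
    rw [Real.log_mul (by positivity) (by positivity), Real.log_pow, one_div, Real.log_inv,
      Real.log_mul ha0.ne' hh.ne', Real.log_mul hx.ne' (by positivity),
      Real.log_rpow (by positivity), Real.log_mul (by positivity) ha0.ne', Real.log_rpow hx]
    push_cast; ring
  have e2 : Real.log ((ℓ / (x ^ theta d s β * h ^ (d + 1))) ^ ((β + 2 - d) / 2) / ℓ)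
      = ((β + 2 - d) / 2) * (Real.log ℓ - (theta d s β * Real.log x + (d + 1) * Real.log h))
        - Real.log ℓ := by
    rw [Real.log_div (by positivity) hℓ.ne', Real.log_rpow (by positivity),
      Real.log_div hℓ.ne' (by positivity), Real.log_mul (by positivity) (by positivity),
      Real.log_rpow hx, Real.log_pow]
    push_cast; ring
  rw [e1, e2, hloga]
  have h3 : theta d s β * (β + 2 - d) * Real.log x
      = (β * (1 - 2 / s) - 2 / s - 1 - ((d : ℝ) + 1)) * Real.log x := by
    rw [theta_mul hs hβ]
  rw [show (2 : ℝ) / s = 2 * (1 / s) by ring] at h3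
  linear_combination (1 / 2) * h3

end Theta

/-- Consequences of the bandwidth condition at a given sample size. -/
theorem stochRate_facts {d T : ℕ} {s β h : ℝ} (hs : 2 < s)
    (hβ : (2 + s * (1 + ((d : ℝ) + 1))) / (s - 2) < β) (hT : 1 ≤ T) (hh : 0 < h) (hh1 : h ≤ 1)
    (hlog : 1 ≤ Real.log T) (hw : Real.log T / ((T : ℝ) ^ theta d s β * h ^ (d + 1)) ≤ 1) :
    0 < stochRate d h T ∧ stochRate d h T ≤ 1 ∧
    stochRate d h T ^ 2 * (T * h ^ (d + 1)) = Real.log T ∧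
    1 ≤ T * h ∧ (T : ℝ) ^ (-(1 / 2) : ℝ) ≤ stochRate d h T ∧
    (1 / (stochRate d h T * h)) ^ (d + 1) ≤ (T : ℝ) ^ (d + 2) ∧
    ((T : ℝ) ^ (1 / s) * stochRate d h T) ^ 2 ≤
      Real.log T / ((T : ℝ) ^ theta d s β * h ^ (d + 1)) := by
  have hT1 : (1 : ℝ) ≤ T := by exact_mod_cast hT
  have hT0 : (0 : ℝ) < T := by linarith
  have hℓ : 0 < Real.log T := by linarith
  have hH0 : 0 < h ^ (d + 1) := by positivity
  have hH1 : h ^ (d + 1) ≤ 1 := pow_le_one₀ hh.le hh1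
  have hHh : h ^ (d + 1) ≤ h := by
    rw [pow_succ]; exact mul_le_of_le_one_left hh.le (pow_le_one₀ hh.le hh1)
  have hTθ : (T : ℝ) ^ theta d s β ≤ T := by
    calc (T : ℝ) ^ theta d s β ≤ (T : ℝ) ^ (1 : ℝ) :=
          Real.rpow_le_rpow_of_exponent_le hT1 (theta_le_one hs hβ)
      _ = T := Real.rpow_one _
  have hTθ0 : 0 < (T : ℝ) ^ theta d s β := by positivity
  have hsq : stochRate d h T ^ 2 = Real.log T / (T * h ^ (d + 1)) := Real.sq_sqrt (by positivity)
  have ha0 : 0 < stochRate d h T := Real.sqrt_pos.2 (by positivity)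
  have hle : Real.log T ≤ (T : ℝ) ^ theta d s β * h ^ (d + 1) := by
    rwa [div_le_one (by positivity)] at hw
  have hle' : Real.log T ≤ T * h ^ (d + 1) :=
    hle.trans (mul_le_mul_of_nonneg_right hTθ hH0.le)
  have hhalf : (T : ℝ) ^ (-(1 / 2) : ℝ) ≤ stochRate d h T := by
    rw [stochRate, Real.sqrt_eq_rpow, Real.rpow_neg hT0.le, ← Real.inv_rpow hT0.le]
    refine Real.rpow_le_rpow (by positivity) ?_ (by norm_num)
    rw [inv_eq_one_div, div_le_div_iff₀ hT0 (by positivity)]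
    nlinarith
  refine ⟨ha0, ?_, ?_, ?_, hhalf, ?_, ?_⟩
  · refine Real.sqrt_le_iff.2 ⟨zero_le_one, ?_⟩
    rwa [one_pow, div_le_one (by positivity)]
  · rw [hsq, div_mul_cancel₀ _ (by positivity)]
  · nlinarith
  · have h1 : 1 / (T : ℝ) ≤ stochRate d h T := by
      refine le_trans ?_ hhalf
      rw [one_div, ← Real.rpow_neg_one]
      exact Real.rpow_le_rpow_of_exponent_le hT1 (by norm_num)
    have h2 : 1 / (T : ℝ) ≤ h ^ (d + 1) := by
      rw [div_le_iff₀ hT0]; nlinarith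
    rw [div_pow, one_pow, mul_pow, div_le_iff₀ (by positivity)]
    calc (1 : ℝ) = (T : ℝ) ^ (d + 2) * ((1 / T) ^ (d + 1) * (1 / T)) := by
          rw [← pow_succ, div_pow, one_pow]; field_simp
      _ ≤ _ := by
          refine mul_le_mul_of_nonneg_left (mul_le_mul (pow_le_pow_left₀ (by positivity) h1 _) h2
            (by positivity) (by positivity)) (by positivity)
  · rw [mul_pow, hsq, ← Real.rpow_natCast, ← Real.rpow_mul hT0.le, ← mul_div_assoc,
      div_le_div_iff₀ (by positivity) (by positivity)]
    have h1 : (T : ℝ) ^ (1 / s * ((2 : ℕ) : ℝ)) * (T : ℝ) ^ theta d s β ≤ T := by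
      rw [← Real.rpow_add hT0]
      calc _ ≤ (T : ℝ) ^ (1 : ℝ) := by
            refine Real.rpow_le_rpow_of_exponent_le hT1 ?_
            have := theta_le hs hβ
            push_cast
            rw [show 1 / s * 2 = 2 / s by ring]
            linarith
        _ = T := Real.rpow_one _
    calc _ = Real.log T * h ^ (d + 1) *
          ((T : ℝ) ^ (1 / s * ((2 : ℕ) : ℝ)) * (T : ℝ) ^ theta d s β) := by ring
      _ ≤ Real.log T * h ^ (d + 1) * T := mul_le_mul_of_nonneg_left h1 (by positivity)
      _ = _ := by ring

/-- Eventually log log T ≥ 1, so this factor may be dropped. -/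
theorem tendsto_of_band {d : ℕ} {s β : ℝ} {h : ℕ → ℝ} (hpos : ∀ T : ℕ, 1 ≤ T → 0 < h T)
    (hband : Tendsto (fun T : ℕ => Real.log (Real.log T) * Real.log T /
      ((T : ℝ) ^ theta d s β * h T ^ (d + 1))) atTop (𝓝 0)) :
    Tendsto (fun T : ℕ => Real.log T / ((T : ℝ) ^ theta d s β * h T ^ (d + 1))) atTop (𝓝 0) := by
  have hlog : Tendsto (fun T : ℕ => Real.log (T : ℝ)) atTop atTop :=
    Real.tendsto_log_atTop.comp tendsto_natCast_atTop_atTop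
  have hloglog : Tendsto (fun T : ℕ => Real.log (Real.log (T : ℝ))) atTop atTop :=
    Real.tendsto_log_atTop.comp hlog
  refine squeeze_zero' ?_ ?_ hband
  · filter_upwards [eventually_ge_atTop 1, hlog.eventually_ge_atTop 0] with T hT hl
    have := hpos T hT
    positivity
  · filter_upwards [eventually_ge_atTop 1, hlog.eventually_ge_atTop 0,
      hloglog.eventually_ge_atTop 1] with T hT hl hll
    have := hpos T hT
    refine div_le_div_of_nonneg_right ?_ (by positivity)
    nlinarith

/-- The union bound over the grid. Each point contributes exp(-(d + 3) log T), against at most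
T^{d+2} grid points up to a constant, and the mixing error, handled by `cover_mul_mixing_eq`. The
block length is the largest integer compatible with the constraint of the exponential inequality at
`l = stochRate d h T`. -/
theorem block_probability_le {d T L : ℕ} {s β h A B ρ r : ℝ} (hs : 2 < s)
    (hβ : (2 + s * (1 + ((d : ℝ) + 1))) / (s - 2) < β) (hT : 1 ≤ T) (hh : 0 < h) (hh1 : h ≤ 1)
    (hlog : 1 ≤ Real.log T) (hw : Real.log T / ((T : ℝ) ^ theta d s β * h ^ (d + 1)) ≤ 1)
    (hA : 0 < A) (hB : 1 ≤ B) (hρ : 1 ≤ ρ) (hr : 0 ≤ r)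
    (hsmall : 2 * (B * (ρ * (T : ℝ) ^ (1 / s))) * stochRate d h T ≤ 1)
    (hL : L = ⌊1 / (2 * (B * (ρ * (T : ℝ) ^ (1 / s))) * stochRate d h T)⌋₊) :
    1 ≤ L ∧ stochRate d h T * (L * (2 * (B * (ρ * (T : ℝ) ^ (1 / s))))) ≤ 1 ∧
    ((2 * r + 5) / (stochRate d h T * h)) ^ (d + 1) * (2 * (4 * (Real.exp (-((d + 3) * Real.log T))
      + (T / (2 * L) + 1) * (4 * Real.exp 1 * (A * (L : ℝ) ^ (-β)))))) ≤
    (2 * r + 5) ^ (d + 1) * (8 * (1 / T + 4 * Real.exp 1 * A * (2 * (4 * B * ρ) ^ (β + 1)) *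
      (Real.log T / ((T : ℝ) ^ theta d s β * h ^ (d + 1))) ^ ((β + 2 - d) / 2))) := by
  obtain ⟨ha0, ha1, hasq, hTh, hhalf, hcov, -⟩ := stochRate_facts hs hβ hT hh hh1 hlog hw
  have hid := cover_mul_mixing_eq (a := stochRate d h T) (x := (T : ℝ)) hs hβ hh
    (by exact_mod_cast hT) (by linarith : 0 < Real.log T) rfl
  have hT1 : (1 : ℝ) ≤ T := by exact_mod_cast hT
  have hT0 : (0 : ℝ) < T := by linarith
  set a := stochRate d h T with ha
  set w := Real.log T / ((T : ℝ) ^ theta d s β * h ^ (d + 1)) with hw'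
  set q := (T : ℝ) ^ (1 / s) with hq
  have hq1 : 1 ≤ q := Real.one_le_rpow hT1 (by positivity)
  set D := 2 * (B * (ρ * q)) * a with hD
  have hD0 : 0 < D := by positivity
  have hβ0 : 0 < β := by
    have := lt_beta_of_condition hs hβ
    have hd : (0 : ℝ) ≤ d := Nat.cast_nonneg d
    linarith
  have h1D : 1 ≤ 1 / D := by rw [le_div_iff₀ hD0]; linarith
  have hL1 : 1 ≤ L := by rw [hL]; exact (Nat.one_le_floor_iff _).2 h1D
  have hLr : (1 : ℝ) ≤ L := by exact_mod_cast hL1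
  have hL0 : (0 : ℝ) < L := by linarith
  have hLle : (L : ℝ) ≤ 1 / D := by rw [hL]; exact Nat.floor_le (by positivity)
  -- Since L ≥ 1, rounding down loses at most a factor 2.
  have hLge : 1 / (L : ℝ) ≤ 2 * D := by
    have : 1 / D < L + 1 := by rw [hL]; exact Nat.lt_floor_add_one _
    rw [div_lt_iff₀ hD0] at this
    rw [div_le_iff₀ hL0]
    nlinarith
  refine ⟨hL1, ?_, ?_⟩
  · calc a * (L * (2 * (B * (ρ * q)))) = L * D := by rw [hD]; ring
      _ ≤ 1 / D * D := mul_le_mul_of_nonneg_right hLle hD0.le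
      _ = 1 := by field_simp
  -- Needed to absorb the additional block: T/(2L) + 1 ≤ 2 T/L.
  · have hLT : (L : ℝ) ≤ T := by
      refine hLle.trans ?_
      rw [div_le_iff₀ hD0]
      have h1 : 1 ≤ T * a := by
        have h2 : (T : ℝ) * (T : ℝ) ^ (-(1 / 2) : ℝ) ≤ T * a :=
          mul_le_mul_of_nonneg_left hhalf hT0.le
        refine le_trans ?_ h2
        rw [← Real.rpow_one_add' hT0.le (by norm_num)]
        exact Real.one_le_rpow hT1 (by norm_num)
      have h2 : 1 ≤ B * (ρ * q) := one_le_mul_of_one_le_of_one_le hB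
        (one_le_mul_of_one_le_of_one_le hρ hq1)
      calc (1 : ℝ) ≤ (T * a) * (B * (ρ * q)) := one_le_mul_of_one_le_of_one_le h1 h2
        _ ≤ _ := by
          rw [hD]
          have : 0 ≤ (T * a) * (B * (ρ * q)) := by positivity
          nlinarith
    have hnum : (T : ℝ) / (2 * L) + 1 ≤ 2 * (T / L) := by
      have h1 : 1 ≤ (T : ℝ) / L := by rw [le_div_iff₀ hL0]; linarith
      have h2 : (T : ℝ) / (2 * L) = T / L / 2 := by field_simp
      rw [h2]; linarith
    have hblock : ((T : ℝ) / (2 * L) + 1) * (4 * Real.exp 1 * (A * (L : ℝ) ^ (-β)))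
        ≤ 4 * Real.exp 1 * A * (2 * (4 * B * ρ) ^ (β + 1)) * (T * (q * a) ^ (β + 1)) := by
      calc _ ≤ 2 * (T / L) * (4 * Real.exp 1 * (A * (L : ℝ) ^ (-β))) :=
            mul_le_mul_of_nonneg_right hnum (by positivity)
        _ = 4 * Real.exp 1 * A * 2 * T * (1 / (L : ℝ)) ^ (β + 1) := by
            rw [Real.rpow_add (by positivity), Real.rpow_one, one_div, Real.inv_rpow hL0.le,
              Real.rpow_neg hL0.le]
            ring
        _ ≤ 4 * Real.exp 1 * A * 2 * T * (2 * D) ^ (β + 1) :=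
            mul_le_mul_of_nonneg_left (Real.rpow_le_rpow (by positivity) hLge (by linarith))
              (by positivity)
        _ = _ := by
            rw [hD, show 2 * (2 * (B * (ρ * q)) * a) = (4 * B * ρ) * (q * a) by ring,
              Real.mul_rpow (by positivity) (by positivity)]
            ring
    have hexp : Real.exp (-((d + 3) * Real.log T)) = 1 / (T : ℝ) ^ (d + 3) := by
      rw [Real.exp_neg, one_div]
      congr 1
      rw [← Real.rpow_natCast, Real.rpow_def_of_pos hT0]
      push_cast; ring_nf
    have hN : ((2 * r + 5) / (a * h)) ^ (d + 1) = (2 * r + 5) ^ (d + 1) * (1 / (a * h)) ^ (d + 1) := by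
      rw [← mul_pow]; congr 1; ring
    rw [hN, mul_assoc]
    refine mul_le_mul_of_nonneg_left ?_ (by positivity)
    have hcov0 : 0 ≤ (1 / (a * h)) ^ (d + 1) := by positivity
    have hpart1 : (1 / (a * h)) ^ (d + 1) * Real.exp (-((d + 3) * Real.log T)) ≤ 1 / T := by
      rw [hexp]
      calc _ ≤ (T : ℝ) ^ (d + 2) * (1 / (T : ℝ) ^ (d + 3)) :=
            mul_le_mul_of_nonneg_right hcov (by positivity)
        _ = 1 / T := by rw [pow_succ (T : ℝ) (d + 2)]; field_simp
    have hpart2 : (1 / (a * h)) ^ (d + 1) * (((T : ℝ) / (2 * L) + 1) *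
        (4 * Real.exp 1 * (A * (L : ℝ) ^ (-β)))) ≤
        4 * Real.exp 1 * A * (2 * (4 * B * ρ) ^ (β + 1)) * w ^ ((β + 2 - d) / 2) := by
      calc _ ≤ (1 / (a * h)) ^ (d + 1) *
            (4 * Real.exp 1 * A * (2 * (4 * B * ρ) ^ (β + 1)) * (T * (q * a) ^ (β + 1))) :=
            mul_le_mul_of_nonneg_left hblock hcov0
        _ = 4 * Real.exp 1 * A * (2 * (4 * B * ρ) ^ (β + 1)) *
            ((1 / (a * h)) ^ (d + 1) * (T * (q * a) ^ (β + 1))) := by ring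
        _ = 4 * Real.exp 1 * A * (2 * (4 * B * ρ) ^ (β + 1)) *
            (w ^ ((β + 2 - d) / 2) / Real.log T) := by rw [hid]
        _ ≤ _ := by
            refine mul_le_mul_of_nonneg_left (div_le_self ?_ hlog) (by positivity)
            have : 0 ≤ w := by rw [hw']; positivity
            positivity
    linarith

/-! ### The uniform rate of the stochastic part -/

theorem sum_Icc_le_of_time_support {T : ℕ} {c : ℕ → ℝ} {u ρ K : ℝ} (hT : 1 ≤ T) (hρ : 0 ≤ ρ)
    (hK : 0 ≤ K) (hc : ∀ t ∈ Finset.Icc 1 T, c t ≤ K)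
    (h0 : ∀ t ∈ Finset.Icc 1 T, ρ < |u - (t : ℝ) / T| → c t = 0) :
    ∑ t ∈ Finset.Icc 1 T, c t ≤ (2 * (ρ * T) + 1) * K := by
  classical
  have hT0 : (0 : ℝ) < T := by exact_mod_cast hT
  have h1 : ∑ t ∈ Finset.Icc 1 T, c t
      ≤ ∑ t ∈ Finset.Icc 1 T, if |u * T - (t : ℝ)| ≤ ρ * T then K else 0 := by
    refine Finset.sum_le_sum fun t ht => ?_
    split_ifs with h
    · exact hc t ht
    · refine (h0 t ht ?_).le
      have h2 : u * T - (t : ℝ) = (u - (t : ℝ) / T) * T := by field_simp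
      rw [h2, abs_mul, abs_of_pos hT0, not_le] at h
      exact lt_of_mul_lt_mul_right h hT0.le
  refine h1.trans ?_
  rw [← Finset.sum_filter, Finset.sum_const, nsmul_eq_mul]
  refine mul_le_mul_of_nonneg_right ?_ hK
  refine le_trans ?_ (card_filter_abs_sub_le (T + 1) (u * T) (ρ * T) (by positivity))
  refine Nat.cast_le.2 (Finset.card_le_card (Finset.filter_subset_filter _ fun t ht => ?_))
  have := Finset.mem_Icc.1 ht
  exact Finset.mem_range.2 (by omega)

section

variable {Ω : Type*} {mΩ : MeasurableSpace Ω} {P : Measure Ω} {d : ℕ}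
  {X : ℕ → ℕ → Ω → (Fin d → ℝ)} {W : ℕ → ℕ → Ω → ℝ} {s : ℝ}

theorem measureReal_exists_gt_le [IsProbabilityMeasure P] (hs : 0 < s) {C τ : ℝ} {T : ℕ} (hτ : 0 < τ)
    (hC : ∀ t T : ℕ, 1 ≤ t → t ≤ T →
      Integrable (fun ω => |W t T ω| ^ s) P ∧ ∫ ω, |W t T ω| ^ s ∂P ≤ C) :
    P.real {ω | ∃ t ∈ Finset.Icc 1 T, τ < |W t T ω|} ≤ T * (C / τ ^ s) := by
  have hsub : {ω | ∃ t ∈ Finset.Icc 1 T, τ < |W t T ω|} ⊆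
      ⋃ t ∈ Finset.Icc 1 T, {ω | τ ^ s ≤ |W t T ω| ^ s} := by
    rintro ω ⟨t, ht, hlt⟩
    exact mem_biUnion ht (Real.rpow_le_rpow hτ.le hlt.le hs.le)
  calc _ ≤ P.real (⋃ t ∈ Finset.Icc 1 T, {ω | τ ^ s ≤ |W t T ω| ^ s}) :=
        measureReal_mono hsub (measure_ne_top _ _)
    _ ≤ ∑ t ∈ Finset.Icc 1 T, P.real {ω | τ ^ s ≤ |W t T ω| ^ s} :=
        measureReal_biUnion_finset_le _ _
    _ ≤ ∑ t ∈ Finset.Icc 1 T, C / τ ^ s := by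
        refine Finset.sum_le_sum fun t ht => ?_
        obtain ⟨ht1, htT⟩ := Finset.mem_Icc.1 ht
        refine (measureReal_le_integral_div (hC t T ht1 htT).1
          (ae_of_all _ fun ω => by positivity) (by positivity)).trans ?_
        exact div_le_div_of_nonneg_right (hC t T ht1 htT).2 (by positivity)
    _ = _ := by simp

-- The exponential inequality is used with `l = a`, where a² T h^{d+1} = log T: threshold, variance
-- term and exponent are then all of order log T. The probability of exceeding the truncation level
-- need not vanish; it suffices that it is at most δ/2, so the level is a fixed multiple of T^{1/s}
-- with a factor depending on δ.
set_option maxHeartbeats 1000000 in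
theorem exists_uniform_rate [IsProbabilityMeasure P] (hLB : LocalBounds P X W s)
    {A β : ℝ} (hA : 0 < A) (hs : 2 < s) (hβ₁ : (2 * s - 2) / (s - 2) < β)
    (hmix : ∀ k : ℕ, 1 ≤ k →
      alphaMix P (fun t T ω => (X t T ω, W t T ω)) k ≤ ENNReal.ofReal (A * (k : ℝ) ^ (-β)))
    (hβ : (2 + s * (1 + ((d : ℝ) + 1))) / (s - 2) < β)
    {h : ℕ → ℝ} (hpos : ∀ T : ℕ, 1 ≤ T → 0 < h T) (hzero : Tendsto h atTop (𝓝 0))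
    (hband : Tendsto (fun T : ℕ => Real.log (Real.log T) * Real.log T /
      ((T : ℝ) ^ theta d s β * h T ^ (d + 1))) atTop (𝓝 0))
    {G : ℝ → (Fin d → ℝ) → ℝ} {B R Λ : ℝ} (hB : 1 ≤ B) (hR : 1 ≤ R) (hG : IsLocKernel G B R)
    (hLip : ∀ v v' z z', |G v z - G v' z'| ≤ Λ * max |v - v'| ‖z - z'‖) (hΛ : 0 ≤ Λ)
    {r : ℝ} (hr : 1 ≤ r) {δ : ℝ} (hδ : 0 < δ) :
    ∃ M : ℝ, 0 < M ∧ ∀ᶠ T : ℕ in atTop,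
      P {ω | ∃ u ∈ Icc (0 : ℝ) 1, ∃ x : Fin d → ℝ, ‖x‖ ≤ r ∧
        M * (stochRate d (h T) T * (T * h T ^ (d + 1))) < |deviation P G id X W (h T) u x T ω|}
        ≤ ENNReal.ofReal δ := by
  obtain ⟨Q, hQ, hdev⟩ := exists_deviation_bound hLB hA hs hβ₁ hmix (r + 2) hB
    (by linarith : 1 ≤ R + 1)
  obtain ⟨C₁, hC₁, hloc⟩ := hLB.local_moment (r + 2)
  obtain ⟨C, hC0, hC⟩ := hLB.moment
  -- With τ = ρ T^{1/s} the maximum of |W| exceeds τ with probability at most C / ρ^s ≤ C / ρ ≤ δ/2.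
  set ρ : ℝ := 1 + 2 * C / δ with hρdef
  have hρ1 : 1 ≤ ρ := by
    have : 0 ≤ 2 * C / δ := by positivity
    linarith
  -- In units of log T: d + 3 from the exponent, 1 from the constant in the threshold, 2Q from the
  -- variance.
  set M₁ : ℝ := 2 * (d + 4 + 2 * Q) with hM₁
  set c : ℝ := 3 * (R + 1) * (B ^ 2 * (C₁ * (R + 1) ^ d)) with hc
  have hB0 : 0 < B := by linarith
  have hR0 : 0 < R := by linarith
  have hc0 : 0 ≤ c := by positivity
  have hM₁0 : 0 < M₁ := by positivity
  refine ⟨M₁ + Λ * (M₁ + 2 * c) + c, by positivity, ?_⟩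
  have hw := tendsto_of_band hpos hband
  have hlog : Tendsto (fun T : ℕ => Real.log (T : ℝ)) atTop atTop :=
    Real.tendsto_log_atTop.comp tendsto_natCast_atTop_atTop
  have hβd := lt_beta_of_condition hs hβ
  have hκ : 0 < (β + 2 - d) / 2 := by linarith
  have hlim : Tendsto (fun T : ℕ => (2 * r + 5) ^ (d + 1) * (8 * (1 / (T : ℝ) +
      4 * Real.exp 1 * A * (2 * (4 * B * ρ) ^ (β + 1)) *
      (Real.log T / ((T : ℝ) ^ theta d s β * h T ^ (d + 1))) ^ ((β + 2 - d) / 2))))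
      atTop (𝓝 0) := by
    have h1 : Tendsto (fun T : ℕ => (Real.log T / ((T : ℝ) ^ theta d s β * h T ^ (d + 1)))
        ^ ((β + 2 - d) / 2)) atTop (𝓝 0) := by
      have := hw.rpow_const (p := (β + 2 - d) / 2) (Or.inr hκ.le)
      rwa [Real.zero_rpow hκ.ne'] at this
    have h2 := ((tendsto_one_div_atTop_nhds_zero_nat (𝕜 := ℝ)).add (h1.const_mul
      (4 * Real.exp 1 * A * (2 * (4 * B * ρ) ^ (β + 1))))).const_mul 8 |>.const_mul
      ((2 * r + 5) ^ (d + 1))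
    simpa using h2
  have hδ2 : 0 < δ / 2 := by positivity
  have hε : 0 < min 1 ((1 / (2 * (B * ρ))) ^ 2) := by positivity
  filter_upwards [eventually_ge_atTop 1, hlog.eventually_ge_atTop 1,
    hzero.eventually_le_const (show 0 < 1 / (R + 1) by positivity),
    hw.eventually_le_const hε, hlim.eventually_le_const hδ2] with T hT hlogT hhR hwT hprob
  have hh := hpos T hT
  generalize h T = η at *
  have hRh : (R + 1) * η ≤ 1 := by
    rw [le_div_iff₀ (by positivity)] at hhR; linarith
  have hh1 : η ≤ 1 := by nlinarith
  have hw1 := hwT.trans (min_le_left _ _)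
  obtain ⟨ha0, ha1, hasq, hTh, hhalf, -, hτa⟩ := stochRate_facts hs hβ hT hh hh1 hlogT hw1
  have hT1 : (1 : ℝ) ≤ T := by exact_mod_cast hT
  have hT0 : (0 : ℝ) < T := by linarith
  have hsmall : 2 * (B * (ρ * (T : ℝ) ^ (1 / s))) * stochRate d η T ≤ 1 := by
    have h1 : ((T : ℝ) ^ (1 / s) * stochRate d η T) ≤ 1 / (2 * (B * ρ)) := by
      refine (pow_le_pow_iff_left₀ (by positivity) (by positivity) two_ne_zero).1 ?_
      exact hτa.trans (hwT.trans (min_le_right _ _))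
    rw [le_div_iff₀ (by positivity)] at h1
    linarith
  obtain ⟨L, hL⟩ : ∃ L : ℕ, L = ⌊1 / (2 * (B * (ρ * (T : ℝ) ^ (1 / s))) * stochRate d η T)⌋₊ :=
    ⟨_, rfl⟩
  obtain ⟨hL1, hLl, hprob'⟩ := block_probability_le hs hβ hT hh hh1 hlogT hw1 hA hB hρ1
    (by linarith : 0 ≤ r) hsmall hL
  replace hprob := hprob'.trans hprob
  clear hprob' hL hsmall hτa
  set a := stochRate d η T with ha
  set τ := ρ * (T : ℝ) ^ (1 / s) with hτdef
  have hτ0 : 0 < τ := by positivity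
  have hH0 : 0 < η ^ d := by positivity
  have hTH : (T : ℝ) * η * η ^ d = T * η ^ (d + 1) := by rw [pow_succ]; ring
  have hTh' : T * η + 1 ≤ 2 * (T * η) := by linarith
  have hlocη : ∀ t, 1 ≤ t → t ≤ T → ∀ x : Fin d → ℝ, ‖x‖ ≤ r + 2 →
      ∫ ω in {ω | ‖X t T ω - x‖ ≤ (R + 1) * η}, (1 + |W t T ω| ^ s) ∂P
        ≤ C₁ * (R + 1) ^ d * η ^ d := by
    intro t ht htT x hx
    refine (hloc t T ht htT x hx ((R + 1) * η) (by positivity) hRh).trans_eq ?_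
    rw [mul_pow]; ring
  have hG' : IsLocKernel G B (R + 1) := hG.mono le_rfl (by linarith)
  have hbox : IsLocKernel (boxKernel (R + 1) : ℝ → (Fin d → ℝ) → ℝ) B (R + 1) :=
    isLocKernel_boxKernel hB
  have hcount : ∀ K : ℝ, 0 ≤ K → (2 * ((R + 1) * η * T) + 1) * (K * (C₁ * (R + 1) ^ d * η ^ d))
      ≤ 3 * (R + 1) * (K * (C₁ * (R + 1) ^ d)) * (T * η ^ (d + 1)) := by
    intro K hK
    calc _ ≤ (3 * (R + 1) * (T * η)) * (K * (C₁ * (R + 1) ^ d * η ^ d)) := by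
          refine mul_le_mul_of_nonneg_right ?_ (by positivity)
          nlinarith
      _ = 3 * (R + 1) * (K * (C₁ * (R + 1) ^ d)) * (T * η * η ^ d) := by ring
      _ = _ := by rw [hTH]
  have hkey := measure_sup_deviation_le (P := P) (T := T) (τ := τ) (r := r)
    (M := M₁ * (a * (T * η ^ (d + 1)))) (E₂ := c * (T * η ^ (d + 1)))
    (tl := c * (a * (T * η ^ (d + 1)))) (π₀ := δ / 2)
    (π₁ := 4 * (Real.exp (-((d + 3) * Real.log T))
      + (T / (2 * L) + 1) * (4 * Real.exp 1 * (A * (L : ℝ) ^ (-β)))))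
    hLB (by linarith) hB hG hLip hΛ hh hh1 ha0 ha1 hr ?_ ?_ ?_ ?_
  · refine (measure_mono ?_).trans (hkey.trans (ENNReal.ofReal_le_ofReal (by linarith)))
    rintro ω ⟨u, hu, x, hx, hlt⟩
    refine ⟨u, hu, x, hx, lt_of_le_of_lt ?_ hlt⟩
    have h1 : Λ * a * (M₁ * (a * (T * η ^ (d + 1)))) ≤ Λ * M₁ * (a * (T * η ^ (d + 1))) := by
      have : 0 ≤ Λ * M₁ * (a * (T * η ^ (d + 1))) := by positivity
      calc _ = a * (Λ * M₁ * (a * (T * η ^ (d + 1)))) := by ring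
        _ ≤ 1 * (Λ * M₁ * (a * (T * η ^ (d + 1)))) := mul_le_mul_of_nonneg_right ha1 this
        _ = _ := one_mul _
    linarith
  · have hdev' : ∀ (u : ℝ) (x : Fin d → ℝ) (G' : ℝ → (Fin d → ℝ) → ℝ) (g : ℝ → ℝ),
        IsLocKernel G' B (R + 1) → ‖x‖ ≤ r + 2 → Measurable g → (∀ w, |g w| ≤ τ) →
        (∀ w, |g w| ≤ |w|) →
        P.real {ω | M₁ * (a * (T * η ^ (d + 1))) ≤ |deviation P G' g X W η u x T ω|}
          ≤ 4 * (Real.exp (-((d + 3) * Real.log T))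
            + (T / (2 * L) + 1) * (4 * Real.exp 1 * (A * (L : ℝ) ^ (-β)))) := by
      intro u x G' g hG' hx hg hgb hgw
      refine (measureReal_mono ?_).trans (hdev T η u x G' g τ a ((d + 3) * Real.log T) L hG' hh hRh
        hx hg hgb hgw hT hL1 ha0.le hLl)
      intro ω hω
      have hω' : M₁ * (a * (T * η ^ (d + 1))) ≤ |deviation P G' g X W η u x T ω| := hω
      refine le_trans ?_ (mul_le_mul_of_nonneg_left hω' ha0.le)
      have h1 : a ^ 2 * (Q * η ^ d * (T * η + 1)) ≤ 2 * Q * Real.log T := by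
        calc _ ≤ a ^ 2 * (Q * η ^ d * (2 * (T * η))) := by
              refine mul_le_mul_of_nonneg_left (mul_le_mul_of_nonneg_left hTh' (by positivity))
                (by positivity)
          _ = 2 * Q * (a ^ 2 * (T * η * η ^ d)) := by ring
          _ = _ := by rw [hTH, hasq]
      have h2 : a * (M₁ * (a * (T * η ^ (d + 1)))) = M₁ * Real.log T := by rw [← hasq]; ring
      rw [h2, hM₁]
      linarith
    exact fun u x hx => ⟨hdev' u x G _ hG' hx (measurable_trunc τ) (abs_trunc_le_level hτ0.le)
      (abs_trunc_le τ), hdev' u x _ _ hbox hx (measurable_norm.comp (measurable_trunc τ))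
      (fun w => by simpa using abs_trunc_le_level hτ0.le w)
      (fun w => by simpa using abs_trunc_le τ w)⟩
  · intro u x hx
    refine (sum_Icc_le_of_time_support (u := u) (ρ := (R + 1) * η)
      (K := B ^ 2 * (C₁ * (R + 1) ^ d * η ^ d)) hT (by positivity) (by positivity) ?_ ?_).trans
      (hcount _ (by positivity))
    · intro t ht
      obtain ⟨ht1, htT⟩ := Finset.mem_Icc.1 ht
      exact (le_abs_self _).trans (abs_integral_le_integral_abs.trans
        (hLB.integral_locTerm_le hs hbox hB (fun w => by simpa using abs_trunc_le τ w) hh ht1 htT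
          (hlocη t ht1 htT x hx)).1)
    · intro t _ hlt
      have : ∀ ω, locTerm (boxKernel (R + 1)) (fun w => |trunc τ w|) X W η u x T t ω = 0 :=
        fun ω => by rw [locTerm, hbox.locWeight_eq_zero_of_time hh hlt, zero_mul]
      simp [this]
  · intro u x hx
    -- As s > 2, τ^{1-s} ≤ T^{1/s - 1} ≤ T^{-1/2} ≤ a, so truncation shifts the means by no more
    -- than the target rate.
    have hτs : τ ^ (1 - s) ≤ a := by
      refine le_trans ?_ hhalf
      calc τ ^ (1 - s) ≤ ((T : ℝ) ^ (1 / s)) ^ (1 - s) :=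
            Real.rpow_le_rpow_of_nonpos (by positivity)
              (le_mul_of_one_le_left (by positivity) hρ1) (by linarith)
        _ = (T : ℝ) ^ (1 / s * (1 - s)) := (Real.rpow_mul hT0.le _ _).symm
        _ ≤ _ := by
            refine Real.rpow_le_rpow_of_exponent_le hT1 ?_
            have : 1 / s < 1 / 2 := one_div_lt_one_div_of_lt (by norm_num) hs
            have h2 : 1 / s * (1 - s) = 1 / s - 1 := by field_simp
            rw [h2]; linarith
    have hid : ∀ t, 1 ≤ t → t ≤ T → Integrable (locTerm G id X W η u x T t) P := fun t ht htT =>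
      hLB.integrable_locTerm hG measurable_id (fun w => le_rfl) hB0.le (by linarith) ht htT
    have htr : ∀ t, 1 ≤ t → t ≤ T → Integrable (locTerm G (trunc τ) X W η u x T t) P :=
      fun t ht htT => hLB.integrable_locTerm hG (measurable_trunc τ) (abs_trunc_le τ) hB0.le
        (by linarith) ht htT
    refine (sum_Icc_le_of_time_support (u := u) (ρ := (R + 1) * η)
      (K := (B ^ 2 * a) * (C₁ * (R + 1) ^ d * η ^ d)) hT (by positivity) (by positivity) ?_ ?_).trans
      ((hcount _ (by positivity)).trans_eq (by rw [hc]; ring))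
    · intro t ht
      obtain ⟨ht1, htT⟩ := Finset.mem_Icc.1 ht
      rw [← integral_sub (hid t ht1 htT) (htr t ht1 htT)]
      refine abs_integral_le_integral_abs.trans (hLB.integral_local_le ht1 htT
        (hlocη t ht1 htT x (by linarith)) (by positivity) (fun ω => abs_nonneg _)
        (fun ω => ?_) fun ω hω => ?_)
      · simp only [locTerm, id, ← mul_sub, abs_mul]
        calc _ ≤ B * (τ ^ (1 - s) * (1 + |W t T ω| ^ s)) :=
              mul_le_mul (hG.bound _ _) (abs_sub_trunc_le hτ0 (by linarith) _) (abs_nonneg _)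
                hB0.le
          _ ≤ B * (a * (1 + |W t T ω| ^ s)) := by gcongr
          _ ≤ B ^ 2 * (a * (1 + |W t T ω| ^ s)) :=
              mul_le_mul_of_nonneg_right (by nlinarith) (by positivity)
          _ = _ := by ring
      · simp [locTerm, hG'.locWeight_eq_zero_of_space hh hω]
    · intro t _ hlt
      have h1 : ∀ g ω, locTerm G g X W η u x T t ω = 0 :=
        fun g ω => by rw [locTerm, hG'.locWeight_eq_zero_of_time hh hlt, zero_mul]
      simp [h1]
  · refine (measureReal_exists_gt_le (by linarith) hτ0 hC).trans ?_
    have h1 : τ ^ s = ρ ^ s * T := by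
      rw [hτdef, Real.mul_rpow (by linarith) (by positivity), ← Real.rpow_mul hT0.le]
      rw [one_div_mul_cancel (by linarith), Real.rpow_one]
    have h2 : ρ ≤ ρ ^ s := by
      calc ρ = ρ ^ (1 : ℝ) := (Real.rpow_one _).symm
        _ ≤ ρ ^ s := Real.rpow_le_rpow_of_exponent_le hρ1 (by linarith)
    have h3 : (T : ℝ) * (C / τ ^ s) = C / ρ ^ s := by
      rw [h1]; field_simp
    rw [h3, div_le_iff₀ (by positivity)]
    have h4 : C ≤ δ / 2 * ρ := by
      rw [hρdef]
      have : δ / 2 * (1 + 2 * C / δ) = δ / 2 + C := by field_simp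
      rw [this]; linarith
    exact h4.trans (mul_le_mul_of_nonneg_left h2 hδ2.le)

end

/-! ### The product kernel -/

/-- The kernel `z ↦ ∏ⱼ K(zʲ)` on `ℝ^d`. -/
def spaceKernel {d : ℕ} (K : ℝ → ℝ) (z : Fin d → ℝ) : ℝ := ∏ j, K (z j)

/-- The kernel `(v, z) ↦ K(v) ∏ⱼ K(zʲ)` on `ℝ × ℝ^d`. -/
def prodKernel {d : ℕ} (K : ℝ → ℝ) (v : ℝ) (z : Fin d → ℝ) : ℝ := K v * spaceKernel K z

theorem weight_eq_locWeight {Ω : Type*} {d : ℕ} (K : ℝ → ℝ) (X : ℕ → ℕ → Ω → (Fin d → ℝ))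
    (h u : ℝ) (x : Fin d → ℝ) (t T : ℕ) (ω : Ω) :
    weight K X h u x t T ω = locWeight (prodKernel K) X h u x t T ω := rfl

theorem abs_prod_sub_prod_le {ι : Type*} (S : Finset ι) {f g : ι → ℝ} {b : ℝ} (hb : 1 ≤ b)
    (hf : ∀ i, |f i| ≤ b) (hg : ∀ i, |g i| ≤ b) :
    |∏ i ∈ S, f i - ∏ i ∈ S, g i| ≤ b ^ S.card * ∑ i ∈ S, |f i - g i| := by
  classical
  induction S using Finset.induction_on with
  | empty => simp
  | insert i S hi ih =>
    rw [Finset.prod_insert hi, Finset.prod_insert hi, Finset.sum_insert hi,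
      Finset.card_insert_of_notMem hi]
    have h1 : |∏ i ∈ S, f i| ≤ b ^ S.card := by
      rw [Finset.abs_prod, ← Finset.prod_const]
      exact Finset.prod_le_prod (fun _ _ => abs_nonneg _) fun i _ => hf i
    have hbS : b ^ S.card ≤ b ^ (S.card + 1) := pow_le_pow_right₀ hb (Nat.le_succ _)
    have hsum : 0 ≤ ∑ i ∈ S, |f i - g i| := Finset.sum_nonneg fun _ _ => abs_nonneg _
    calc _ = |(f i - g i) * ∏ i ∈ S, f i + g i * (∏ i ∈ S, f i - ∏ i ∈ S, g i)| := by
          congr 1; ring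
      _ ≤ |f i - g i| * |∏ i ∈ S, f i| + |g i| * |∏ i ∈ S, f i - ∏ i ∈ S, g i| := by
          rw [← abs_mul, ← abs_mul]; exact abs_add_le _ _
      _ ≤ |f i - g i| * b ^ (S.card + 1) + b * (b ^ S.card * ∑ i ∈ S, |f i - g i|) :=
          add_le_add (mul_le_mul_of_nonneg_left (h1.trans hbS) (abs_nonneg _))
            (mul_le_mul (hg i) ih (abs_nonneg _) (by linarith))
      _ = _ := by rw [pow_succ]; ring

/-- A kernel in the sense of `IsKernel`, with a common constant `b ≥ 1` bounding the kernel, its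
Lipschitz constant and its support radius. -/
structure IsBoundedKernel (K : ℝ → ℝ) (C₁ b : ℝ) : Prop where
  one_le : 1 ≤ b
  integral : ∫ v, K v = 1
  symm : ∀ v, K (-v) = K v
  bound : ∀ v, |K v| ≤ b
  supp : ∀ v, C₁ < |v| → K v = 0
  radius : C₁ ≤ b
  lip : ∀ v w, |K v - K w| ≤ b * |v - w|

theorem IsKernel.exists_isBoundedKernel {K : ℝ → ℝ} {C₁ : ℝ} (hK : IsKernel K C₁) :
    ∃ b, IsBoundedKernel K C₁ b := by
  obtain ⟨h1, h2, ⟨B, hB⟩, h4, L, hL⟩ := hK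
  refine ⟨max (max 1 B) (max C₁ L), le_max_of_le_left (le_max_left _ _), h1, h2,
    fun v => (hB v).trans (le_max_of_le_left (le_max_right _ _)), h4,
    le_max_of_le_right (le_max_left _ _), fun v w => ?_⟩
  have := hL.dist_le_mul v w
  rw [Real.dist_eq, Real.dist_eq] at this
  exact this.trans (mul_le_mul_of_nonneg_right (le_max_of_le_right (le_max_right _ _))
    (abs_nonneg _))

namespace IsBoundedKernel

variable {K : ℝ → ℝ} {C₁ b : ℝ} {d : ℕ}

theorem continuous (hK : IsBoundedKernel K C₁ b) : Continuous K := by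
  have : LipschitzWith (Real.toNNReal b) K := LipschitzWith.of_dist_le_mul fun v w => by
    rw [Real.dist_eq, Real.dist_eq, Real.coe_toNNReal _ (by linarith [hK.one_le])]
    exact hK.lip v w
  exact this.continuous

/-- A kernel supported in {0} would have integral zero. -/
theorem radius_pos (hK : IsBoundedKernel K C₁ b) : 0 < C₁ := by
  by_contra hcon
  have h0 : K =ᵐ[volume] fun _ => 0 := by
    have : ∀ᵐ v : ℝ, v ≠ 0 := by simp [ae_iff]
    filter_upwards [this] with v hv
    exact hK.supp v ((not_lt.1 hcon).trans_lt (abs_pos.2 hv))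
  have := hK.integral
  rw [integral_congr_ae h0] at this
  simp at this

/-- Continuity extends the vanishing to the boundary |v| = C₁. The Riemann sum lemma requires this
closed form. -/
theorem eq_zero_of_le (hK : IsBoundedKernel K C₁ b) {v : ℝ} (hv : C₁ ≤ |v|) : K v = 0 := by
  rcases hv.lt_or_eq with h | h
  · exact hK.supp v h
  · have hcl : IsClosed {w : ℝ | K w = 0} := isClosed_eq hK.continuous continuous_const
    have hv0 : v ≠ 0 := by
      rw [← abs_pos, ← h]; exact hK.radius_pos
    have ht : Tendsto (fun n : ℕ => v * (1 + 1 / ((n : ℝ) + 1))) atTop (𝓝 v) := by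
      have := ((tendsto_one_div_add_atTop_nhds_zero_nat (𝕜 := ℝ)).const_add 1).const_mul v
      simpa using this
    refine hcl.mem_of_tendsto ht (Eventually.of_forall fun n => hK.supp _ ?_)
    rw [abs_mul, h]
    have h1 : 0 < 1 / ((n : ℝ) + 1) := by positivity
    rw [abs_of_pos (by linarith : 0 < 1 + 1 / ((n : ℝ) + 1))]
    have := abs_pos.2 hv0
    nlinarith

theorem continuous_spaceKernel (hK : IsBoundedKernel K C₁ b) :
    Continuous (spaceKernel K : (Fin d → ℝ) → ℝ) :=
  continuous_finsetProd _ fun j _ => hK.continuous.comp (continuous_apply j)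

theorem abs_spaceKernel_le (hK : IsBoundedKernel K C₁ b) (z : Fin d → ℝ) :
    |spaceKernel K z| ≤ b ^ d := by
  rw [spaceKernel, Finset.abs_prod]
  calc _ ≤ ∏ _j : Fin d, b := Finset.prod_le_prod (fun _ _ => abs_nonneg _) fun j _ => hK.bound _
    _ = b ^ d := by simp

theorem spaceKernel_eq_zero (hK : IsBoundedKernel K C₁ b) {z : Fin d → ℝ} (hz : C₁ < ‖z‖) :
    spaceKernel K z = 0 := by
  have : ∃ j, C₁ < |z j| := by
    by_contra hcon
    push Not at hcon
    exact absurd ((pi_norm_le_iff_of_nonneg hK.radius_pos.le).2 hcon) (not_le.2 hz)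
  obtain ⟨j, hj⟩ := this
  exact Finset.prod_eq_zero (Finset.mem_univ j) (hK.supp _ hj)

theorem spaceKernel_neg (hK : IsBoundedKernel K C₁ b) (z : Fin d → ℝ) :
    spaceKernel K (-z) = spaceKernel K z :=
  Finset.prod_congr rfl fun j _ => hK.symm (z j)

theorem abs_spaceKernel_sub_le (hK : IsBoundedKernel K C₁ b) (z z' : Fin d → ℝ) :
    |spaceKernel K z - spaceKernel K z'| ≤ d * b ^ (d + 1) * ‖z - z'‖ := by
  have hb := hK.one_le
  have h1 := abs_prod_sub_prod_le Finset.univ hb (fun j => hK.bound (z j))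
    (fun j => hK.bound (z' j))
  rw [Finset.card_univ, Fintype.card_fin] at h1
  refine h1.trans ?_
  calc _ ≤ b ^ d * ∑ j : Fin d, b * ‖z - z'‖ := by
        refine mul_le_mul_of_nonneg_left (Finset.sum_le_sum fun j _ => (hK.lip _ _).trans
          (mul_le_mul_of_nonneg_left (norm_le_pi_norm (z - z') j) (by linarith))) (by positivity)
    _ = _ := by rw [Finset.sum_const, Finset.card_univ, Fintype.card_fin, nsmul_eq_mul]; ring

theorem isLocKernel (hK : IsBoundedKernel K C₁ b) :
    IsLocKernel (prodKernel K : ℝ → (Fin d → ℝ) → ℝ) (b ^ (d + 1)) b := by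
  have hb := hK.one_le
  refine ⟨fun v => (hK.continuous_spaceKernel.measurable.const_mul (K v)), fun v z => ?_,
    fun v z hv => ?_, fun v z hz => ?_⟩
  · rw [prodKernel, abs_mul, pow_succ, mul_comm]
    exact mul_le_mul (hK.abs_spaceKernel_le z) (hK.bound v) (abs_nonneg _) (by positivity)
  · rw [prodKernel, hK.supp v (hK.radius.trans_lt hv), zero_mul]
  · rw [prodKernel, hK.spaceKernel_eq_zero (hK.radius.trans_lt hz), mul_zero]

theorem abs_prodKernel_sub_le (hK : IsBoundedKernel K C₁ b) (v v' : ℝ) (z z' : Fin d → ℝ) :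
    |prodKernel K v z - prodKernel K v' z'| ≤ (d + 1) * b ^ (d + 2) * max |v - v'| ‖z - z'‖ := by
  have hb := hK.one_le
  have hb0 : 0 ≤ b := by linarith
  unfold prodKernel
  calc _ = |(K v - K v') * spaceKernel K z + K v' * (spaceKernel K z - spaceKernel K z')| := by
        congr 1; ring
    _ ≤ |K v - K v'| * |spaceKernel K z| + |K v'| * |spaceKernel K z - spaceKernel K z'| := by
        rw [← abs_mul, ← abs_mul]; exact abs_add_le _ _
    _ ≤ (b * max |v - v'| ‖z - z'‖) * b ^ d + b * (d * b ^ (d + 1) * max |v - v'| ‖z - z'‖) := by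
        refine add_le_add (mul_le_mul ((hK.lip _ _).trans ?_) (hK.abs_spaceKernel_le z)
          (abs_nonneg _) (by positivity)) (mul_le_mul (hK.bound _)
          ((hK.abs_spaceKernel_sub_le z z').trans ?_) (abs_nonneg _) hb0)
        · exact mul_le_mul_of_nonneg_left (le_max_left _ _) hb0
        · exact mul_le_mul_of_nonneg_left (le_max_right _ _) (by positivity)
    _ = (b ^ (d + 1) + d * b ^ (d + 2)) * max |v - v'| ‖z - z'‖ := by ring
    _ ≤ _ := by
        refine mul_le_mul_of_nonneg_right ?_ (le_max_of_le_left (abs_nonneg _))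
        have : b ^ (d + 1) ≤ b ^ (d + 2) := pow_le_pow_right₀ hb (Nat.le_succ _)
        linarith

theorem integral_spaceKernel_scaled (hK : IsBoundedKernel K C₁ b) {h : ℝ} (hh : 0 < h)
    (x : Fin d → ℝ) : ∫ y : Fin d → ℝ, spaceKernel K (fun j => (x j - y j) / h) = h ^ d := by
  have e : ∀ y : Fin d → ℝ, spaceKernel K (fun j => (x j - y j) / h)
      = (fun w : Fin d → ℝ => spaceKernel K (h⁻¹ • w)) (x - y) := fun y => by
    simp only [spaceKernel, Pi.smul_apply, Pi.sub_apply, smul_eq_mul, div_eq_inv_mul]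
  simp_rw [e]
  rw [integral_sub_left_eq_self (fun w : Fin d → ℝ => spaceKernel K (h⁻¹ • w)) volume x,
    Measure.integral_comp_smul]
  have h1 : ∫ z : Fin d → ℝ, spaceKernel K z = 1 := by
    have := integral_fintype_prod_eq_pow (ι := Fin d) (μ := (volume : Measure ℝ)) K
    simp only [hK.integral, one_pow] at this
    exact this
  rw [h1, smul_eq_mul, mul_one, Module.finrank_fin_fun, inv_pow, inv_inv, abs_of_pos (by positivity)]

/-- The integrand is odd about `x`. Reflection preserves the integral of any function, so
integrability plays no role. -/
theorem integral_spaceKernel_mul_linear (hK : IsBoundedKernel K C₁ b) (h : ℝ)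
    (x : Fin d → ℝ) (ℓ : (Fin d → ℝ) →ₗ[ℝ] ℝ) :
    ∫ y : Fin d → ℝ, spaceKernel K (fun j => (x j - y j) / h) * ℓ (y - x) = 0 := by
  set φ : (Fin d → ℝ) → ℝ := fun w => spaceKernel K (fun j => w j / h) * ℓ (-w) with hφ
  have e : ∀ y : Fin d → ℝ, spaceKernel K (fun j => (x j - y j) / h) * ℓ (y - x) = φ (x - y) :=
    fun y => by simp [hφ]; ring
  simp_rw [e]
  rw [integral_sub_left_eq_self φ volume x]
  have h1 : ∫ w, φ (-w) = ∫ w, φ w := integral_neg_eq_self φ volume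
  have h2 : ∀ w, φ (-w) = -φ w := fun w => by
    have : spaceKernel K (fun j => (-w) j / h) = spaceKernel K (fun j => w j / h) := by
      rw [← hK.spaceKernel_neg]
      congr 1; ext j; simp [neg_div]
    simp only [hφ, this, neg_neg, map_neg]
    ring
  simp_rw [h2, integral_neg] at h1
  linarith

end IsBoundedKernel

/-! ### Local expansions of smooth functions -/

theorem exists_bound_of_continuousOn {d : ℕ} {D : ℝ → (Fin d → ℝ) → ℝ} (r : ℝ)
    (hD : ContinuousOn (fun p : ℝ × (Fin d → ℝ) => D p.1 p.2) (Icc 0 1 ×ˢ univ)) :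
    ∃ C, 0 ≤ C ∧ ∀ u ∈ Icc (0 : ℝ) 1, ∀ x : Fin d → ℝ, ‖x‖ ≤ r → |D u x| ≤ C := by
  obtain ⟨C, hC⟩ := ((isCompact_Icc (a := (0 : ℝ)) (b := 1)).prod
    (isCompact_closedBall (0 : Fin d → ℝ) r)).exists_bound_of_continuousOn
    (hD.mono (prod_mono_right (subset_univ _)))
  refine ⟨|C|, abs_nonneg _, fun u hu x hx => (hC (u, x) ⟨hu, ?_⟩).trans (le_abs_self _)⟩
  exact mem_closedBall_zero_iff.2 hx

/-- The mean value inequality is applied in time and then in one coordinate after another, so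
partial derivatives suffice. The balls of the maximum norm are products of intervals, hence contain
the mixed points. -/
theorem exists_lipschitz_of_smooth {d : ℕ} {f : ℝ → (Fin d → ℝ) → ℝ} (ht : SmoothInTime f)
    (hx : SmoothInSpace f) (r : ℝ) :
    ∃ C, 0 ≤ C ∧ ∀ u ∈ Icc (0 : ℝ) 1, ∀ v ∈ Icc (0 : ℝ) 1, ∀ x y : Fin d → ℝ, ‖x‖ ≤ r → ‖y‖ ≤ r →
      |f v y - f u x| ≤ C * (|v - u| + ‖y - x‖) := by
  obtain ⟨D, hDc, hD⟩ := ht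
  obtain ⟨C₀, hC₀, hb₀⟩ := exists_bound_of_continuousOn r hDc
  choose D' hD'c hD' using hx
  choose C' hC' hb' using fun j => exists_bound_of_continuousOn r (hD'c j)
  refine ⟨max C₀ (∑ j, C' j), le_max_of_le_left hC₀, fun u hu v hv x y hxr hyr => ?_⟩
  have h1 : |f v y - f u y| ≤ C₀ * |v - u| := by
    have := (convex_Icc (0 : ℝ) 1).norm_image_sub_le_of_norm_hasDerivWithin_le
      (f := fun w => f w y) (f' := fun w => D w y) (C := C₀) (fun w hw => hD w hw y)
      (fun w hw => hb₀ w hw y hyr) hu hv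
    simpa using this
  have h2 : ∀ S : Finset (Fin d), |f u (S.piecewise y x) - f u x| ≤ ∑ j ∈ S, C' j * ‖y - x‖ := by
    intro S
    induction S using Finset.induction_on with
    | empty => simp
    | insert j S hj ih =>
      rw [Finset.sum_insert hj, Finset.piecewise_insert]
      set p := S.piecewise y x with hp
      have hr0 : 0 ≤ r := (norm_nonneg x).trans hxr
      have hpr : ∀ w ∈ Icc (-r) r, ‖Function.update p j w‖ ≤ r := by
        intro w hw
        refine (pi_norm_le_iff_of_nonneg hr0).2 fun i => ?_
        by_cases hij : i = j
        · subst hij; simpa [abs_le] using hw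
        · rw [Function.update_of_ne hij, hp]
          by_cases hi : i ∈ S
          · rw [Finset.piecewise_eq_of_mem _ _ _ hi]; exact (norm_le_pi_norm y i).trans hyr
          · rw [Finset.piecewise_eq_of_notMem _ _ _ hi]; exact (norm_le_pi_norm x i).trans hxr
      have hpj : p j = x j := Finset.piecewise_eq_of_notMem _ _ _ hj
      have h3 := (convex_Icc (-r) r).norm_image_sub_le_of_norm_hasDerivWithin_le
        (f := fun w => f u (Function.update p j w))
        (f' := fun w => D' j u (Function.update p j w)) (C := C' j)
        (fun w _ => by
          have := hD' j u hu (Function.update p j w)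
          simp only [Function.update_idem, Function.update_self] at this
          exact this.hasDerivWithinAt)
        (fun w hw => hb' j u hu _ (hpr w hw))
        (abs_le.1 ((norm_le_pi_norm x j).trans hxr)) (abs_le.1 ((norm_le_pi_norm y j).trans hyr))
      rw [← hpj, Function.update_eq_self] at h3
      have h4 : ‖y j - p j‖ ≤ ‖y - x‖ := by rw [hpj]; exact norm_le_pi_norm (y - x) j
      calc _ ≤ |f u (Function.update p j (y j)) - f u p| + |f u p - f u x| := abs_sub_le _ _ _
        _ ≤ C' j * ‖y - x‖ + ∑ j ∈ S, C' j * ‖y - x‖ :=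
            add_le_add (h3.trans (mul_le_mul_of_nonneg_left h4 (hC' j))) ih
  have h3 := h2 Finset.univ
  rw [Finset.piecewise_univ, ← Finset.sum_mul] at h3
  calc |f v y - f u x| ≤ |f v y - f u y| + |f u y - f u x| := abs_sub_le _ _ _
    _ ≤ C₀ * |v - u| + (∑ j, C' j) * ‖y - x‖ := add_le_add h1 h3
    _ ≤ _ := by
      rw [mul_add]
      exact add_le_add (mul_le_mul_of_nonneg_right (le_max_left _ _) (abs_nonneg _))
        (mul_le_mul_of_nonneg_right (le_max_right _ _) (norm_nonneg _))

/-- Derivatives are taken within [0,1] × ℝ^d, and on the compact convex set [0,1] × ball the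
function and its first two derivatives are bounded. The linear part is split into time and space
since the two are cancelled by different mechanisms. -/
theorem exists_taylor_of_contDiffOn {d : ℕ} {m : ℝ → (Fin d → ℝ) → ℝ}
    (hm : ContDiffOn ℝ 2 (fun p : ℝ × (Fin d → ℝ) => m p.1 p.2) (Icc 0 1 ×ˢ univ)) (r : ℝ) :
    ∃ C, 0 ≤ C ∧
      (∀ u ∈ Icc (0 : ℝ) 1, ∀ x : Fin d → ℝ, ‖x‖ ≤ r → |m u x| ≤ C) ∧
      (∀ u ∈ Icc (0 : ℝ) 1, ∀ v ∈ Icc (0 : ℝ) 1, ∀ x y : Fin d → ℝ, ‖x‖ ≤ r → ‖y‖ ≤ r →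
        |m v y - m u x| ≤ C * max |v - u| ‖y - x‖) ∧
      ∀ u ∈ Icc (0 : ℝ) 1, ∀ x : Fin d → ℝ, ‖x‖ ≤ r → ∃ (ℓ₁ : ℝ) (ℓ₂ : (Fin d → ℝ) →ₗ[ℝ] ℝ),
        |ℓ₁| ≤ C ∧ ∀ v ∈ Icc (0 : ℝ) 1, ∀ y : Fin d → ℝ, ‖y‖ ≤ r →
          |m v y - m u x - (v - u) * ℓ₁ - ℓ₂ (y - x)| ≤ C * max |v - u| ‖y - x‖ ^ 2 := by
  set M : ℝ × (Fin d → ℝ) → ℝ := fun p => m p.1 p.2 with hM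
  set D : Set (ℝ × (Fin d → ℝ)) := Icc 0 1 ×ˢ univ with hD
  set Q : Set (ℝ × (Fin d → ℝ)) := Icc 0 1 ×ˢ Metric.closedBall 0 r with hQ
  have hQD : Q ⊆ D := prod_mono_right (subset_univ _)
  have hQc : IsCompact Q := isCompact_Icc.prod (isCompact_closedBall _ _)
  have hQconv : Convex ℝ Q := (convex_Icc _ _).prod (convex_closedBall _ _)
  have hDu : UniqueDiffOn ℝ D := (uniqueDiffOn_Icc zero_lt_one).prod uniqueDiffOn_univ
  have hA1 : ContDiffOn ℝ 1 (fderivWithin ℝ M D) D := hm.fderivWithin hDu (by norm_num)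
  have hMd : ∀ p ∈ Q, HasFDerivWithinAt M (fderivWithin ℝ M D p) Q p := fun p hp =>
    ((hm.differentiableOn (by norm_num)) p (hQD hp)).hasFDerivWithinAt.mono hQD
  have hAd : ∀ p ∈ Q, HasFDerivWithinAt (fderivWithin ℝ M D)
      (fderivWithin ℝ (fderivWithin ℝ M D) D p) Q p := fun p hp =>
    ((hA1.differentiableOn (by norm_num)) p (hQD hp)).hasFDerivWithinAt.mono hQD
  obtain ⟨c₀, hc₀⟩ := hQc.exists_bound_of_continuousOn (hm.continuousOn.mono hQD)
  obtain ⟨c₁, hc₁⟩ := hQc.exists_bound_of_continuousOn (hA1.continuousOn.mono hQD)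
  obtain ⟨c₂, hc₂⟩ := hQc.exists_bound_of_continuousOn
    ((hA1.continuousOn_fderivWithin hDu (by norm_num)).mono hQD)
  set C := max (|c₀|) (max |c₁| |c₂|) with hC
  have hC0 : |c₀| ≤ C := le_max_left _ _
  have hC1 : |c₁| ≤ C := le_max_of_le_right (le_max_left _ _)
  have hC2 : |c₂| ≤ C := le_max_of_le_right (le_max_right _ _)
  have hmem : ∀ u ∈ Icc (0 : ℝ) 1, ∀ x : Fin d → ℝ, ‖x‖ ≤ r → (u, x) ∈ Q := fun u hu x hx =>
    ⟨hu, mem_closedBall_zero_iff.2 hx⟩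
  have hdist : ∀ (u v : ℝ) (x y : Fin d → ℝ), ‖((v, y) : ℝ × (Fin d → ℝ)) - (u, x)‖
      = max |v - u| ‖y - x‖ := fun u v x y => by
    rw [Prod.mk_sub_mk, Prod.norm_mk, Real.norm_eq_abs]
  refine ⟨C, (abs_nonneg _).trans hC0, fun u hu x hx => ?_, fun u hu v hv x y hx hy => ?_,
    fun u hu x hx => ?_⟩
  · exact (hc₀ _ (hmem u hu x hx)).trans ((le_abs_self _).trans hC0)
  · have := hQconv.norm_image_sub_le_of_norm_hasFDerivWithin_le hMd
      (fun p hp => (hc₁ p hp).trans ((le_abs_self _).trans hC1)) (hmem u hu x hx) (hmem v hv y hy)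
    rwa [hdist] at this
  · set p : ℝ × (Fin d → ℝ) := (u, x) with hp
    set A := fderivWithin ℝ M D with hA
    have hpQ := hmem u hu x hx
    refine ⟨A p (1, 0), (A p).toLinearMap ∘ₗ LinearMap.inr ℝ ℝ (Fin d → ℝ), ?_, fun v hv y hy => ?_⟩
    · have h1 := (A p).le_opNorm (1, 0)
      have h2 : ‖((1, 0) : ℝ × (Fin d → ℝ))‖ = 1 := by simp [Prod.norm_mk]
      rw [h2, mul_one] at h1
      exact h1.trans ((hc₁ p hpQ).trans ((le_abs_self _).trans hC1))
    · set η := max |v - u| ‖y - x‖ with hη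
      have hη0 : 0 ≤ η := le_max_of_le_left (abs_nonneg _)
      have hq : ‖((v, y) : ℝ × (Fin d → ℝ)) - p‖ = η := hdist u v x y
      -- Within distance η of p the derivative differs from `A p` by at most C η, so the mean value
      -- inequality gives the remainder C η².
      have h1 := (hQconv.inter (convex_closedBall p η)).norm_image_sub_le_of_norm_hasFDerivWithin_le'
        (f := M) (f' := A) (φ := A p) (C := C * η) (x := p) (y := (v, y))
        (fun q hq => (hMd q hq.1).mono inter_subset_left)
        (fun q hq => by
          have h2 := hQconv.norm_image_sub_le_of_norm_hasFDerivWithin_le hAd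
            (fun p hp => (hc₂ p hp).trans ((le_abs_self _).trans hC2)) hpQ hq.1
          refine h2.trans (mul_le_mul_of_nonneg_left ?_ ((abs_nonneg _).trans hC0))
          rw [← dist_eq_norm]; exact hq.2)
        ⟨hpQ, Metric.mem_closedBall_self hη0⟩
        ⟨hmem v hv y hy, by rw [Metric.mem_closedBall, dist_eq_norm, hq]⟩
      rw [hq] at h1
      have h3 : A p ((v, y) - p) = (v - u) * A p (1, 0) + A p (0, y - x) := by
        have : ((v, y) : ℝ × (Fin d → ℝ)) - p = (v - u) • (1, 0) + (0, y - x) := by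
          simp [hp]
        rw [this, map_add, map_smul, smul_eq_mul]
      rw [h3] at h1
      calc _ = ‖M (v, y) - M p - ((v - u) * A p (1, 0) + A p (0, y - x))‖ := by
            rw [Real.norm_eq_abs]
            congr 1
            simp [hM, hp]
            ring
        _ ≤ _ := h1.trans_eq (by ring)

/-! ### Riemann sums -/

/-- Each cell of length 1/T contributes at most Λ/T. Only cells meeting the support contribute, and
the conditions on `u` keep the support inside [0,1], so no boundary error arises. -/
theorem abs_sum_sub_integral_le {φ : ℝ → ℝ} {Λ ρ u : ℝ} {T : ℕ} (hT : 1 ≤ T) (hΛ : 0 ≤ Λ)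
    (hρ : 0 ≤ ρ) (hLip : ∀ v w, |φ v - φ w| ≤ Λ * |v - w|) (h0 : ∀ v, ρ ≤ |u - v| → φ v = 0)
    (hu0 : ρ ≤ u) (hu1 : u ≤ 1 - ρ) :
    |∑ t ∈ Finset.Icc 1 T, φ ((t : ℝ) / T) - T * ∫ v, φ v| ≤ (2 * (ρ * T) + 3) * (Λ / T) := by
  have hT0 : (0 : ℝ) < T := by exact_mod_cast hT
  have hcont : Continuous φ := by
    have : LipschitzWith (Real.toNNReal Λ) φ := LipschitzWith.of_dist_le_mul fun v w => by
      rw [Real.dist_eq, Real.dist_eq, Real.coe_toNNReal _ hΛ]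
      exact hLip v w
    exact this.continuous
  have hint : ∀ a b, IntervalIntegrable φ volume a b := fun a b => hcont.intervalIntegrable a b
  have hsplit : ∫ v, φ v = ∑ t ∈ Finset.Icc 1 T, ∫ v in (((t : ℝ) - 1) / T)..((t : ℝ) / T), φ v := by
    have h1 : ∫ v in (0 : ℝ)..1, φ v = ∫ v, φ v := by
      refine intervalIntegral.integral_eq_integral_of_support_subset fun v hv => ?_
      have h2 : |u - v| < ρ := by
        by_contra hcon
        exact hv (h0 v (not_lt.1 hcon))
      have := abs_lt.1 h2
      exact ⟨by linarith, by linarith⟩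
    have h2 := intervalIntegral.sum_integral_adjacent_intervals (f := φ) (μ := volume)
      (a := fun k : ℕ => (k : ℝ) / T) (n := T) fun k _ => hint _ _
    simp only [Nat.cast_zero, zero_div, div_self hT0.ne'] at h2
    rw [← h1, ← h2, ← Finset.Ico_succ_right_eq_Icc, Finset.sum_Ico_eq_sum_range]
    simp only [Nat.succ_eq_succ, Nat.succ_eq_add_one, Nat.add_sub_cancel]
    refine Finset.sum_congr rfl fun k _ => ?_
    congr 1 <;> push_cast <;> ring
  have hterm : ∀ t : ℕ, |φ ((t : ℝ) / T) - T * ∫ v in (((t : ℝ) - 1) / T)..((t : ℝ) / T), φ v|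
      ≤ Λ / T := by
    intro t
    have hlen : (t : ℝ) / T - ((t : ℝ) - 1) / T = 1 / T := by ring
    have h1 : φ ((t : ℝ) / T) = T * ∫ _ in (((t : ℝ) - 1) / T)..((t : ℝ) / T), φ ((t : ℝ) / T) := by
      rw [intervalIntegral.integral_const, hlen, smul_eq_mul]; field_simp
    rw [h1, ← mul_sub, ← intervalIntegral.integral_sub (by simp) (hint _ _), abs_mul,
      abs_of_pos hT0]
    have h2 := intervalIntegral.norm_integral_le_of_norm_le_const (a := ((t : ℝ) - 1) / T)
      (b := (t : ℝ) / T) (f := fun v => φ ((t : ℝ) / T) - φ v) (C := Λ * (1 / T)) fun v hv => by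
        rw [uIoc_of_le (by gcongr; linarith)] at hv
        refine (hLip _ _).trans (mul_le_mul_of_nonneg_left ?_ hΛ)
        rw [abs_of_nonneg (by linarith [hv.2]), ← hlen]
        linarith [hv.1]
    rw [hlen, abs_of_pos (by positivity), Real.norm_eq_abs] at h2
    calc _ ≤ (T : ℝ) * (Λ * (1 / T) * (1 / T)) := mul_le_mul_of_nonneg_left h2 hT0.le
      _ = Λ / T := by field_simp
  rw [hsplit, Finset.mul_sum, ← Finset.sum_sub_distrib]
  refine (Finset.abs_sum_le_sum_abs _ _).trans ?_
  -- The radius grows by 1/T since a cell may meet the support while its right endpoint does not;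
  -- this turns the `+ 1` of the count into `+ 3`.
  refine (sum_Icc_le_of_time_support (u := u) (ρ := ρ + 1 / T) (K := Λ / T) hT (by positivity)
    (by positivity) (fun t _ => hterm t) fun t _ hlt => ?_).trans_eq ?_
  · have hout : ∀ v ∈ Icc (((t : ℝ) - 1) / T) ((t : ℝ) / T), φ v = 0 := by
      intro v hv
      refine h0 v ?_
      have h1 : |(t : ℝ) / T - v| ≤ 1 / T := by
        rw [abs_of_nonneg (by linarith [hv.2])]
        have : (t : ℝ) / T - ((t : ℝ) - 1) / T = 1 / T := by ring
        linarith [hv.1]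
      have h2 : |u - (t : ℝ) / T| ≤ |u - v| + |(t : ℝ) / T - v| := by
        calc |u - (t : ℝ) / T| = |(u - v) - ((t : ℝ) / T - v)| := by congr 1; ring
          _ ≤ _ := abs_sub _ _
      linarith
    have hle : ((t : ℝ) - 1) / T ≤ (t : ℝ) / T := by gcongr; linarith
    rw [hout _ (right_mem_Icc.2 hle), intervalIntegral.integral_congr (g := fun _ => 0)
      (fun v hv => hout v (by rwa [uIcc_of_le hle] at hv))]
    simp
  · congr 1; field_simp; ring

section Kernel

variable {K : ℝ → ℝ} {C₁ b : ℝ}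

theorem IsBoundedKernel.abs_sum_time_sub_le (hK : IsBoundedKernel K C₁ b) {h u : ℝ} {T : ℕ}
    (hT : 1 ≤ T) (hh : 0 < h) (hTh : 1 ≤ T * h) (hu0 : C₁ * h ≤ u) (hu1 : u ≤ 1 - C₁ * h) :
    |∑ t ∈ Finset.Icc 1 T, K ((u - (t : ℝ) / T) / h) - T * h| ≤ 5 * b ^ 2 := by
  have hb := hK.one_le
  have hT0 : (0 : ℝ) < T := by exact_mod_cast hT
  have hint : ∫ v, K ((u - v) / h) = h := by
    rw [integral_sub_left_eq_self (fun w => K (w / h)) volume u, Measure.integral_comp_div,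
      hK.integral, smul_eq_mul, mul_one, abs_of_pos hh]
  have := abs_sum_sub_integral_le (φ := fun v => K ((u - v) / h)) (Λ := b / h) (ρ := C₁ * h) hT
    (by positivity) (mul_pos hK.radius_pos hh).le (fun v w => by
      refine (hK.lip _ _).trans_eq ?_
      rw [show (u - v) / h - (u - w) / h = -((v - w) / h) by ring, abs_neg, abs_div,
        abs_of_pos hh]
      ring) (fun v hv => hK.eq_zero_of_le (by
        rw [abs_div, abs_of_pos hh, le_div_iff₀ hh]; exact hv)) hu0 hu1
  rw [hint] at this
  refine this.trans ?_
  have e : (2 * (C₁ * h * T) + 3) * (b / h / T) = 2 * C₁ * b + 3 * b * (1 / (T * h)) := by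
    field_simp
  have h1 : 1 / (T * h) ≤ 1 := by rw [div_le_one (by positivity)]; exact hTh
  have h2 : 3 * b * (1 / (T * h)) ≤ 3 * b * 1 := mul_le_mul_of_nonneg_left h1 (by linarith)
  rw [e]
  nlinarith [hK.radius]

/-- The function K((u - v)/h)(v - u) has integral zero by symmetry. Its Lipschitz constant is free
of h, because v - u = O(h) on the support compensates the slope 1/h of the kernel; the sum is
therefore O(h). -/
theorem IsBoundedKernel.abs_sum_time_mul_le (hK : IsBoundedKernel K C₁ b) {h u : ℝ} {T : ℕ}
    (hT : 1 ≤ T) (hh : 0 < h) (hTh : 1 ≤ T * h) (hu0 : C₁ * h ≤ u) (hu1 : u ≤ 1 - C₁ * h) :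
    |∑ t ∈ Finset.Icc 1 T, K ((u - (t : ℝ) / T) / h) * ((t : ℝ) / T - u)| ≤ 10 * b ^ 3 * h := by
  have hb := hK.one_le
  have hT0 : (0 : ℝ) < T := by exact_mod_cast hT
  have hρ := mul_pos hK.radius_pos hh
  have hzero : ∀ v, C₁ * h ≤ |u - v| → K ((u - v) / h) = 0 := fun v hv =>
    hK.eq_zero_of_le (by rw [abs_div, abs_of_pos hh, le_div_iff₀ hh]; exact hv)
  have hint : ∫ v, K ((u - v) / h) * (v - u) = 0 := by
    set φ : ℝ → ℝ := fun w => K (w / h) * (-w) with hφ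
    have e : ∀ v, K ((u - v) / h) * (v - u) = φ (u - v) := fun v => by simp only [hφ]; ring
    simp_rw [e]
    rw [integral_sub_left_eq_self φ volume u]
    have h1 : ∫ w, φ (-w) = ∫ w, φ w := integral_neg_eq_self φ volume
    have h2 : ∀ w, φ (-w) = -φ w := fun w => by
      simp only [hφ, neg_div, hK.symm]; ring
    simp_rw [h2, integral_neg] at h1
    linarith
  have hK' : ∀ v w, |K ((u - v) / h) - K ((u - w) / h)| ≤ b / h * |v - w| := fun v w => by
    refine (hK.lip _ _).trans_eq ?_
    rw [show (u - v) / h - (u - w) / h = -((v - w) / h) by ring, abs_neg, abs_div, abs_of_pos hh]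
    ring
  have hlip1 : ∀ v w, |u - w| ≤ C₁ * h →
      |K ((u - v) / h) * (v - u) - K ((u - w) / h) * (w - u)| ≤ 2 * b ^ 2 * |v - w| := by
    intro v w hw
    calc _ = |K ((u - v) / h) * (v - w) + (K ((u - v) / h) - K ((u - w) / h)) * (w - u)| := by
          congr 1; ring
      _ ≤ |K ((u - v) / h)| * |v - w| + |K ((u - v) / h) - K ((u - w) / h)| * |w - u| := by
          rw [← abs_mul, ← abs_mul]; exact abs_add_le _ _
      _ ≤ b * |v - w| + (b / h * |v - w|) * (C₁ * h) := by
          refine add_le_add (mul_le_mul_of_nonneg_right (hK.bound _) (abs_nonneg _))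
            (mul_le_mul (hK' v w) (by rwa [abs_sub_comm]) (abs_nonneg _) (by positivity))
      _ = (b + b * C₁) * |v - w| := by field_simp
      _ ≤ _ := by
          refine mul_le_mul_of_nonneg_right ?_ (abs_nonneg _)
          nlinarith [hK.radius]
  have hlip : ∀ v w, |K ((u - v) / h) * (v - u) - K ((u - w) / h) * (w - u)|
      ≤ 2 * b ^ 2 * |v - w| := by
    intro v w
    rcases le_total (|u - w|) (C₁ * h) with hw | hw
    · exact hlip1 v w hw
    · rcases le_total (|u - v|) (C₁ * h) with hv | hv
      · rw [abs_sub_comm, abs_sub_comm v w]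
        exact hlip1 w v hv
      · rw [hzero v hv, hzero w hw]
        simp; positivity
  have := abs_sum_sub_integral_le (φ := fun v => K ((u - v) / h) * (v - u)) (Λ := 2 * b ^ 2)
    (ρ := C₁ * h) hT (by positivity) hρ.le hlip (fun v hv => by simp [hzero v hv]) hu0 hu1
  rw [hint, mul_zero, sub_zero] at this
  refine this.trans ?_
  have h3 : 2 * (C₁ * h * T) + 3 ≤ 5 * b * (T * h) := by
    have h4 : C₁ * (T * h) ≤ b * (T * h) := mul_le_mul_of_nonneg_right hK.radius (by positivity)
    nlinarith
  calc _ ≤ 5 * b * (T * h) * (2 * b ^ 2 / T) := mul_le_mul_of_nonneg_right h3 (by positivity)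
    _ = _ := by field_simp; ring

end Kernel

/-! ### Expectations of kernel-localized functions -/

section

variable {Ω : Type*} {mΩ : MeasurableSpace Ω} {P : Measure Ω} {d : ℕ}

theorem rpow_min_le_one_add {y ρ : ℝ} (hy : 0 ≤ y) (hρ : 0 < ρ) : y ^ min ρ 1 ≤ 1 + y ^ ρ := by
  have hr : 0 < min ρ 1 := lt_min hρ one_pos
  rcases le_total y 1 with h | h
  · have h1 : y ^ min ρ 1 ≤ 1 := Real.rpow_le_one hy h hr.le
    have h2 : 0 ≤ y ^ ρ := by positivity
    linarith
  · have : y ^ min ρ 1 ≤ y ^ ρ := Real.rpow_le_rpow_of_exponent_le h (min_le_left _ _)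
    linarith

/-- The difference y of the two values is at most 2c and at most c' τ U. Writing y = y^{1-r} y^r
with r = min ρ 1 and using one bound in each factor requires only the moment of order ρ of U. -/
theorem abs_integral_sub_le_of_close [IsProbabilityMeasure P] {Z Z' : Ω → Fin d → ℝ} {U : Ω → ℝ}
    {ρ τ c c' : ℝ} {C : ℝ≥0} (hZ : Measurable Z) (hZ' : Measurable Z') (hU : Measurable U)
    (hU0 : ∀ ω, 0 < U ω) (hUC : ∫⁻ ω, ENNReal.ofReal (U ω ^ ρ) ∂P ≤ C) (hρ : 0 < ρ) (hτ : 0 ≤ τ)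
    (hclose : ∀ᵐ ω ∂P, ‖Z ω - Z' ω‖ ≤ τ * U ω) {ψ : (Fin d → ℝ) → ℝ} (hψ : Measurable ψ)
    (hc : 0 ≤ c) (hc' : 0 ≤ c')
    (hψb : ∀ y, |ψ y| ≤ c) (hψL : ∀ y y', |ψ y - ψ y'| ≤ c' * ‖y - y'‖) :
    |∫ ω, ψ (Z ω) ∂P - ∫ ω, ψ (Z' ω) ∂P|
      ≤ (2 * c) ^ (1 - min ρ 1) * (c' * τ) ^ min ρ 1 * (1 + C) := by
  have hr : 0 < min ρ 1 := lt_min hρ one_pos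
  have hr1 : min ρ 1 ≤ 1 := min_le_right _ _
  have hi : Integrable (fun ω => ψ (Z ω)) P := Integrable.of_bound
    (hψ.comp hZ).aestronglyMeasurable c (ae_of_all _ fun ω => hψb _)
  have hi' : Integrable (fun ω => ψ (Z' ω)) P := Integrable.of_bound
    (hψ.comp hZ').aestronglyMeasurable c (ae_of_all _ fun ω => hψb _)
  have hUi : Integrable (fun ω => U ω ^ ρ) P := by
    refine ⟨(hU.pow_const ρ).aestronglyMeasurable, ?_⟩
    rw [hasFiniteIntegral_iff_ofReal (ae_of_all _ fun ω => Real.rpow_nonneg (hU0 ω).le _)]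
    exact hUC.trans_lt ENNReal.coe_lt_top
  have hUint : ∫ ω, U ω ^ ρ ∂P ≤ C := by
    rw [integral_eq_lintegral_of_nonneg_ae (ae_of_all _ fun ω => Real.rpow_nonneg (hU0 ω).le _)
      hUi.aestronglyMeasurable]
    exact ENNReal.toReal_le_coe_of_le_coe hUC
  rw [← integral_sub hi hi']
  calc _ ≤ ∫ ω, |ψ (Z ω) - ψ (Z' ω)| ∂P := abs_integral_le_integral_abs
    _ ≤ ∫ ω, (2 * c) ^ (1 - min ρ 1) * (c' * τ) ^ min ρ 1 * (1 + U ω ^ ρ) ∂P := by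
        refine integral_mono_ae (hi.sub hi').abs
          (((integrable_const 1).add hUi).const_mul _) ?_
        filter_upwards [hclose] with ω hω
        set y := |ψ (Z ω) - ψ (Z' ω)| with hy
        have hy0 : 0 ≤ y := abs_nonneg _
        have h1 : y ≤ 2 * c := (abs_sub _ _).trans (by linarith [hψb (Z ω), hψb (Z' ω)])
        have h2 : y ≤ c' * τ * U ω := (hψL _ _).trans (by
          rw [mul_assoc]; exact mul_le_mul_of_nonneg_left hω hc')
        calc y = y ^ (1 - min ρ 1) * y ^ min ρ 1 := by
              rcases hy0.eq_or_lt with h0 | h0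
              · rw [← h0, Real.zero_rpow hr.ne', mul_zero]
              · rw [← Real.rpow_add h0]; simp
          _ ≤ (2 * c) ^ (1 - min ρ 1) * (c' * τ * U ω) ^ min ρ 1 :=
              mul_le_mul (Real.rpow_le_rpow hy0 h1 (by linarith))
                (Real.rpow_le_rpow hy0 h2 hr.le) (by positivity) (by positivity)
          _ = (2 * c) ^ (1 - min ρ 1) * (c' * τ) ^ min ρ 1 * U ω ^ min ρ 1 := by
              rw [Real.mul_rpow (by positivity) (hU0 ω).le]; ring
          _ ≤ _ := mul_le_mul_of_nonneg_left (rpow_min_le_one_add (hU0 ω).le hρ) (by positivity)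
    _ ≤ _ := by
        rw [integral_const_mul, integral_add (integrable_const 1) hUi]
        refine mul_le_mul_of_nonneg_left ?_ (by positivity)
        simpa using hUint

theorem integral_comp_eq_of_density {E : Type*} [MeasureSpace E] {Z : Ω → E} (hZ : Measurable Z)
    {p : E → ℝ} (hp : IsDensity P Z p) {ψ : E → ℝ} (hψ : Measurable ψ) :
    ∫ ω, ψ (Z ω) ∂P = ∫ y, ψ y * p y := by
  obtain ⟨hpm, hp0, hmap⟩ := hp
  rw [← integral_map hZ.aemeasurable hψ.aestronglyMeasurable, hmap,
    integral_withDensity_eq_integral_toReal_smul hpm.ennreal_ofReal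
      (ae_of_all _ fun _ => ENNReal.ofReal_lt_top)]
  simp only [ENNReal.toReal_ofReal (hp0 _), smul_eq_mul, mul_comm]

theorem abs_integral_le_of_ball_support {φ : (Fin d → ℝ) → ℝ} {x : Fin d → ℝ} {η c : ℝ}
    (hη : 0 ≤ η) (h0 : ∀ y, η < ‖y - x‖ → φ y = 0) (hc : ∀ y, ‖y - x‖ ≤ η → |φ y| ≤ c) :
    |∫ y, φ y| ≤ c * (2 ^ d * η ^ d) := by
  have hsupp : Function.support φ ⊆ Metric.closedBall x η := fun y hy => by
    rw [Metric.mem_closedBall, dist_eq_norm]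
    by_contra hcon
    exact hy (h0 y (not_le.1 hcon))
  rw [← setIntegral_eq_integral_of_forall_compl_eq_zero (s := Metric.closedBall x η)
    fun y hy => by_contra fun hne => hy (hsupp hne), ← volumeReal_closedBall_pi x hη]
  rw [← Real.norm_eq_abs]
  exact norm_setIntegral_le_of_norm_le_const measure_closedBall_lt_top fun y hy => by
    rw [Real.norm_eq_abs]
    exact hc y (by rwa [Metric.mem_closedBall, dist_eq_norm] at hy)

end

/-! ### Bias of the smoothed design density and regression function -/

section

variable {Ω : Type*} {mΩ : MeasurableSpace Ω} {P : Measure Ω} {d : ℕ}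

theorem integrable_of_ball_support {φ : (Fin d → ℝ) → ℝ} (hφ : Measurable φ) {x : Fin d → ℝ}
    {η c : ℝ} (h0 : ∀ y, η < ‖y - x‖ → φ y = 0) (hc : ∀ y, ‖y - x‖ ≤ η → |φ y| ≤ c) :
    Integrable φ := by
  have hsupp : Function.support φ ⊆ Metric.closedBall x η := fun y hy => by
    rw [Metric.mem_closedBall, dist_eq_norm]
    by_contra hcon
    exact hy (h0 y (not_le.1 hcon))
  rw [← integrableOn_iff_integrable_of_support_subset hsupp]
  refine Measure.integrableOn_of_bounded (M := c) measure_closedBall_lt_top.ne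
    hφ.aestronglyMeasurable ?_
  filter_upwards [ae_restrict_mem measurableSet_closedBall] with y hy
  rw [Real.norm_eq_abs]
  exact hc y (by rwa [Metric.mem_closedBall, dist_eq_norm] at hy)

/-- The stationary approximation is taken at u = t/T, where the distance reduces to U/T. -/
theorem exists_abs_integral_comp_sub_le [IsProbabilityMeasure P] {X : ℕ → ℕ → Ω → (Fin d → ℝ)}
    {Xs : ℝ → ℤ → Ω → (Fin d → ℝ)} {f : ℝ → (Fin d → ℝ) → ℝ} {ρ : ℝ}
    (hX : ∀ t T : ℕ, 1 ≤ t → t ≤ T → Measurable (X t T)) (hloc : LocallyStationary P X Xs f ρ) :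
    ∃ C : ℝ, 0 ≤ C ∧ ∀ t T : ℕ, 1 ≤ t → t ≤ T → ∀ (ψ : (Fin d → ℝ) → ℝ) (c c' : ℝ), Measurable ψ →
      0 ≤ c → 0 ≤ c' → (∀ y, |ψ y| ≤ c) → (∀ y y', |ψ y - ψ y'| ≤ c' * ‖y - y'‖) →
      |∫ ω, ψ (X t T ω) ∂P - ∫ y, ψ y * f ((t : ℝ) / T) y|
        ≤ (2 * c) ^ (1 - min ρ 1) * (c' * (1 / T)) ^ min ρ 1 * C := by
  obtain ⟨hst, hρ, U, C, hU⟩ := hloc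
  refine ⟨1 + C, by positivity, fun t T ht htT ψ c c' hψ hc hc' hb hL => ?_⟩
  have hT : (0 : ℝ) < T := by exact_mod_cast (by omega : 0 < T)
  have hu : (t : ℝ) / T ∈ Icc (0 : ℝ) 1 :=
    ⟨by positivity, by rw [div_le_one hT]; exact_mod_cast htT⟩
  obtain ⟨h1, h2, h3, h4⟩ := hU _ hu t T ht htT
  rw [← integral_comp_eq_of_density ((hst _ hu).1.1 t) ((hst _ hu).2 t) hψ]
  refine abs_integral_sub_le_of_close (hX t T ht htT) ((hst _ hu).1.1 t) h1 h2 h3 hρ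
    (by positivity) ?_ hψ hc hc' hb hL
  filter_upwards [h4] with ω hω
  simpa using hω

variable {K : ℝ → ℝ} {C₁ b h : ℝ} {x : Fin d → ℝ}

theorem IsBoundedKernel.scaled_eq_zero (hK : IsBoundedKernel K C₁ b) (hh : 0 < h) {y : Fin d → ℝ}
    (hy : b * h < ‖y - x‖) : spaceKernel K (fun j => (x j - y j) / h) = 0 := by
  refine hK.spaceKernel_eq_zero (hK.radius.trans_lt ?_)
  rwa [norm_spaceArg x y hh, lt_div_iff₀ hh]

theorem IsBoundedKernel.abs_scaled_sub_le (hK : IsBoundedKernel K C₁ b) (hh : 0 < h)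
    (y y' : Fin d → ℝ) :
    |spaceKernel K (fun j => (x j - y j) / h) - spaceKernel K (fun j => (x j - y' j) / h)|
      ≤ d * b ^ (d + 1) / h * ‖y - y'‖ := by
  refine (hK.abs_spaceKernel_sub_le _ _).trans_eq ?_
  have : (fun j => (x j - y j) / h) - (fun j => (x j - y' j) / h)
      = (fun j => (y' j - y j) / h : Fin d → ℝ) := by
    ext j; simp only [Pi.sub_apply]; ring
  rw [this, norm_spaceArg y' y hh]
  ring

theorem IsBoundedKernel.continuous_scaled (hK : IsBoundedKernel K C₁ b) (h : ℝ) (x : Fin d → ℝ) :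
    Continuous fun y : Fin d → ℝ => spaceKernel K (fun j => (x j - y j) / h) :=
  hK.continuous_spaceKernel.comp (by fun_prop)

theorem IsBoundedKernel.integrable_scaled_mul (hK : IsBoundedKernel K C₁ b) (hh : 0 < h)
    {g : (Fin d → ℝ) → ℝ} (hg : Measurable g) {c : ℝ} (hc : ∀ y, ‖y - x‖ ≤ b * h → |g y| ≤ c) :
    Integrable fun y => spaceKernel K (fun j => (x j - y j) / h) * g y :=
  integrable_of_ball_support (x := x) (η := b * h) (c := b ^ d * c)
    ((hK.continuous_scaled h x).measurable.mul hg)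
    (fun y hy => by rw [hK.scaled_eq_zero hh hy, zero_mul])
    fun y hy => by
      rw [abs_mul]
      exact mul_le_mul (hK.abs_spaceKernel_le _) (hc y hy) (abs_nonneg _)
        (pow_nonneg (by linarith [hK.one_le]) _)

theorem IsBoundedKernel.abs_integral_scaled_mul_le (hK : IsBoundedKernel K C₁ b) (hh : 0 < h)
    {g : (Fin d → ℝ) → ℝ} {c : ℝ} (hc : ∀ y, ‖y - x‖ ≤ b * h → |g y| ≤ c) :
    |∫ y, spaceKernel K (fun j => (x j - y j) / h) * g y|
      ≤ (b ^ d * (2 ^ d * b ^ d)) * (c * h ^ d) := by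
  have hb := hK.one_le
  refine (abs_integral_le_of_ball_support (x := x) (η := b * h) (c := b ^ d * c) (by positivity)
    (fun y hy => by rw [hK.scaled_eq_zero hh hy, zero_mul]) fun y hy => ?_).trans_eq ?_
  · rw [abs_mul]
    exact mul_le_mul (hK.abs_spaceKernel_le _) (hc y hy) (abs_nonneg _) (by positivity)
  · rw [mul_pow]; ring

/-- Expectation of the spatial kernel weight. -/
theorem exists_expectation_scaled_sub_le [IsProbabilityMeasure P] {X : ℕ → ℕ → Ω → (Fin d → ℝ)}
    {Xs : ℝ → ℤ → Ω → (Fin d → ℝ)} {f : ℝ → (Fin d → ℝ) → ℝ} {ρ : ℝ}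
    (hX : ∀ t T : ℕ, 1 ≤ t → t ≤ T → Measurable (X t T)) (hloc : LocallyStationary P X Xs f ρ)
    (hK : IsBoundedKernel K C₁ b) {r L : ℝ} (hL : 0 ≤ L)
    (hf : ∀ u ∈ Icc (0 : ℝ) 1, ∀ v ∈ Icc (0 : ℝ) 1, ∀ x y : Fin d → ℝ, ‖x‖ ≤ r + 1 → ‖y‖ ≤ r + 1 →
      |f v y - f u x| ≤ L * (|v - u| + ‖y - x‖)) :
    ∃ Q : ℝ, 0 ≤ Q ∧ ∀ t T : ℕ, 1 ≤ t → t ≤ T → ∀ h : ℝ, 0 < h → b * h ≤ 1 →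
      ∀ u ∈ Icc (0 : ℝ) 1, ∀ x : Fin d → ℝ, ‖x‖ ≤ r → |u - (t : ℝ) / T| ≤ b * h →
      |∫ ω, spaceKernel K (fun j => (x j - X t T ω j) / h) ∂P - f u x * h ^ d|
        ≤ Q * (1 / ((T : ℝ) ^ min ρ 1 * h ^ min ρ 1) + h ^ (d + 1)) := by
  obtain ⟨C, hC, hcomp⟩ := exists_abs_integral_comp_sub_le hX hloc
  have hb := hK.one_le
  set r' := min ρ 1 with hr'
  refine ⟨(2 * b ^ d) ^ (1 - r') * (d * b ^ (d + 1)) ^ r' * C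
    + (b ^ d * (2 ^ d * b ^ d)) * (2 * L * b), by positivity,
    fun t T ht htT h hh hbh u hu x hx hut => ?_⟩
  have hT : (0 : ℝ) < T := by exact_mod_cast (by omega : 0 < T)
  have hv : (t : ℝ) / T ∈ Icc (0 : ℝ) 1 :=
    ⟨by positivity, by rw [div_le_one hT]; exact_mod_cast htT⟩
  set v := (t : ℝ) / T
  have hball : ∀ y : Fin d → ℝ, ‖y - x‖ ≤ b * h → |f v y - f u x| ≤ 2 * L * b * h := by
    intro y hy
    have hy' : ‖y‖ ≤ r + 1 := by
      have : ‖y‖ ≤ ‖y - x‖ + ‖x‖ := by simpa using norm_add_le (y - x) x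
      linarith
    refine (hf u hu v hv x y (by linarith) hy').trans ?_
    rw [abs_sub_comm] at hut
    calc _ ≤ L * (b * h + b * h) := mul_le_mul_of_nonneg_left (add_le_add hut hy) hL
      _ = _ := by ring
  have hfm : Measurable (f v) := ((hloc.1 v hv).2 0).1
  have h1 := hcomp t T ht htT (fun y => spaceKernel K (fun j => (x j - y j) / h)) (b ^ d)
    (d * b ^ (d + 1) / h) (hK.continuous_scaled h x).measurable (by positivity) (by positivity)
    (fun y => hK.abs_spaceKernel_le _) (hK.abs_scaled_sub_le hh)
  have hi1 := hK.integrable_scaled_mul hh (hfm.sub_const (f u x)) hball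
  have hi2 := hK.integrable_scaled_mul (x := x) hh (measurable_const (a := f u x))
    (c := |f u x|) fun y _ => le_rfl
  have h2 : (∫ y, spaceKernel K (fun j => (x j - y j) / h) * f v y) - f u x * h ^ d
      = ∫ y, spaceKernel K (fun j => (x j - y j) / h) * (f v y - f u x) := by
    have e : ∀ y, spaceKernel K (fun j => (x j - y j) / h) * f v y
        = spaceKernel K (fun j => (x j - y j) / h) * (f v y - f u x)
          + spaceKernel K (fun j => (x j - y j) / h) * f u x := fun y => by ring
    simp_rw [e]
    rw [integral_add hi1 hi2, integral_mul_const, hK.integral_spaceKernel_scaled hh x]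
    ring
  have h3 := hK.abs_integral_scaled_mul_le hh hball
  rw [← h2] at h3
  -- The Lipschitz constant of the rescaled kernel is of order 1/h; this is the origin of the factor
  -- h^{-r}.
  have e1 : (d * b ^ (d + 1) / h * (1 / T)) ^ r'
      = (d * b ^ (d + 1)) ^ r' * (1 / ((T : ℝ) ^ r' * h ^ r')) := by
    rw [show d * b ^ (d + 1) / h * (1 / T) = d * b ^ (d + 1) / (T * h) by field_simp,
      Real.div_rpow (by positivity) (by positivity), Real.mul_rpow hT.le hh.le]
    ring
  rw [e1] at h1
  set p := 1 / ((T : ℝ) ^ r' * h ^ r')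
  have hp : 0 ≤ p := by positivity
  set q₁ := (2 * b ^ d) ^ (1 - r') * (d * b ^ (d + 1)) ^ r' * C
  have hq₁ : 0 ≤ q₁ := by positivity
  set q₂ := (b ^ d * (2 ^ d * b ^ d)) * (2 * L * b)
  have hq₂ : 0 ≤ q₂ := by positivity
  calc _ ≤ _ := abs_sub_le _ (∫ y, spaceKernel K (fun j => (x j - y j) / h) * f v y) _
    _ ≤ q₁ * p + q₂ * h ^ (d + 1) := add_le_add (h1.trans_eq (by simp only [q₁]; ring))
        (h3.trans_eq (by simp only [q₂]; ring))
    _ ≤ _ := by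
        have := mul_nonneg hq₁ (pow_pos hh (d + 1)).le
        have := mul_nonneg hq₂ hp
        nlinarith

/-- Expectation of the kernel-weighted increments of the regression function. -/
theorem exists_expectation_scaled_increment_le [IsProbabilityMeasure P]
    {X : ℕ → ℕ → Ω → (Fin d → ℝ)} {Xs : ℝ → ℤ → Ω → (Fin d → ℝ)} {f m : ℝ → (Fin d → ℝ) → ℝ}
    {ρ : ℝ} (hX : ∀ t T : ℕ, 1 ≤ t → t ≤ T → Measurable (X t T))
    (hloc : LocallyStationary P X Xs f ρ) (hK : IsBoundedKernel K C₁ b) {r L : ℝ} (hL : 0 ≤ L)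
    (hf : ∀ u ∈ Icc (0 : ℝ) 1, ∀ v ∈ Icc (0 : ℝ) 1, ∀ x y : Fin d → ℝ, ‖x‖ ≤ r + 1 → ‖y‖ ≤ r + 1 →
      |f v y - f u x| ≤ L * (|v - u| + ‖y - x‖))
    (hfb : ∀ u ∈ Icc (0 : ℝ) 1, ∀ x : Fin d → ℝ, ‖x‖ ≤ r → |f u x| ≤ L)
    (hmm : ∀ v ∈ Icc (0 : ℝ) 1, Measurable (m v))
    (hm : ∀ u ∈ Icc (0 : ℝ) 1, ∀ v ∈ Icc (0 : ℝ) 1, ∀ x y : Fin d → ℝ, ‖x‖ ≤ r + 1 → ‖y‖ ≤ r + 1 →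
      |m v y - m u x| ≤ L * max |v - u| ‖y - x‖) :
    ∃ Q : ℝ, 0 ≤ Q ∧ ∀ t T : ℕ, 1 ≤ t → t ≤ T → ∀ h : ℝ, 0 < h → b * h ≤ 1 →
      ∀ u ∈ Icc (0 : ℝ) 1, ∀ x : Fin d → ℝ, ‖x‖ ≤ r → |u - (t : ℝ) / T| ≤ b * h →
      ∀ (ℓ₁ : ℝ) (ℓ₂ : (Fin d → ℝ) →ₗ[ℝ] ℝ), (∀ v ∈ Icc (0 : ℝ) 1, ∀ y : Fin d → ℝ, ‖y‖ ≤ r + 1 →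
          |m v y - m u x - (v - u) * ℓ₁ - ℓ₂ (y - x)| ≤ L * max |v - u| ‖y - x‖ ^ 2) →
      |∫ ω, spaceKernel K (fun j => (x j - X t T ω j) / h)
            * (m ((t : ℝ) / T) (X t T ω) - m u x) ∂P
          - f u x * h ^ d * (((t : ℝ) / T - u) * ℓ₁)|
        ≤ Q * (1 / (T : ℝ) ^ min ρ 1 + h ^ (d + 2)) := by
  obtain ⟨C, hC, hcomp⟩ := exists_abs_integral_comp_sub_le hX hloc
  have hb := hK.one_le
  set r' := min ρ 1 with hr'
  refine ⟨(2 * (b ^ d * L)) ^ (1 - r') * (b ^ d * L + d * b ^ (d + 1) * (L * b)) ^ r' * C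
    + (b ^ d * (2 ^ d * b ^ d)) * (3 * L ^ 2 * b ^ 2), by positivity,
    fun t T ht htT h hh hbh u hu x hx hut ℓ₁ ℓ₂ hℓ => ?_⟩
  have hT : (0 : ℝ) < T := by exact_mod_cast (by omega : 0 < T)
  have hv : (t : ℝ) / T ∈ Icc (0 : ℝ) 1 :=
    ⟨by positivity, by rw [div_le_one hT]; exact_mod_cast htT⟩
  set v := (t : ℝ) / T
  have hut' : |v - u| ≤ b * h := by rwa [abs_sub_comm]
  have hnorm : ∀ y : Fin d → ℝ, ‖y - x‖ ≤ b * h → ‖y‖ ≤ r + 1 := fun y hy => by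
    have : ‖y‖ ≤ ‖y - x‖ + ‖x‖ := by simpa using norm_add_le (y - x) x
    linarith
  have hx' : ‖x‖ ≤ r + 1 := by linarith
  have hballf : ∀ y : Fin d → ℝ, ‖y - x‖ ≤ b * h → |f v y - f u x| ≤ 2 * L * b * h := by
    intro y hy
    refine (hf u hu v hv x y hx' (hnorm y hy)).trans ?_
    calc _ ≤ L * (b * h + b * h) := mul_le_mul_of_nonneg_left (add_le_add hut' hy) hL
      _ = _ := by ring
  have hballm : ∀ y : Fin d → ℝ, ‖y - x‖ ≤ b * h → |m v y - m u x| ≤ L * (b * h) := fun y hy =>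
    (hm u hu v hv x y hx' (hnorm y hy)).trans (mul_le_mul_of_nonneg_left (max_le hut' hy) hL)
  have hballR : ∀ y : Fin d → ℝ, ‖y - x‖ ≤ b * h →
      |m v y - m u x - (v - u) * ℓ₁ - ℓ₂ (y - x)| ≤ L * (b * h) ^ 2 := fun y hy =>
    (hℓ v hv y (hnorm y hy)).trans (mul_le_mul_of_nonneg_left
      (pow_le_pow_left₀ (le_max_of_le_left (abs_nonneg _)) (max_le hut' hy) 2) hL)
  have hfm : Measurable (f v) := ((hloc.1 v hv).2 0).1
  have hℓm : Measurable fun y : Fin d → ℝ => ℓ₂ (y - x) :=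
    (ℓ₂.continuous_of_finiteDimensional.comp (continuous_id.sub continuous_const)).measurable
  set κ : (Fin d → ℝ) → ℝ := fun y => spaceKernel K (fun j => (x j - y j) / h) with hκ
  have hκb : ∀ y, |κ y| ≤ b ^ d := fun y => hK.abs_spaceKernel_le _
  have hκ0 : ∀ y, b * h < ‖y - x‖ → κ y = 0 := fun y hy => hK.scaled_eq_zero hh hy
  have hκL : ∀ y y', |κ y - κ y'| ≤ d * b ^ (d + 1) / h * ‖y - y'‖ := hK.abs_scaled_sub_le hh
  have hψb : ∀ y, |κ y * (m v y - m u x)| ≤ b ^ d * L := by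
    intro y
    rcases le_or_gt (‖y - x‖) (b * h) with hy | hy
    · rw [abs_mul]
      refine mul_le_mul (hκb y) ((hballm y hy).trans ?_) (abs_nonneg _) (by positivity)
      exact mul_le_of_le_one_right hL hbh
    · rw [hκ0 y hy]; simp; positivity
  -- The Lipschitz constant does not depend on h: on the support the increment of m is O(h), which
  -- offsets the slope of the kernel. Hence the approximation error is T^{-r} without the factor
  -- h^{-r}.
  have hψL1 : ∀ y y', ‖y' - x‖ ≤ b * h → |κ y * (m v y - m u x) - κ y' * (m v y' - m u x)|
      ≤ (b ^ d * L + d * b ^ (d + 1) * (L * b)) * ‖y - y'‖ := by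
    intro y y' hy'
    have h1 : |κ y - κ y'| * |m v y' - m u x| ≤ d * b ^ (d + 1) * (L * b) * ‖y - y'‖ := by
      calc _ ≤ (d * b ^ (d + 1) / h * ‖y - y'‖) * (L * (b * h)) :=
            mul_le_mul (hκL y y') (hballm y' hy') (abs_nonneg _) (by positivity)
        _ = _ := by field_simp
    rcases le_or_gt (‖y - x‖) (b * h) with hy | hy
    · have h2 : |m v y - m v y'| ≤ L * ‖y - y'‖ := by
        have := hm v hv v hv y' y (hnorm y' hy') (hnorm y hy)
        rwa [sub_self, abs_zero, max_eq_right (norm_nonneg _)] at this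
      calc _ = |κ y * (m v y - m v y') + (κ y - κ y') * (m v y' - m u x)| := by congr 1; ring
        _ ≤ |κ y| * |m v y - m v y'| + |κ y - κ y'| * |m v y' - m u x| := by
            rw [← abs_mul, ← abs_mul]; exact abs_add_le _ _
        _ ≤ b ^ d * (L * ‖y - y'‖) + d * b ^ (d + 1) * (L * b) * ‖y - y'‖ :=
            add_le_add (mul_le_mul (hκb y) h2 (abs_nonneg _) (by positivity)) h1
        _ = _ := by ring
    · calc _ = |κ y - κ y'| * |m v y' - m u x| := by
            rw [← abs_mul, hκ0 y hy]; congr 1; ring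
        _ ≤ _ := h1.trans (mul_le_mul_of_nonneg_right (le_add_of_nonneg_left (by positivity))
            (norm_nonneg _))
  have hψL : ∀ y y', |κ y * (m v y - m u x) - κ y' * (m v y' - m u x)|
      ≤ (b ^ d * L + d * b ^ (d + 1) * (L * b)) * ‖y - y'‖ := by
    intro y y'
    rcases le_or_gt (‖y' - x‖) (b * h) with hy' | hy'
    · exact hψL1 y y' hy'
    · rcases le_or_gt (‖y - x‖) (b * h) with hy | hy
      · rw [abs_sub_comm, norm_sub_rev]
        exact hψL1 y' y hy
      · rw [hκ0 y hy, hκ0 y' hy']; simp; positivity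
  have hκm : Measurable κ := (hK.continuous_scaled h x).measurable
  have h1 := hcomp t T ht htT (fun y => κ y * (m v y - m u x)) (b ^ d * L)
    (b ^ d * L + d * b ^ (d + 1) * (L * b)) (hκm.mul ((hmm v hv).sub_const _)) (by positivity)
    (by positivity) hψb hψL
  -- `g` collects the O(h²) part of (m(v,y) - m(u,x)) f(v,y): the product of two increments and the
  -- Taylor remainder. What is left is linear with coefficient f(u,x); its spatial part integrates
  -- to zero and its time part is kept for the summation over t.
  set g : (Fin d → ℝ) → ℝ := fun y => (m v y - m u x) * (f v y - f u x)
    + f u x * (m v y - m u x - (v - u) * ℓ₁ - ℓ₂ (y - x)) with hg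
  have hgm : Measurable g := (((hmm v hv).sub_const _).mul (hfm.sub_const _)).add
    (((((hmm v hv).sub_const _).sub_const _).sub hℓm).const_mul _)
  have hgb : ∀ y, ‖y - x‖ ≤ b * h → |g y| ≤ 3 * L ^ 2 * b ^ 2 * h ^ 2 := by
    intro y hy
    calc _ ≤ |m v y - m u x| * |f v y - f u x|
          + |f u x| * |m v y - m u x - (v - u) * ℓ₁ - ℓ₂ (y - x)| := by
          rw [← abs_mul, ← abs_mul]; exact abs_add_le _ _
      _ ≤ (L * (b * h)) * (2 * L * b * h) + L * (L * (b * h) ^ 2) :=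
          add_le_add (mul_le_mul (hballm y hy) (hballf y hy) (abs_nonneg _) (by positivity))
            (mul_le_mul (hfb u hu x hx) (hballR y hy) (abs_nonneg _) hL)
      _ = _ := by ring
  have hi1 := hK.integrable_scaled_mul hh hgm hgb
  have hi2 := hK.integrable_scaled_mul (x := x) hh
    (measurable_const (a := f u x * ((v - u) * ℓ₁))) fun y _ => le_rfl
  have hℓb : ∀ y, ‖y - x‖ ≤ b * h → |ℓ₂ (y - x)| ≤ ‖ℓ₂.toContinuousLinearMap‖ * (b * h) :=
    fun y hy => ((ℓ₂.toContinuousLinearMap).le_opNorm (y - x)).trans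
      (mul_le_mul_of_nonneg_left hy (norm_nonneg _))
  have hi3 := (hK.integrable_scaled_mul hh hℓm hℓb).const_mul (f u x)
  have h2 : (∫ y, κ y * (m v y - m u x) * f v y) - f u x * h ^ d * ((v - u) * ℓ₁)
      = ∫ y, κ y * g y := by
    have e : ∀ y, κ y * (m v y - m u x) * f v y
        = κ y * g y + κ y * (f u x * ((v - u) * ℓ₁)) + f u x * (κ y * ℓ₂ (y - x)) := fun y => by
      simp only [hg]; ring
    have hi12 : Integrable fun y => κ y * g y + κ y * (f u x * ((v - u) * ℓ₁)) := hi1.add hi2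
    simp_rw [e]
    rw [integral_add hi12 hi3, integral_add hi1 hi2, integral_mul_const,
      integral_const_mul, hK.integral_spaceKernel_scaled hh x,
      hK.integral_spaceKernel_mul_linear h x ℓ₂]
    ring
  have h3 := hK.abs_integral_scaled_mul_le hh hgb
  rw [← h2] at h3
  have e1 : ((b ^ d * L + d * b ^ (d + 1) * (L * b)) * (1 / T)) ^ r'
      = (b ^ d * L + d * b ^ (d + 1) * (L * b)) ^ r' * (1 / (T : ℝ) ^ r') := by
    rw [Real.mul_rpow (by positivity) (by positivity), Real.div_rpow zero_le_one hT.le,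
      Real.one_rpow]
  rw [e1] at h1
  set p := 1 / (T : ℝ) ^ r'
  have hp : 0 ≤ p := by positivity
  set q₁ := (2 * (b ^ d * L)) ^ (1 - r') * (b ^ d * L + d * b ^ (d + 1) * (L * b)) ^ r' * C
  have hq₁ : 0 ≤ q₁ := by positivity
  set q₂ := (b ^ d * (2 ^ d * b ^ d)) * (3 * L ^ 2 * b ^ 2)
  have hq₂ : 0 ≤ q₂ := by positivity
  calc _ ≤ _ := abs_sub_le _ (∫ y, κ y * (m v y - m u x) * f v y) _
    _ ≤ q₁ * p + q₂ * h ^ (d + 2) := add_le_add (h1.trans_eq (by simp only [q₁]; ring))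
        (h3.trans_eq (by simp only [q₂]; ring))
    _ ≤ _ := by
        have := mul_nonneg hq₁ (pow_pos hh (d + 2)).le
        have := mul_nonneg hq₂ hp
        nlinarith

end

/-! ### Kernel-weighted sums of expectations -/

section

variable {K : ℝ → ℝ} {C₁ b : ℝ}

/-- Summation in time of expectations that are affine in t/T - u up to an error q. The constant part
reproduces the mass T h of the kernel up to O(1), and the slope is nearly annihilated by symmetry.
-/
theorem IsBoundedKernel.abs_sum_time_affine_le (hK : IsBoundedKernel K C₁ b) {h u α γ q : ℝ}
    {T : ℕ} {e : ℕ → ℝ} (hT : 1 ≤ T) (hh : 0 < h) (hTh : 1 ≤ T * h) (hu0 : C₁ * h ≤ u)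
    (hu1 : u ≤ 1 - C₁ * h) (hq : 0 ≤ q) (he : ∀ t ∈ Finset.Icc 1 T, |u - (t : ℝ) / T| ≤ b * h →
      |e t - (α + γ * ((t : ℝ) / T - u))| ≤ q) :
    |∑ t ∈ Finset.Icc 1 T, K ((u - (t : ℝ) / T) / h) * e t - α * (T * h)|
      ≤ 3 * b ^ 2 * (T * h) * q + 5 * b ^ 2 * |α| + 10 * b ^ 3 * h * |γ| := by
  have hb := hK.one_le
  have hK0 : ∀ t : ℕ, b * h < |u - (t : ℝ) / T| → K ((u - (t : ℝ) / T) / h) = 0 := fun t ht => by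
    refine hK.supp _ (hK.radius.trans_lt ?_)
    rwa [abs_div, abs_of_pos hh, lt_div_iff₀ hh]
  have h1 : |∑ t ∈ Finset.Icc 1 T, K ((u - (t : ℝ) / T) / h)
      * (e t - (α + γ * ((t : ℝ) / T - u)))| ≤ 3 * b ^ 2 * (T * h) * q := by
    refine (Finset.abs_sum_le_sum_abs _ _).trans ?_
    refine (sum_Icc_le_of_time_support (u := u) (ρ := b * h) (K := b * q) hT (by positivity)
      (by positivity) (fun t ht => ?_) fun t _ hlt => by rw [hK0 t hlt, zero_mul, abs_zero]).trans ?_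
    · rcases le_or_gt |u - (t : ℝ) / T| (b * h) with hle | hlt
      · rw [abs_mul]
        exact mul_le_mul (hK.bound _) (he t ht hle) (abs_nonneg _) (by linarith)
      · rw [hK0 t hlt]; simp; positivity
    · have h2 : 2 * (b * h * T) + 1 ≤ 3 * b * (T * h) := by nlinarith
      calc _ ≤ 3 * b * (T * h) * (b * q) := mul_le_mul_of_nonneg_right h2 (by positivity)
        _ = _ := by ring
  have h2 : |α * (∑ t ∈ Finset.Icc 1 T, K ((u - (t : ℝ) / T) / h) - T * h)| ≤ 5 * b ^ 2 * |α| := by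
    rw [abs_mul, mul_comm]
    exact mul_le_mul_of_nonneg_right (hK.abs_sum_time_sub_le hT hh hTh hu0 hu1) (abs_nonneg _)
  have h3 : |γ * ∑ t ∈ Finset.Icc 1 T, K ((u - (t : ℝ) / T) / h) * ((t : ℝ) / T - u)|
      ≤ 10 * b ^ 3 * h * |γ| := by
    rw [abs_mul, mul_comm]
    exact mul_le_mul_of_nonneg_right (hK.abs_sum_time_mul_le hT hh hTh hu0 hu1) (abs_nonneg _)
  have h4 : ∑ t ∈ Finset.Icc 1 T, K ((u - (t : ℝ) / T) / h) * e t - α * (T * h)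
      = ∑ t ∈ Finset.Icc 1 T, K ((u - (t : ℝ) / T) / h) * (e t - (α + γ * ((t : ℝ) / T - u)))
        + α * (∑ t ∈ Finset.Icc 1 T, K ((u - (t : ℝ) / T) / h) - T * h)
        + γ * ∑ t ∈ Finset.Icc 1 T, K ((u - (t : ℝ) / T) / h) * ((t : ℝ) / T - u) := by
    rw [mul_sub, Finset.mul_sum, Finset.mul_sum, ← sub_eq_zero]
    have : ∀ t : ℕ, K ((u - (t : ℝ) / T) / h) * e t
        = K ((u - (t : ℝ) / T) / h) * (e t - (α + γ * ((t : ℝ) / T - u)))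
          + α * K ((u - (t : ℝ) / T) / h)
          + γ * (K ((u - (t : ℝ) / T) / h) * ((t : ℝ) / T - u)) := fun t => by ring
    rw [Finset.sum_congr rfl fun t _ => this t, Finset.sum_add_distrib, Finset.sum_add_distrib]
    ring
  rw [h4]
  exact (abs_add_three _ _ _).trans (add_le_add (add_le_add h1 h2) h3)

end

section

variable {Ω : Type*} {mΩ : MeasurableSpace Ω} {P : Measure Ω} {d : ℕ} {K : ℝ → ℝ} {C₁ b : ℝ}
  {X : ℕ → ℕ → Ω → (Fin d → ℝ)} {Xs : ℝ → ℤ → Ω → (Fin d → ℝ)} {f m : ℝ → (Fin d → ℝ) → ℝ} {ρ : ℝ}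

theorem exists_abs_bound_of_lipschitz {f : ℝ → (Fin d → ℝ) → ℝ} {r L : ℝ} (hr : 0 ≤ r) (hL : 0 ≤ L)
    (hf : ∀ u ∈ Icc (0 : ℝ) 1, ∀ v ∈ Icc (0 : ℝ) 1, ∀ x y : Fin d → ℝ, ‖x‖ ≤ r → ‖y‖ ≤ r →
      |f v y - f u x| ≤ L * (|v - u| + ‖y - x‖)) :
    ∃ C, 0 ≤ C ∧ ∀ u ∈ Icc (0 : ℝ) 1, ∀ x : Fin d → ℝ, ‖x‖ ≤ r → |f u x| ≤ C := by
  refine ⟨|f 0 0| + L * (1 + r), by positivity, fun u hu x hx => ?_⟩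
  have h1 := hf 0 ⟨le_rfl, zero_le_one⟩ u hu 0 x (by simpa using hr) hx
  rw [sub_zero, sub_zero, abs_of_nonneg hu.1] at h1
  have h2 : L * (u + ‖x‖) ≤ L * (1 + r) := mul_le_mul_of_nonneg_left (add_le_add hu.2 hx) hL
  have h3 : |f u x| ≤ |f u x - f 0 0| + |f 0 0| := by
    simpa using abs_add_le (f u x - f 0 0) (f 0 0)
  linarith

/-- Uniform approximation of the expected denominator and of the smoothing bias of the
Nadaraya–Watson estimator. -/
theorem exists_bias_le [IsProbabilityMeasure P]
    (hX : ∀ t T : ℕ, 1 ≤ t → t ≤ T → Measurable (X t T)) (hloc : LocallyStationary P X Xs f ρ)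
    (hft : SmoothInTime f) (hfx : SmoothInSpace f)
    (hm : ContDiffOn ℝ 2 (fun p : ℝ × (Fin d → ℝ) => m p.1 p.2) (Icc 0 1 ×ˢ univ))
    (hmm : ∀ v ∈ Icc (0 : ℝ) 1, Measurable (m v))
    (hK : IsBoundedKernel K C₁ b) {r : ℝ} (hr : 0 ≤ r) :
    ∃ Q : ℝ, 0 < Q ∧ ∀ (T : ℕ) (h : ℝ), 1 ≤ T → 0 < h → b * h ≤ 1 → 1 ≤ T * h →
      ∀ u ∈ Icc (C₁ * h) (1 - C₁ * h), ∀ x : Fin d → ℝ, ‖x‖ ≤ r →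
      |∑ t ∈ Finset.Icc 1 T, ∫ ω, weight K X h u x t T ω ∂P - f u x * (T * h ^ (d + 1))|
        ≤ Q * (1 / ((T : ℝ) ^ min ρ 1 * h ^ ((d : ℝ) + min ρ 1)) + h) * (T * h ^ (d + 1)) ∧
      |∑ t ∈ Finset.Icc 1 T, ∫ ω, weight K X h u x t T ω * (m ((t : ℝ) / T) (X t T ω) - m u x) ∂P|
        ≤ Q * (1 / ((T : ℝ) ^ min ρ 1 * h ^ d) + h ^ 2) * (T * h ^ (d + 1)) := by
  have hb := hK.one_le
  have hρ := hloc.2.1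
  obtain ⟨L₁, hL₁, hf⟩ := exists_lipschitz_of_smooth hft hfx (r + 1)
  obtain ⟨L₂, hL₂, hfb⟩ := exists_abs_bound_of_lipschitz (by linarith) hL₁ hf
  obtain ⟨L₃, hL₃, -, hmL, hmT⟩ := exists_taylor_of_contDiffOn hm (r + 1)
  set L := L₁ + L₂ + L₃ with hLdef
  have hL : 0 ≤ L := by positivity
  have hf' : ∀ u ∈ Icc (0 : ℝ) 1, ∀ v ∈ Icc (0 : ℝ) 1, ∀ x y : Fin d → ℝ, ‖x‖ ≤ r + 1 →
      ‖y‖ ≤ r + 1 → |f v y - f u x| ≤ L * (|v - u| + ‖y - x‖) := fun u hu v hv x y hx hy =>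
    (hf u hu v hv x y hx hy).trans (mul_le_mul_of_nonneg_right (by linarith) (by positivity))
  have hfb' : ∀ u ∈ Icc (0 : ℝ) 1, ∀ x : Fin d → ℝ, ‖x‖ ≤ r → |f u x| ≤ L := fun u hu x hx =>
    (hfb u hu x (by linarith)).trans (by linarith)
  have hmL' : ∀ u ∈ Icc (0 : ℝ) 1, ∀ v ∈ Icc (0 : ℝ) 1, ∀ x y : Fin d → ℝ, ‖x‖ ≤ r + 1 →
      ‖y‖ ≤ r + 1 → |m v y - m u x| ≤ L * max |v - u| ‖y - x‖ := fun u hu v hv x y hx hy =>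
    (hmL u hu v hv x y hx hy).trans
      (mul_le_mul_of_nonneg_right (by linarith) (le_max_of_le_left (abs_nonneg _)))
  obtain ⟨Q₁, hQ₁, h1⟩ := exists_expectation_scaled_sub_le hX hloc hK hL hf'
  obtain ⟨Q₂, hQ₂, h2⟩ := exists_expectation_scaled_increment_le hX hloc hK hL hf' hfb' hmm hmL'
  set r' := min ρ 1 with hr'
  have hr0 : 0 < r' := lt_min hρ one_pos
  have hr1 : r' ≤ 1 := min_le_right _ _
  refine ⟨3 * b ^ 2 * (Q₁ + Q₂) + 5 * b ^ 2 * L + 10 * b ^ 3 * L ^ 2 + 1, by positivity,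
    fun T h hT hh hbh hTh u hu x hx => ?_⟩
  have hT0 : (0 : ℝ) < T := by exact_mod_cast hT
  have hC₁ := mul_pos hK.radius_pos hh
  have hu' : u ∈ Icc (0 : ℝ) 1 := ⟨by linarith [hu.1], by linarith [hu.2]⟩
  have hh1 : h ≤ 1 := by nlinarith
  have hTr : (0 : ℝ) < (T : ℝ) ^ r' := by positivity
  have hTr1 : (T : ℝ) ^ r' ≤ T := by
    simpa using Real.rpow_le_rpow_of_exponent_le (by exact_mod_cast hT : (1 : ℝ) ≤ T) hr1
  have hhd : h ^ d ≤ 1 := pow_le_one₀ hh.le hh1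
  have hhd0 : 0 < h ^ d := by positivity
  constructor
  · have h3 := hK.abs_sum_time_affine_le (α := f u x * h ^ d) (γ := 0)
      (e := fun t => ∫ ω, spaceKernel K (fun j => (x j - X t T ω j) / h) ∂P)
      (q := Q₁ * (1 / ((T : ℝ) ^ r' * h ^ r') + h ^ (d + 1))) hT hh hTh hu.1 hu.2 (by positivity)
      fun t ht hut => by
        rw [zero_mul, add_zero]
        exact h1 t T (Finset.mem_Icc.1 ht).1 (Finset.mem_Icc.1 ht).2 h hh hbh u hu' x hx hut
    have e : ∀ t, ∫ ω, weight K X h u x t T ω ∂P = K ((u - (t : ℝ) / T) / h)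
        * ∫ ω, spaceKernel K (fun j => (x j - X t T ω j) / h) ∂P := fun t => by
      rw [← integral_const_mul]; rfl
    simp_rw [e]
    rw [show f u x * (T * h ^ (d + 1)) = f u x * h ^ d * (T * h) by ring]
    refine h3.trans ?_
    have hp : h ^ ((d : ℝ) + r') = h ^ d * h ^ r' := by
      rw [Real.rpow_add hh, Real.rpow_natCast]
    rw [hp]
    set p := 1 / ((T : ℝ) ^ r' * h ^ r') with hpdef
    have hp0 : 0 < p := by positivity
    -- As T h ≥ 1 and r ≤ 1, (T h)^r ≤ T h. The O(1) error of the Riemann sum is thereby absorbed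
    -- into the stationarity error.
    have hp1 : 1 ≤ p * (T * h) := by
      have h4 : (T * h) ^ r' ≤ T * h := by
        simpa using Real.rpow_le_rpow_of_exponent_le hTh hr1
      rw [Real.mul_rpow hT0.le hh.le] at h4
      rw [hpdef, one_div, inv_mul_eq_div, one_le_div (by positivity)]
      exact h4
    have e2 : 1 / ((T : ℝ) ^ r' * (h ^ d * h ^ r')) * (T * h ^ (d + 1)) = p * (T * h) := by
      rw [hpdef]; field_simp; ring
    have hα : |f u x * h ^ d| ≤ L := by
      rw [abs_mul, abs_of_pos hhd0]
      calc _ ≤ L * 1 := mul_le_mul (hfb' u hu' x hx) hhd hhd0.le hL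
        _ = L := mul_one L
    rw [abs_zero, mul_zero, add_zero, mul_assoc _ (_ + h) _, add_mul _ h _, e2]
    have hs0 : 0 ≤ h * (T * h ^ (d + 1)) := by positivity
    have e3 : 3 * b ^ 2 * (T * h) * (Q₁ * (p + h ^ (d + 1)))
        = 3 * b ^ 2 * Q₁ * (p * (T * h) + h * (T * h ^ (d + 1))) := by ring
    rw [e3]
    set s := p * (T * h) + h * (T * h ^ (d + 1)) with hs
    have hs1 : 1 ≤ s := by linarith
    have h5 : 5 * b ^ 2 * |f u x * h ^ d| ≤ 5 * b ^ 2 * L * s :=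
      calc _ ≤ 5 * b ^ 2 * L * 1 := by
            rw [mul_one]; exact mul_le_mul_of_nonneg_left hα (by positivity)
        _ ≤ _ := mul_le_mul_of_nonneg_left hs1 (by positivity)
    have h6 : 0 ≤ (3 * b ^ 2 * Q₂ + 10 * b ^ 3 * L ^ 2 + 1) * s := by positivity
    linarith
  · obtain ⟨ℓ₁, ℓ₂, hℓ₁, hℓ⟩ := hmT u hu' x (by linarith)
    have h3 := hK.abs_sum_time_affine_le (α := 0) (γ := f u x * h ^ d * ℓ₁)
      (e := fun t => ∫ ω, spaceKernel K (fun j => (x j - X t T ω j) / h)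
        * (m ((t : ℝ) / T) (X t T ω) - m u x) ∂P)
      (q := Q₂ * (1 / (T : ℝ) ^ r' + h ^ (d + 2))) hT hh hTh hu.1 hu.2 (by positivity)
      fun t ht hut => by
        have := h2 t T (Finset.mem_Icc.1 ht).1 (Finset.mem_Icc.1 ht).2 h hh hbh u hu' x hx hut
          ℓ₁ ℓ₂ fun v hv y hy => (hℓ v hv y hy).trans
            (mul_le_mul_of_nonneg_right (by linarith) (by positivity))
        rwa [show 0 + f u x * h ^ d * ℓ₁ * ((t : ℝ) / T - u)
          = f u x * h ^ d * (((t : ℝ) / T - u) * ℓ₁) by ring]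
    have e : ∀ t, ∫ ω, weight K X h u x t T ω * (m ((t : ℝ) / T) (X t T ω) - m u x) ∂P
        = K ((u - (t : ℝ) / T) / h) * ∫ ω, spaceKernel K (fun j => (x j - X t T ω j) / h)
          * (m ((t : ℝ) / T) (X t T ω) - m u x) ∂P := fun t => by
      rw [← integral_const_mul]
      refine integral_congr_ae (ae_of_all _ fun ω => ?_)
      exact mul_assoc _ _ _
    simp_rw [e]
    rw [zero_mul, sub_zero] at h3
    refine h3.trans ?_
    rw [abs_zero, mul_zero, add_zero]
    have hγ : |f u x * h ^ d * ℓ₁| ≤ L ^ 2 * h ^ d := by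
      rw [abs_mul, abs_mul, abs_of_pos hhd0]
      calc _ ≤ L * h ^ d * L := mul_le_mul (mul_le_mul_of_nonneg_right (hfb' u hu' x hx) hhd0.le)
            (hℓ₁.trans (by linarith)) (abs_nonneg _) (by positivity)
        _ = _ := by ring
    set p := 1 / (T : ℝ) ^ r' with hpdef
    have hp0 : 0 < p := by positivity
    -- From T^r ≤ T; the O(h) error of the linear term in time is absorbed into p T h.
    have hpT : 1 ≤ p * T := by
      rw [hpdef, one_div, inv_mul_eq_div, one_le_div hTr]; exact hTr1
    have e2 : (1 / ((T : ℝ) ^ r' * h ^ d) + h ^ 2) * (T * h ^ (d + 1))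
        = p * (T * h) + T * h * h ^ (d + 2) := by
      rw [hpdef]; field_simp; ring
    rw [mul_assoc _ (_ + h ^ 2) _, e2]
    have e3 : 3 * b ^ 2 * (T * h) * (Q₂ * (p + h ^ (d + 2)))
        = 3 * b ^ 2 * Q₂ * (p * (T * h) + T * h * h ^ (d + 2)) := by ring
    rw [e3]
    set s := p * (T * h) + T * h * h ^ (d + 2) with hs
    have hs1 : h ≤ s := by
      have : 0 ≤ T * h * h ^ (d + 2) := by positivity
      nlinarith
    have h5 : 10 * b ^ 3 * h * |f u x * h ^ d * ℓ₁| ≤ 10 * b ^ 3 * L ^ 2 * s :=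
      calc _ ≤ 10 * b ^ 3 * h * L ^ 2 := by
            refine mul_le_mul_of_nonneg_left (hγ.trans ?_) (by positivity)
            exact mul_le_of_le_one_right (by positivity) hhd
        _ = 10 * b ^ 3 * L ^ 2 * h := by ring
        _ ≤ _ := mul_le_mul_of_nonneg_left hs1 (by positivity)
    have hs0 : 0 ≤ s := by linarith
    have h6 : 0 ≤ (3 * b ^ 2 * Q₁ + 5 * b ^ 2 * L + 1) * s := by positivity
    linarith

end

/-! ### The Nadaraya–Watson estimator -/

section

variable {Ω : Type*} {mΩ : MeasurableSpace Ω} {P : Measure Ω} {d : ℕ}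

theorem integral_comp_mul_eq_zero [IsProbabilityMeasure P] {E : Type*} [MeasurableSpace E]
    {Z : Ω → E} (hZ : Measurable Z) {e : Ω → ℝ} (he : Integrable e P)
    (hce : P[e | MeasurableSpace.comap Z inferInstance] =ᵐ[P] 0) {φ : E → ℝ} (hφ : Measurable φ)
    {c : ℝ} (hc : ∀ z, |φ z| ≤ c) : ∫ ω, φ (Z ω) * e ω ∂P = 0 := by
  have hle : MeasurableSpace.comap Z inferInstance ≤ mΩ := hZ.comap_le
  have hm : Measurable[MeasurableSpace.comap Z inferInstance] fun ω => φ (Z ω) :=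
    hφ.comp (comap_measurable Z)
  have hint : Integrable ((fun ω => φ (Z ω)) * e) P :=
    he.bdd_mul (hφ.comp hZ).aestronglyMeasurable (ae_of_all _ fun ω => hc (Z ω))
  have h1 := condExp_mul_of_stronglyMeasurable_left (μ := P) hm.stronglyMeasurable hint he
  have h2 : ∫ ω, ((fun ω => φ (Z ω)) * e) ω ∂P = 0 := by
    rw [← integral_condExp hle, integral_congr_ae h1]
    have : (fun ω => φ (Z ω)) * P[e | MeasurableSpace.comap Z inferInstance] =ᵐ[P] 0 := by
      filter_upwards [hce] with ω hω
      simp [hω]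
    rw [integral_congr_ae this]
    simp
  exact h2

theorem sum_locTerm_eq_deviation_add (P : Measure Ω) (G : ℝ → (Fin d → ℝ) → ℝ) (g : ℝ → ℝ)
    (X : ℕ → ℕ → Ω → (Fin d → ℝ)) (W : ℕ → ℕ → Ω → ℝ) (h u : ℝ) (x : Fin d → ℝ) (T : ℕ) (ω : Ω) :
    ∑ t ∈ Finset.Icc 1 T, locTerm G g X W h u x T t ω = deviation P G g X W h u x T ω
      + ∑ t ∈ Finset.Icc 1 T, ∫ ω', locTerm G g X W h u x T t ω' ∂P := by
  rw [deviation, Finset.sum_sub_distrib]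
  ring

/-- The regression function along the design, cut off outside of a ball. -/
def localizedSignal (m : ℝ → (Fin d → ℝ) → ℝ) (r : ℝ) (X : ℕ → ℕ → Ω → (Fin d → ℝ))
    (t T : ℕ) (ω : Ω) : ℝ :=
  (Metric.closedBall 0 r).indicator (m ((t : ℝ) / T)) (X t T ω)

variable {K : ℝ → ℝ} {C₁ b : ℝ} {X : ℕ → ℕ → Ω → (Fin d → ℝ)} {Y ε : ℕ → ℕ → Ω → ℝ}
  {m : ℝ → (Fin d → ℝ) → ℝ} {s : ℝ}

/-- The weight vanishes unless ‖X - x‖ ≤ b h ≤ 1, so the cut-off at radius `r + 1` is invisible to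
it. -/
theorem IsBoundedKernel.weight_mul_localizedSignal (hK : IsBoundedKernel K C₁ b) {r h u : ℝ}
    {x : Fin d → ℝ} (hh : 0 < h) (hbh : b * h ≤ 1) (hx : ‖x‖ ≤ r) (t T : ℕ) (ω : Ω) :
    weight K X h u x t T ω * localizedSignal m (r + 1) X t T ω
      = weight K X h u x t T ω * m ((t : ℝ) / T) (X t T ω) := by
  rcases le_or_gt (‖X t T ω - x‖) (b * h) with hle | hlt
  · rw [localizedSignal, indicator_of_mem]
    rw [mem_closedBall_zero_iff]
    have : ‖X t T ω‖ ≤ ‖X t T ω - x‖ + ‖x‖ := by simpa using norm_add_le (X t T ω - x) x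
    linarith
  · rw [weight_eq_locWeight, hK.isLocKernel.locWeight_eq_zero_of_space hh hlt, zero_mul, zero_mul]

/-- Decomposition of the numerator of the estimation error into stochastic parts and bias. -/
theorem sum_weight_mul_sub_eq [IsProbabilityMeasure P] (hmodel : IsModel P X Y ε m)
    (hK : IsBoundedKernel K C₁ b) (hs : 1 ≤ s) (hone : LocalBounds P X (fun _ _ _ => 1) s) {r : ℝ}
    (hsig : LocalBounds P X (localizedSignal m (r + 1) X) s) {h u : ℝ} {x : Fin d → ℝ} {T : ℕ}
    (hh : 0 < h) (hbh : b * h ≤ 1) (hx : ‖x‖ ≤ r) {ω : Ω}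
    (hω : ∀ t ∈ Finset.Icc 1 T, Y t T ω = m ((t : ℝ) / T) (X t T ω) + ε t T ω) :
    ∑ t ∈ Finset.Icc 1 T, weight K X h u x t T ω * (Y t T ω - m u x)
      = deviation P (prodKernel K) id X ε h u x T ω
        + (deviation P (prodKernel K) id X (localizedSignal m (r + 1) X) h u x T ω
          - m u x * deviation P (prodKernel K) id X (fun _ _ _ => 1) h u x T ω)
        + ∑ t ∈ Finset.Icc 1 T,
          ∫ ω', weight K X h u x t T ω' * (m ((t : ℝ) / T) (X t T ω') - m u x) ∂P := by
  have hb := hK.one_le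
  have hG := hK.isLocKernel (d := d)
  have hB0 : 0 ≤ b ^ (d + 1) := by positivity
  have h1 : ∑ t ∈ Finset.Icc 1 T, weight K X h u x t T ω * ε t T ω
      = deviation P (prodKernel K) id X ε h u x T ω := by
    refine Finset.sum_congr rfl fun t ht => ?_
    obtain ⟨hX, -, -, hε, hce⟩ := hmodel t T (Finset.mem_Icc.1 ht).1 (Finset.mem_Icc.1 ht).2
    have : ∫ ω', locTerm (prodKernel K) id X ε h u x T t ω' ∂P = 0 :=
      integral_comp_mul_eq_zero hX hε hce
        (φ := fun y => prodKernel K ((u - (t : ℝ) / T) / h) fun j => (x j - y j) / h)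
        ((hG.meas _).comp (measurable_spaceArg x h)) fun y => hG.bound _ _
    rw [this, sub_zero]
    rfl
  have h2 : ∀ ω', ∑ t ∈ Finset.Icc 1 T, weight K X h u x t T ω' * m ((t : ℝ) / T) (X t T ω')
      = ∑ t ∈ Finset.Icc 1 T,
        locTerm (prodKernel K) id X (localizedSignal m (r + 1) X) h u x T t ω' := fun ω' =>
    Finset.sum_congr rfl fun t _ => (hK.weight_mul_localizedSignal hh hbh hx t T ω').symm
  have h3 : ∑ t ∈ Finset.Icc 1 T, weight K X h u x t T ω
      = ∑ t ∈ Finset.Icc 1 T, locTerm (prodKernel K) id X (fun _ _ _ => 1) h u x T t ω :=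
    Finset.sum_congr rfl fun t _ => (mul_one _).symm
  have h4 : ∑ t ∈ Finset.Icc 1 T,
      ∫ ω', weight K X h u x t T ω' * (m ((t : ℝ) / T) (X t T ω') - m u x) ∂P
      = ∑ t ∈ Finset.Icc 1 T,
          ∫ ω', locTerm (prodKernel K) id X (localizedSignal m (r + 1) X) h u x T t ω' ∂P
        - m u x * ∑ t ∈ Finset.Icc 1 T,
          ∫ ω', locTerm (prodKernel K) id X (fun _ _ _ => 1) h u x T t ω' ∂P := by
    rw [Finset.mul_sum, ← Finset.sum_sub_distrib]
    refine Finset.sum_congr rfl fun t ht => ?_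
    obtain ⟨ht1, htT⟩ := Finset.mem_Icc.1 ht
    have hi1 := hsig.integrable_locTerm hG measurable_id (fun _ => le_rfl) hB0 hs ht1 htT (h := h)
      (u := u) (x := x)
    have hi2 := hone.integrable_locTerm hG measurable_id (fun _ => le_rfl) hB0 hs ht1 htT (h := h)
      (u := u) (x := x)
    rw [← integral_const_mul, ← integral_sub hi1 (hi2.const_mul _)]
    refine integral_congr_ae (ae_of_all _ fun ω' => ?_)
    have h5 := hK.weight_mul_localizedSignal (m := m) (X := X) (u := u) hh hbh hx t T ω'
    simp only [locTerm, id_eq, ← weight_eq_locWeight, mul_one]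
    rw [h5]
    ring
  have h5 : ∑ t ∈ Finset.Icc 1 T, weight K X h u x t T ω * (Y t T ω - m u x)
      = ∑ t ∈ Finset.Icc 1 T, weight K X h u x t T ω * ε t T ω
        + ∑ t ∈ Finset.Icc 1 T, weight K X h u x t T ω * m ((t : ℝ) / T) (X t T ω)
        - m u x * ∑ t ∈ Finset.Icc 1 T, weight K X h u x t T ω := by
    rw [Finset.mul_sum, ← Finset.sum_add_distrib, ← Finset.sum_sub_distrib]
    refine Finset.sum_congr rfl fun t ht => ?_
    rw [hω t ht]
    ring
  rw [h5, h1, h2, h3, h4, sum_locTerm_eq_deviation_add P, sum_locTerm_eq_deviation_add P]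
  ring

theorem localBounds_localizedSignal [IsProbabilityMeasure P] (hs : 0 < s)
    (hone : LocalBounds P X (fun _ _ _ => 1) s) (hmm : ∀ v ∈ Icc (0 : ℝ) 1, Measurable (m v))
    {r L : ℝ} (hm : ∀ u ∈ Icc (0 : ℝ) 1, ∀ x : Fin d → ℝ, ‖x‖ ≤ r → |m u x| ≤ L) :
    LocalBounds P X (localizedSignal m r X) s := by
  have hu : ∀ t T : ℕ, 1 ≤ t → t ≤ T → (t : ℝ) / T ∈ Icc (0 : ℝ) 1 := fun t T ht htT => by
    have hT : (0 : ℝ) < T := by exact_mod_cast (by omega : 0 < T)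
    exact ⟨by positivity, by rw [div_le_one hT]; exact_mod_cast htT⟩
  refine LocalBounds.of_bounded hs hone (fun t T ht htT => ?_) (b := max 1 L)
    (fun t T ht htT ω => ?_) (le_max_left _ _)
  · exact ((hmm _ (hu t T ht htT)).indicator measurableSet_closedBall).comp (hone.measX t T ht htT)
  · rw [localizedSignal]
    by_cases hmem : X t T ω ∈ Metric.closedBall 0 r
    · rw [indicator_of_mem hmem]
      exact (hm _ (hu t T ht htT) _ (mem_closedBall_zero_iff.1 hmem)).trans (le_max_right _ _)
    · rw [indicator_of_notMem hmem, abs_zero]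
      positivity

/-- The signal is a measurable function of X, so mixing of the pair (X, 1) is enough. -/
theorem alphaMix_localizedSignal_le (hmm : ∀ v ∈ Icc (0 : ℝ) 1, Measurable (m v)) (r : ℝ) (k : ℕ) :
    alphaMix P (fun t T ω => (X t T ω, localizedSignal m r X t T ω)) k
      ≤ alphaMix P (fun t T ω => (X t T ω, (1 : ℝ))) k := by
  refine alphaMix_mono (fun t T ht htT => ?_) k
  have hT : (0 : ℝ) < T := by exact_mod_cast (by omega : 0 < T)
  have hu : (t : ℝ) / T ∈ Icc (0 : ℝ) 1 :=
    ⟨by positivity, by rw [div_le_one hT]; exact_mod_cast htT⟩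
  have hX : Measurable[MeasurableSpace.comap (fun ω => (X t T ω, (1 : ℝ))) inferInstance]
      (X t T) := measurable_fst.comp (comap_measurable fun ω => (X t T ω, (1 : ℝ)))
  exact Measurable.comap_le
    (hX.prodMk (((hmm _ hu).indicator measurableSet_closedBall).comp hX))

theorem abs_div_sub_le {N D S c A μ : ℝ} (hS : 0 < S) (hc : 0 < c) (hD : c * S ≤ D)
    (hN : |N - μ * D| ≤ A * S) : |N / D - μ| ≤ c⁻¹ * A := by
  have hcS : 0 < c * S := mul_pos hc hS
  have hD0 : 0 < D := hcS.trans_le hD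
  have e : N / D - μ = (N - μ * D) / D := by field_simp
  rw [e, abs_div, abs_of_pos hD0, div_le_iff₀ hD0]
  have hA : 0 ≤ A := nonneg_of_mul_nonneg_left ((abs_nonneg _).trans hN) hS
  calc _ ≤ A * S := hN
    _ = c⁻¹ * A * (c * S) := by field_simp
    _ ≤ _ := mul_le_mul_of_nonneg_left hD (by positivity)

end

/-! ### Assembly of the rate. -/

section

variable {Ω : Type*} {mΩ : MeasurableSpace Ω} {P : Measure Ω} {d : ℕ}

theorem measure_le_of_subset_union_three {E E₁ E₂ E₃ N : Set Ω} {δ : ℝ} (hδ : 0 < δ)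
    (hsub : E ⊆ N ∪ (E₁ ∪ E₂ ∪ E₃)) (hN : P N = 0) (h₁ : P E₁ ≤ ENNReal.ofReal (δ / 3))
    (h₂ : P E₂ ≤ ENNReal.ofReal (δ / 3)) (h₃ : P E₃ ≤ ENNReal.ofReal (δ / 3)) :
    P E ≤ ENNReal.ofReal δ :=
  calc P E ≤ P N + (P E₁ + P E₂ + P E₃) := (measure_mono hsub).trans ((measure_union_le _ _).trans
        (add_le_add le_rfl ((measure_union_le _ _).trans
          (add_le_add (measure_union_le _ _) le_rfl))))
    _ ≤ 0 + (ENNReal.ofReal (δ / 3) + ENNReal.ofReal (δ / 3) + ENNReal.ofReal (δ / 3)) :=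
        add_le_add hN.le (add_le_add (add_le_add h₁ h₂) h₃)
    _ = ENNReal.ofReal δ := by
        rw [zero_add, ← ENNReal.ofReal_add (by positivity) (by positivity),
          ← ENNReal.ofReal_add (by positivity) (by positivity)]
        congr 1; ring

theorem tendsto_zero_of_le_const_mul_rpow {h : ℕ → ℝ} (hpos : ∀ T : ℕ, 1 ≤ T → 0 < h T)
    {ξ C : ℝ} (hξ : 0 < ξ) (hC : ∀ T : ℕ, 1 ≤ T → h T ≤ C * (T : ℝ) ^ (-ξ)) :
    Tendsto h atTop (𝓝 0) := by
  have h1 : Tendsto (fun T : ℕ => C * (T : ℝ) ^ (-ξ)) atTop (𝓝 0) := by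
    simpa using ((tendsto_rpow_neg_atTop hξ).comp tendsto_natCast_atTop_atTop).const_mul C
  refine squeeze_zero' ?_ ?_ h1
  · filter_upwards [eventually_ge_atTop 1] with T hT using (hpos T hT).le
  · filter_upwards [eventually_ge_atTop 1] with T hT using hC T hT

variable {X : ℕ → ℕ → Ω → (Fin d → ℝ)} {W : ℕ → ℕ → Ω → ℝ}

theorem MixingCond.exists_pos_bound {s β : ℝ} (h : MixingCond P X W s β) :
    ∃ A : ℝ, 0 < A ∧ ∀ k : ℕ, 1 ≤ k →
      alphaMix P (fun t T ω => (X t T ω, W t T ω)) k ≤ ENNReal.ofReal (A * (k : ℝ) ^ (-β)) := by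
  obtain ⟨-, ⟨A, hA⟩, -⟩ := h
  refine ⟨max A 1, by positivity, fun k hk => (hA k hk).trans (ENNReal.ofReal_le_ofReal ?_)⟩
  exact mul_le_mul_of_nonneg_right (le_max_left _ _) (by positivity)

/-- Uniform rate of the Nadaraya–Watson estimator, on the region away from the boundary. -/
theorem isBigOInProb_nadarayaWatson [IsProbabilityMeasure P] {Y ε : ℕ → ℕ → Ω → ℝ}
    {m f : ℝ → (Fin d → ℝ) → ℝ} (hmodel : IsModel P X Y ε m) {Xs : ℝ → ℤ → Ω → (Fin d → ℝ)} {ρ : ℝ}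
    (hloc : LocallyStationary P X Xs f ρ) (hft : SmoothInTime f) (hfx : SmoothInSpace f)
    (hm : ContDiffOn ℝ 2 (fun p : ℝ × (Fin d → ℝ) => m p.1 p.2) (Icc 0 1 ×ˢ univ))
    {K : ℝ → ℝ} {C₁ s β : ℝ} (hK : IsKernel K C₁)
    (hmom_one : MomentCond P (fun _ _ (_ : Ω) => (1 : ℝ)) s)
    (hmix_one : MixingCond P X (fun _ _ (_ : Ω) => (1 : ℝ)) s β)
    (hdens_one : DensityCond P X (fun _ _ (_ : Ω) => (1 : ℝ)) s)
    (hmom_err : MomentCond P ε s) (hmix_err : MixingCond P X ε s β)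
    (hdens_err : DensityCond P X ε s)
    (hβ : (2 + s * (1 + ((d : ℝ) + 1))) / (s - 2) < β) {S : Set (Fin d → ℝ)} (hS : IsCompact S)
    {c : ℝ} (hc : 0 < c) (hcf : ∀ u ∈ Icc (0 : ℝ) 1, ∀ x ∈ S, c ≤ f u x)
    {h : ℕ → ℝ} (hpos : ∀ T : ℕ, 1 ≤ T → 0 < h T) (hzero : Tendsto h atTop (𝓝 0))
    (hband₁ : Tendsto (fun T : ℕ => Real.log (Real.log T) * Real.log T /
      ((T : ℝ) ^ theta d s β * h T ^ (d + 1))) atTop (𝓝 0))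
    (hband₂ : Tendsto (fun T : ℕ => 1 / ((T : ℝ) ^ min ρ 1 * h T ^ ((d : ℝ) + min ρ 1)))
      atTop (𝓝 0)) :
    IsBigOInProb P
      (fun T ω => ⨆ u ∈ Icc (C₁ * h T) (1 - C₁ * h T), ⨆ x ∈ S,
        ENNReal.ofReal |nadarayaWatson K X Y (h T) T u x ω - m u x|)
      (fun T => Real.sqrt (Real.log T / (T * h T ^ (d + 1))) +
        1 / ((T : ℝ) ^ min ρ 1 * h T ^ d) + h T ^ 2) := by
  intro δ hδ
  have hs : 2 < s := hmom_one.1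
  have hβ₁ := hmix_one.2.2
  obtain ⟨b, hKb⟩ := hK.exists_isBoundedKernel
  have hb := hKb.one_le
  obtain ⟨r, hr1, hr⟩ : ∃ r : ℝ, 1 ≤ r ∧ ∀ x ∈ S, ‖x‖ ≤ r := by
    obtain ⟨r, hr⟩ := hS.isBounded.exists_norm_le
    exact ⟨max r 1, le_max_right _ _, fun x hx => (hr x hx).trans (le_max_left _ _)⟩
  have hX : ∀ t T : ℕ, 1 ≤ t → t ≤ T → Measurable (X t T) := fun t T ht htT =>
    (hmodel t T ht htT).1
  have hmm : ∀ v ∈ Icc (0 : ℝ) 1, Measurable (m v) := fun v hv => by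
    have h1 : ContinuousOn ((fun p : ℝ × (Fin d → ℝ) => m p.1 p.2) ∘ fun y => (v, y)) univ :=
      hm.continuousOn.comp (by fun_prop) fun y _ => ⟨hv, mem_univ _⟩
    exact (continuousOn_univ.1 h1).measurable
  obtain ⟨L, hL, hmL, -, -⟩ := exists_taylor_of_contDiffOn hm (r + 1)
  have hone := localBounds_of_densityCond hX (fun _ _ _ _ => measurable_const) hmom_one hdens_one
  have herr := localBounds_of_densityCond hX (fun t T ht htT => (hmodel t T ht htT).2.1)
    hmom_err hdens_err
  have hsig := localBounds_localizedSignal (by linarith) hone hmm hmL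
  obtain ⟨A, hA, hAmix⟩ := hmix_one.exists_pos_bound
  obtain ⟨A', hA', hAmix'⟩ := hmix_err.exists_pos_bound
  obtain ⟨Q, hQ, hbias⟩ := exists_bias_le hX hloc hft hfx hm hmm hKb (by linarith : 0 ≤ r)
  have hδ3 : 0 < δ / 3 := by positivity
  have hrate : ∀ (V : ℕ → ℕ → Ω → ℝ) (A : ℝ), LocalBounds P X V s → 0 < A →
      (∀ k : ℕ, 1 ≤ k → alphaMix P (fun t T ω => (X t T ω, V t T ω)) k
        ≤ ENNReal.ofReal (A * (k : ℝ) ^ (-β))) →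
      ∃ M : ℝ, 0 < M ∧ ∀ᶠ T : ℕ in atTop,
        P {ω | ∃ u ∈ Icc (0 : ℝ) 1, ∃ x : Fin d → ℝ, ‖x‖ ≤ r ∧
          M * (stochRate d (h T) T * (T * h T ^ (d + 1)))
            < |deviation P (prodKernel K) id X V (h T) u x T ω|} ≤ ENNReal.ofReal (δ / 3) :=
    fun V A hV hA hVmix => exists_uniform_rate hV hA hs hβ₁ hVmix hβ hpos hzero hband₁
      (one_le_pow₀ hb) hb hKb.isLocKernel hKb.abs_prodKernel_sub_le (by positivity) hr1 hδ3
  obtain ⟨M₁, hM₁, hev₁⟩ := hrate ε A' herr hA' hAmix'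
  obtain ⟨M₂, hM₂, hev₂⟩ := hrate (localizedSignal m (r + 1) X) A hsig hA fun k hk =>
    (alphaMix_localizedSignal_le hmm (r + 1) k).trans (hAmix k hk)
  obtain ⟨M₃, hM₃, hev₃⟩ := hrate (fun _ _ _ => 1) A hone hA hAmix
  have hw := tendsto_of_band hpos hband₁
  have hlog : Tendsto (fun T : ℕ => Real.log (T : ℝ)) atTop atTop :=
    Real.tendsto_log_atTop.comp tendsto_natCast_atTop_atTop
  -- Once a, the stationarity error and h are all below this value, the denominator differs from
  -- f(u,x) S by at most (c/2) S.
  have hκ : 0 < c / (2 * (M₃ + 2 * Q)) := by positivity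
  have hκ1 : 0 < min 1 ((c / (2 * (M₃ + 2 * Q))) ^ 2) := lt_min one_pos (by positivity)
  refine ⟨(c / 2)⁻¹ * (M₁ + M₂ + L * M₃ + Q), by positivity, ?_⟩
  filter_upwards [hev₁, hev₂, hev₃, eventually_ge_atTop 1, hlog.eventually_ge_atTop 1,
    hw.eventually (ge_mem_nhds hκ1), hband₂.eventually (ge_mem_nhds hκ),
    hzero.eventually (ge_mem_nhds hκ),
    hzero.eventually (ge_mem_nhds (by positivity : 0 < 1 / b))] with T h₁ h₂ h₃ hT hlogT hwT hpT
      hhT hhb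
  have hh := hpos T hT
  have hT0 : (0 : ℝ) < T := by exact_mod_cast hT
  have hbh : b * h T ≤ 1 := by
    rw [le_div_iff₀ (by linarith)] at hhb
    linarith
  have hh1 : h T ≤ 1 := by nlinarith
  obtain ⟨ha0, -, -, hTh, hTa, -, haw⟩ :=
    stochRate_facts hs hβ hT hh hh1 hlogT (hwT.trans (min_le_left _ _))
  set a := stochRate d (h T) T with ha
  have haκ : a ≤ c / (2 * (M₃ + 2 * Q)) := by
    have hT1 : (1 : ℝ) ≤ (T : ℝ) ^ (1 / s) :=
      Real.one_le_rpow (by exact_mod_cast hT) (by positivity)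
    have h1 : a ≤ (T : ℝ) ^ (1 / s) * a := le_mul_of_one_le_left ha0.le hT1
    refine h1.trans (abs_le_of_sq_le_sq' (haw.trans (hwT.trans (min_le_right _ _))) hκ.le).2
  have hS0 : 0 < T * h T ^ (d + 1) := by positivity
  have hnull : P {ω | ∀ t ∈ Finset.Icc 1 T, Y t T ω = m ((t : ℝ) / T) (X t T ω) + ε t T ω}ᶜ = 0 :=
    ae_iff.1 ((Finset.eventually_all _).2 fun t ht =>
      (hmodel t T (Finset.mem_Icc.1 ht).1 (Finset.mem_Icc.1 ht).2).2.2.1)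
  -- Outside the three exceptional events and the null set where the model equation fails, the bound
  -- holds deterministically for all (u, x); no measurability of the supremum is involved.
  refine measure_le_of_subset_union_three hδ (fun ω hω => ?_) hnull h₁ h₂ h₃
  by_contra hcon
  simp only [mem_union, not_or, mem_compl_iff, not_not] at hcon
  obtain ⟨hY, ⟨hn₁, hn₂⟩, hn₃⟩ := hcon
  have hn : ∀ {V : ℕ → ℕ → Ω → ℝ} {M : ℝ}, (ω ∉ {ω | ∃ u ∈ Icc (0 : ℝ) 1, ∃ x : Fin d → ℝ,
      ‖x‖ ≤ r ∧ M * (a * (T * h T ^ (d + 1)))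
        < |deviation P (prodKernel K) id X V (h T) u x T ω|}) → ∀ u ∈ Icc (0 : ℝ) 1,
      ∀ x ∈ S, |deviation P (prodKernel K) id X V (h T) u x T ω|
        ≤ M * (a * (T * h T ^ (d + 1))) := fun hn u hu x hx =>
    not_lt.1 fun hlt => hn ⟨u, hu, x, hr x hx, hlt⟩
  refine absurd hω (not_lt.2 (iSup₂_le fun u hu => iSup₂_le fun x hx =>
    ENNReal.ofReal_le_ofReal ?_))
  have hC₁ := mul_pos hKb.radius_pos hh
  have hu' : u ∈ Icc (0 : ℝ) 1 := ⟨by linarith [hu.1], by linarith [hu.2]⟩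
  obtain ⟨hb₁, hb₂⟩ := hbias T (h T) hT hh hbh hTh u hu x (hr x hx)
  have hd₁ := hn hn₁ u hu' x hx
  have hd₂ := hn hn₂ u hu' x hx
  have hd₃ := hn hn₃ u hu' x hx
  have hmu := hmL u hu' x ((hr x hx).trans (by linarith))
  have hdec := sum_weight_mul_sub_eq hmodel hKb (by linarith : 1 ≤ s) hone hsig (u := u) hh hbh
    (hr x hx) hY
  have hden := sum_locTerm_eq_deviation_add P (prodKernel K) id X (fun _ _ _ => 1) (h T) u x T ω
  simp only [locTerm, id_eq, mul_one, ← weight_eq_locWeight] at hden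
  rw [nadarayaWatson, mul_assoc]
  set U := (T : ℝ) * h T ^ (d + 1) with hU
  refine abs_div_sub_le hS0 (half_pos hc) ?_ ?_
  · have h4 : c * U ≤ f u x * U := mul_le_mul_of_nonneg_right (hcf u hu' x hx) hS0.le
    have h5 := (abs_le.1 hb₁).1
    have h6 := (abs_le.1 hd₃).1
    rw [hden]
    have h7 : (M₃ + 2 * Q) * (c / (2 * (M₃ + 2 * Q))) = c / 2 := by field_simp
    have h8 : M₃ * a + Q * (1 / ((T : ℝ) ^ min ρ 1 * h T ^ ((d : ℝ) + min ρ 1)) + h T) ≤ c / 2 := by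
      have := mul_le_mul_of_nonneg_left haκ hM₃.le
      have := mul_le_mul_of_nonneg_left hpT hQ.le
      have := mul_le_mul_of_nonneg_left hhT hQ.le
      linarith
    have h9 := mul_le_mul_of_nonneg_right h8 hS0.le
    linarith
  · have h4 : ∑ t ∈ Finset.Icc 1 T, weight K X (h T) u x t T ω * Y t T ω
        - m u x * ∑ t ∈ Finset.Icc 1 T, weight K X (h T) u x t T ω
        = ∑ t ∈ Finset.Icc 1 T, weight K X (h T) u x t T ω * (Y t T ω - m u x) := by
      rw [Finset.mul_sum, ← Finset.sum_sub_distrib]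
      exact Finset.sum_congr rfl fun t _ => by ring
    rw [h4, hdec]
    have h5 : |m u x * deviation P (prodKernel K) id X (fun _ _ _ => 1) (h T) u x T ω|
        ≤ L * (M₃ * (a * U)) := by
      rw [abs_mul]
      exact mul_le_mul hmu hd₃ (abs_nonneg _) hL
    refine (abs_add_three _ _ _).trans ((add_le_add (add_le_add hd₁
      ((abs_sub _ _).trans (add_le_add hd₂ h5))) hb₂).trans ?_)
    rw [← stochRate, ← ha]
    set q := 1 / ((T : ℝ) ^ min ρ 1 * h T ^ d) + h T ^ 2 with hq
    have hq0 : 0 ≤ q := by positivity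
    have h6 : 0 ≤ (M₁ + M₂ + L * M₃) * q * U := by positivity
    have h7 : 0 ≤ Q * a * U := by positivity
    rw [add_assoc a, ← hq]
    linarith

end

end LocStat

end

theorem theorem4p2 {Ω : Type*} [MeasurableSpace Ω] (P : Measure Ω) [IsProbabilityMeasure P]
    (d : ℕ) (hd : 1 ≤ d)
    -- the model
    (X : ℕ → ℕ → Ω → (Fin d → ℝ)) (Y ε : ℕ → ℕ → Ω → ℝ) (m : ℝ → (Fin d → ℝ) → ℝ)
    (hmodel : LocStat.IsModel P X Y ε m)
    -- local stationarity, with approximating processes `Xs` and their densities `f`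
    (Xs : ℝ → ℤ → Ω → (Fin d → ℝ)) (f : ℝ → (Fin d → ℝ) → ℝ) (ρ : ℝ)
    (hC1 : LocStat.LocallyStationary P X Xs f ρ)
    (hC2 : LocStat.SmoothInTime f)
    (hC3 : LocStat.IsAlphaMixing P (fun t T ω => (X t T ω, ε t T ω)))
    (hC4 : LocStat.SmoothInSpace f)
    (hC5 : ContDiffOn ℝ 2 (fun p : ℝ × (Fin d → ℝ) => m p.1 p.2) (Icc 0 1 ×ˢ univ))
    (K : ℝ → ℝ) (C₁ : ℝ) (hC6 : LocStat.IsKernel K C₁)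
    -- moment, mixing and density conditions, for `W = 1` and for `W = ε`
    (s β : ℝ)
    (hK0_one : LocStat.MomentCond P (fun _ _ (_ : Ω) => (1 : ℝ)) s)
    (hK1_one : LocStat.MixingCond P X (fun _ _ (_ : Ω) => (1 : ℝ)) s β)
    (hK2_one : LocStat.DensityCond P X (fun _ _ (_ : Ω) => (1 : ℝ)) s)
    (hK0_err : LocStat.MomentCond P ε s)
    (hK1_err : LocStat.MixingCond P X ε s β)
    (hK2_err : LocStat.DensityCond P X ε s)
    (hβ : (2 + s * (1 + ((d : ℝ) + 1))) / (s - 2) < β)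
    -- the compact set
    (S : Set (Fin d → ℝ)) (hS : IsCompact S)
    (hf : ∃ c : ℝ, 0 < c ∧ ∀ u ∈ Icc (0 : ℝ) 1, ∀ x ∈ S, c ≤ f u x)
    -- the bandwidth
    (h : ℕ → ℝ) (hpos : ∀ T : ℕ, 1 ≤ T → 0 < h T)
    (hpoly : ∃ ξ C : ℝ, 0 < ξ ∧ 0 < C ∧ ∀ T : ℕ, 1 ≤ T → h T ≤ C * (T : ℝ) ^ (-ξ))
    (hband₁ : Tendsto (fun T : ℕ => Real.log (Real.log T) * Real.log T /
      ((T : ℝ) ^ LocStat.theta d s β * h T ^ (d + 1))) atTop (𝓝 0))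
    (hband₂ : Tendsto (fun T : ℕ => 1 / ((T : ℝ) ^ min ρ 1 * h T ^ ((d : ℝ) + min ρ 1)))
      atTop (𝓝 0)) :
    LocStat.IsBigOInProb P
      (fun T ω => ⨆ u ∈ Icc (C₁ * h T) (1 - C₁ * h T), ⨆ x ∈ S,
        ENNReal.ofReal |LocStat.nadarayaWatson K X Y (h T) T u x ω - m u x|)
      (fun T => Real.sqrt (Real.log T / (T * h T ^ (d + 1))) +
        1 / ((T : ℝ) ^ min ρ 1 * h T ^ d) + h T ^ 2) := by
  obtain ⟨c, hc, hcf⟩ := hf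
  obtain ⟨ξ, C, hξ, -, hC⟩ := hpoly
  -- Only h → 0 is drawn from the polynomial bound on the bandwidth.
  exact LocStat.isBigOInProb_nadarayaWatson hmodel hC1 hC2 hC4 hC5 hC6 hK0_one hK1_one hK2_one
    hK0_err hK1_err hK2_err hβ hS hc hcf hpos
    (LocStat.tendsto_zero_of_le_const_mul_rpow hpos hξ hC) hband₁ hband₂
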